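/- Let $k$ be a commutative ring. For an essentially small $k$-linear category $\mathbf{a}$, let $\mathsf{PSh}\,\mathbf{a}$ be the category of $k$-linear functors $\mathbf{a}^{\mathrm{op}}\to\mathsf{Mod}_k$, with Yoneda embedding $\mathtt{Y}:\mathbf{a}\to\mathsf{PSh}\,\mathbf{a}$. A *formal sequence* $\amalg_\gamma Z_\gamma\xrightarrow{p}\amalg_\beta Y_\beta\xrightarrow{q}X$ in $\mathbf{a}$ consists of objects $X, Y_\beta, Z_\gamma$ (indexed by sets) and elements $q\in\prod_\beta\mathbf{a}(Y_\beta,X)$, $p\in\prod_\gamma\bigoplus_\beta\mathbf{a}(Z_\gamma,Y_\beta)$ with $q\circ p=0$. For a class $\mathcal{S}$ of formal sequences, $\mathsf{Sh}_{\mathcal{S}}\mathbf{a}\subset\mathsf{PSh}\,\mathbf{a}$ is the full subcategory of those $F$ for which $0\to F(X)\to\prod_\beta F(Y_\beta)\to\prod_\gamma F(Z_\gamma)$ is exact for every sequence in $\mathcal{S}$. A *localisation* is a fully faithful additive functor with a left adjoint (the sheafification) that preserves finite limits. A *creator* is a $k$-linear functor $u:\mathbf{a}\to\mathbf{C}$ such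 that $\mathbf{C}\to\mathsf{PSh}\,\mathbf{a}$, $M\mapsto\mathbf{C}(u-,M)$, is a localisation; it is *$\kappa$-compact* if every $u(X)$ is a $\kappa$-compact object, that is, $\mathbf{C}(u(X),-)$ commutes with $\kappa$-filtered colimits. Let $\mathbf{A}$ and $\mathbf{B}$ be $k$-linear Grothendieck categories with realisations $\mathbf{A}\simeq\mathsf{Sh}_{\mathcal{S}_1}\mathbf{a}$ and $\mathbf{B}\simeq\mathsf{Sh}_{\mathcal{S}_2}\mathbf{b}$, that is: $\mathbf{a},\mathbf{b}$ are essentially small $k$-linear categories, $\mathcal{S}_1,\mathcal{S}_2$ are classes of formal sequences in $\mathbf{a}$ and $\mathbf{b}$ for which the inclusions $\mathsf{Sh}_{\mathcal{S}_1}\mathbf{a}\subset\mathsf{PSh}\,\mathbf{a}$ and $\mathsf{Sh}_{\mathcal{S}_2}\mathbf{b}\subset\mathsf{PSh}\,\mathbf{b}$ are localisations, and the equivalences are $k$-linear. Let $\mathbf{a}\to\mathbf{A}$ and $\mathbf{b}\to\mathbf{B}$ be the functors given by the Yoneda embedding followed by sheafification. Let $\mathbf{a}\otimes\mathbf{b}$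 be the $k$-linear category whose objects are pairs $(X,Y)$ and whose morphisms are $\mathbf{a}(X,X')\otimes_k\mathbf{b}(Y,Y')$, and let $\mathbf{A}\boxtimes\mathbf{B}$ be the full subcategory of $\mathsf{PSh}(\mathbf{a}\otimes\mathbf{b})$ of the functors $F$ for which $$0\to F(X,A)\to\prod_\beta F(Y_\beta,A)\to\prod_\gamma F(Z_\gamma,A),\qquad 0\to F(X,A)\to\prod_\beta F(X,B_\beta)\to\prod_\gamma F(X,C_\gamma)$$ are exact for all $X\in\mathbf{a}$, $A\in\mathbf{b}$, all $\amalg_\gamma Z_\gamma\to\amalg_\beta Y_\beta\to X$ in $\mathcal{S}_1$ and all $\amalg_\gamma C_\gamma\to\amalg_\beta B_\beta\to A$ in $\mathcal{S}_2$. Then: (i) The inclusion $\mathbf{A}\boxtimes\mathbf{B}\subset\mathsf{PSh}(\mathbf{a}\otimes\mathbf{b})$ is a localisation; in particular $\mathbf{A}\boxtimes\mathbf{B}$ is a Grothendieck category. (ii) $\mathbf{A}\boxtimes\mathbf{B}$ is the Kelly tensor product of $\mathbf{A}$ and $\mathbf{B}$: it is cocomplete, and there is a functor $T:\mathbf{A}\times\mathbf{B}\to\mathbf{A}\boxtimes\mathbf{B}$,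 $k$-linear and cocontinuous in each variable and extending (up to isomorphism) the canonical functor $\mathbf{a}\times\mathbf{b}\to\mathbf{a}\otimes\mathbf{b}\to\mathbf{A}\boxtimes\mathbf{B}$, such that for every locally small cocomplete $k$-linear category $\mathbf{D}$ precomposition with $T$ is an equivalence from the category of $k$-linear cocontinuous functors $\mathbf{A}\boxtimes\mathbf{B}\to\mathbf{D}$ to the category of functors $\mathbf{A}\times\mathbf{B}\to\mathbf{D}$ that are $k$-linear and cocontinuous in each variable. In particular $\mathbf{A}\boxtimes\mathbf{B}$ does not depend on the realisations: for any other realisations of $\mathbf{A}$ and $\mathbf{B}$, with generating categories $\mathbf{a}'$ and $\mathbf{b}'$ and resulting category $(\mathbf{A}\boxtimes\mathbf{B})'$, there is a $k$-linear equivalence $E:\mathbf{A}\boxtimes\mathbf{B}\simeq(\mathbf{A}\boxtimes\mathbf{B})'$ such that $E\circ T$ extends the canonical functor $\mathbf{a}'\times\mathbf{b}'\to\mathbf{a}'\otimes\mathbf{b}'\to(\mathbf{A}\boxtimes\mathbf{B})'$. (iii) If $\mathbf{a}\to\mathbf{A}$ and $\mathbf{b}\to\mathbf{B}$ are $\kappa$-compact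 creators for an infinite regular cardinal $\kappa$, then so is $\mathbf{a}\otimes\mathbf{b}\to\mathbf{A}\boxtimes\mathbf{B}$. -/

import Mathlib

open CategoryTheory CategoryTheory.Limits Opposite
open scoped TensorProduct

universe v w w' u u₁ u₂ u₃ u₄ u₅ u₆ v₁ v₂

noncomputable section

namespace LinSh

/-! ### Linear presheaves -/

section Presheaves

variable (k : Type v) [CommRing k] (a : Type u) [Category.{v} a] [Preadditive a] [Linear k a]

/-- The property of a functor `aᵒᵖ ⥤ ModuleCat k` of being `k`-linear. -/
def isLinearPresheaf : ObjectProperty (aᵒᵖ ⥤ ModuleCat.{v} k) :=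
  fun F => F.Additive ∧ ∀ ⦃X Y : a⦄ (f : X ⟶ Y) (r : k), F.map (r • f).op = r • F.map f.op

/-- `PSh a`: the category of `k`-linear functors `aᵒᵖ ⥤ ModuleCat k`. -/
abbrev PSh : Type (max u (v + 1)) := (isLinearPresheaf k a).FullSubcategory

/-- The Yoneda embedding `a ⥤ PSh a`. -/
def yonedaPSh : a ⥤ PSh k a :=
  (isLinearPresheaf k a).lift (linearYoneda k a) fun X =>
    ⟨inferInstance, fun _ _ f r => by
      ext g
      exact Linear.smul_comp _ _ _ r f g⟩

end Presheaves

/-! ### Formal sequences and the associated sheaf condition -/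

/-- A formal sequence `∐ Z_γ ⟶ ∐ Y_β ⟶ X` with composite zero. A formal morphism
`∐ Z_γ ⟶ ∐ Y_β` is an element of `∏_γ ⨁_β Hom(Z_γ, Y_β)`. -/
structure FormalSeq (a : Type u) [Category.{v} a] [Preadditive a] where
  X : a
  β : Type v
  Y : β → a
  γ : Type v
  Z : γ → a
  q : ∀ j, Y j ⟶ X
  p : ∀ i j, Z i ⟶ Y j
  finite : ∀ i, {j | p i j ≠ 0}.Finite
  comp_eq_zero : ∀ i, ∑ᶠ j, p i j ≫ q j = 0

namespace FormalSeq

variable {k : Type v} [CommRing k] {a : Type u} [Category.{v} a] [Preadditive a]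
  (s : FormalSeq a) (F : aᵒᵖ ⥤ ModuleCat.{v} k)

/-- The map `F(X) → ∏_β F(Y_β)`. -/
def evalQ : F.obj (op s.X) → ∀ j, F.obj (op (s.Y j)) :=
  fun x j => (F.map (s.q j).op).hom x

/-- The map `∏_β F(Y_β) → ∏_γ F(Z_γ)`. -/
def evalP : (∀ j, F.obj (op (s.Y j))) → ∀ i, F.obj (op (s.Z i)) :=
  fun y i => ∑ᶠ j, (F.map (s.p i j).op).hom (y j)

/-- Exactness of `0 → F(X) → ∏_β F(Y_β) → ∏_γ F(Z_γ)`. -/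
def ExactOn : Prop :=
  Function.Injective (s.evalQ F) ∧ Function.Exact (s.evalQ F) (s.evalP F)

end FormalSeq

/-- The presheaves satisfying the sheaf condition for every sequence in the class `S`. -/
def isSheafFor (k : Type v) [CommRing k] {a : Type u} [Category.{v} a] [Preadditive a]
    [Linear k a] (S : Set (FormalSeq.{v} a)) : ObjectProperty (PSh k a) :=
  fun F => ∀ s ∈ S, s.ExactOn F.obj

/-- `Sh_S a`, as a full subcategory of `PSh a`. -/
abbrev Sh (k : Type v) [CommRing k] {a : Type u} [Category.{v} a] [Preadditive a]
    [Linear k a] (S : Set (FormalSeq.{v} a)) : Type (max u (v + 1)) :=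
  (isSheafFor k S).FullSubcategory

/-! ### Localisations and creators -/

section Localisations

/-- A localisation: a fully faithful additive functor with a left adjoint that preserves
finite limits. -/
structure IsLocalisation {C : Type u₁} [Category.{v₁} C] [Preadditive C] {B : Type u₂}
    [Category.{v₂} B] [Preadditive B] (I : C ⥤ B) : Prop where
  full : I.Full
  faithful : I.Faithful
  additive : I.Additive
  exists_leftAdjoint : ∃ L : B ⥤ C, Nonempty (L ⊣ I) ∧ PreservesFiniteLimits L

/-- A preadditive category is a Grothendieck category if it is abelian, with exact filtered
colimits and a generator. -/
def IsGrothendieckCat (C : Type u₁) [Category.{v₁} C] [inst : Preadditive C] : Prop :=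
  ∃ hab : Abelian C, hab.toPreadditive = inst ∧ @IsGrothendieckAbelian.{v} C _ hab

/-- The sheafification: a left adjoint of a localisation. -/
def IsLocalisation.sheafification {C : Type u₁} [Category.{v₁} C] [Preadditive C] {B : Type u₂}
    [Category.{v₂} B] [Preadditive B] {I : C ⥤ B} (h : IsLocalisation I) : B ⥤ C :=
  h.exists_leftAdjoint.choose

variable {k : Type v} [CommRing k] {a : Type u} [Category.{v} a] [Preadditive a] [Linear k a]

/-- The functor `a ⥤ C` obtained by composing the Yoneda embedding with the sheafification, for
a full subcategory `C` of `PSh a` whose inclusion is a localisation. -/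
def genFunctor {P : ObjectProperty (PSh k a)} (h : IsLocalisation P.ι) :
    a ⥤ P.FullSubcategory :=
  yonedaPSh k a ⋙ h.sheafification

variable (k)

/-- A creator: a `k`-linear functor `u : a ⥤ C` for which the functor `C ⥤ PSh a`,
`M ↦ C(u -, M)` is a localisation. This functor is given up to isomorphism as a functor `R`
with `k`-linear isomorphisms `C(u X, M) ≃ R(M)(X)` natural in `X` and `M`. -/
def IsCreator {C : Type u₁} [Category.{v₁} C] [Preadditive C] [Linear k C]
    (G : a ⥤ C) : Prop :=
  G.Additive ∧ Functor.Linear k G ∧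
    ∃ (R : C ⥤ PSh k a) (e : ∀ (X : a) (M : C), (G.obj X ⟶ M) ≃ₗ[k] (R.obj M).obj.obj (op X)),
      (∀ (X : a) (M N : C) (g : M ⟶ N) (f : G.obj X ⟶ M),
        e X N (f ≫ g) = ((R.map g).hom.app (op X)).hom (e X M f)) ∧
      (∀ (X Y : a) (h : X ⟶ Y) (M : C) (f : G.obj Y ⟶ M),
        e X M (G.map h ≫ f) = ((R.obj M).obj.map h.op).hom (e Y M f)) ∧
      IsLocalisation R

/-- A `κ`-compact creator: a creator taking values in `κ`-compact objects. -/
def IsCompactCreator (κ : Cardinal.{v}) [Fact κ.IsRegular] {C : Type u₁} [Category.{v₁} C]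
    [Preadditive C] [Linear k C] (G : a ⥤ C) : Prop :=
  IsCreator k G ∧ ∀ X, IsCardinalPresentable (G.obj X) κ

/-- A realisation of `A` as the sheaf category `Sh_S a`: the latter is a localisation of
`PSh a`, and it comes with a `k`-linear equivalence with `A`. -/
structure Realisation (A : Type u₁) [Category.{v₁} A] [Preadditive A] [Linear k A]
    (S : Set (FormalSeq.{v} a)) where
  localisation : IsLocalisation (isSheafFor k S).ι
  equiv : A ≌ Sh k S
  additive : equiv.functor.Additive
  linear : Functor.Linear k equiv.functor

/-- The generating functor `a ⥤ Sh_S a ≌ A` of a realisation. -/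
def Realisation.gen {k : Type v} [CommRing k] {a : Type u} [Category.{v} a] [Preadditive a]
    [Linear k a] {A : Type u₁} [Category.{v₁} A] [Preadditive A] [Linear k A]
    {S : Set (FormalSeq.{v} a)} (R : Realisation k A S) : a ⥤ A :=
  genFunctor R.localisation ⋙ R.equiv.inverse

end Localisations

/-! ### The tensor product of two linear categories -/

section Tensor

variable (k : Type v) [CommRing k] (a : Type u₁) [Category.{v} a] [Preadditive a] [Linear k a]
  (b : Type u₂) [Category.{v} b] [Preadditive b] [Linear k b]

/-- Objects of `a ⊗ b`: pairs of objects. -/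
structure TensorCat (k : Type v) (a : Type u₁) (b : Type u₂) where
  left : a
  right : b

namespace TensorCat

variable {k a b}

/-- Composition in `a ⊗ b`, as a bilinear map: `(f ⊗ g) ≫ (f' ⊗ g') = (f ≫ f') ⊗ (g ≫ g')`. -/
def compHom (P Q R : TensorCat k a b) :
    ((P.left ⟶ Q.left) ⊗[k] (P.right ⟶ Q.right)) →ₗ[k]
      ((Q.left ⟶ R.left) ⊗[k] (Q.right ⟶ R.right)) →ₗ[k]
        ((P.left ⟶ R.left) ⊗[k] (P.right ⟶ R.right)) :=
  TensorProduct.map₂ (Linear.comp P.left Q.left R.left) (Linear.comp P.right Q.right R.right)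

@[simp]
theorem compHom_tmul (P Q R : TensorCat k a b) (f : P.left ⟶ Q.left) (g : P.right ⟶ Q.right)
    (f' : Q.left ⟶ R.left) (g' : Q.right ⟶ R.right) :
    compHom P Q R (f ⊗ₜ g) (f' ⊗ₜ g') = (f ≫ f') ⊗ₜ (g ≫ g') := rfl

instance : Category.{v} (TensorCat k a b) where
  Hom P Q := (P.left ⟶ Q.left) ⊗[k] (P.right ⟶ Q.right)
  id P := 𝟙 P.left ⊗ₜ 𝟙 P.right
  comp {P Q R} x y := compHom P Q R x y
  id_comp {P Q} x := by
    induction x using TensorProduct.induction_on with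
    | zero => simp
    | tmul f g => simp
    | add x y hx hy => rw [map_add, hx, hy]
  comp_id {P Q} x := by
    induction x using TensorProduct.induction_on with
    | zero => simp
    | tmul f g => simp
    | add x y hx hy => rw [map_add, LinearMap.add_apply, hx, hy]
  assoc {P Q R T} x y z := by
    induction x using TensorProduct.induction_on with
    | zero => simp
    | add x x' hx hx' => simp only [map_add, LinearMap.add_apply, hx, hx']
    | tmul f g =>
      induction y using TensorProduct.induction_on with
      | zero => simp
      | add y y' hy hy' => simp only [map_add, LinearMap.add_apply, hy, hy']
      | tmul f' g' =>
        induction z using TensorProduct.induction_on with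
        | zero => simp
        | add z z' hz hz' => simp only [map_add, hz, hz']
        | tmul f'' g'' => simp

theorem comp_def {P Q R : TensorCat k a b} (x : P ⟶ Q) (y : Q ⟶ R) :
    x ≫ y = compHom P Q R x y := rfl

instance : Preadditive (TensorCat k a b) where
  homGroup P Q :=
    inferInstanceAs (AddCommGroup ((P.left ⟶ Q.left) ⊗[k] (P.right ⟶ Q.right)))
  add_comp P Q R x x' y := LinearMap.map_add₂ (compHom P Q R) x x' y
  comp_add P Q R x y y' := (compHom P Q R x).map_add y y'

instance : Linear k (TensorCat k a b) where
  homModule P Q :=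
    inferInstanceAs (Module k ((P.left ⟶ Q.left) ⊗[k] (P.right ⟶ Q.right)))
  smul_comp P Q R r x y := LinearMap.map_smul₂ (compHom P Q R) r x y
  comp_smul P Q R x r y := (compHom P Q R x).map_smul r y

/-- The morphism `f ⊗ g` of `a ⊗ b`. -/
def homTmul {X X' : a} {Y Y' : b} (f : X ⟶ X') (g : Y ⟶ Y') :
    (⟨X, Y⟩ : TensorCat k a b) ⟶ ⟨X', Y'⟩ :=
  (f ⊗ₜ[k] g : (X ⟶ X') ⊗[k] (Y ⟶ Y'))

variable (k a b)

/-- The canonical functor `a × b ⥤ a ⊗ b`, `(f, g) ↦ f ⊗ g`. -/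
def pair : a × b ⥤ TensorCat k a b where
  obj P := ⟨P.1, P.2⟩
  map φ := homTmul φ.1 φ.2
  map_id _ := rfl
  map_comp _ _ := rfl

end TensorCat

end Tensor

/-! ### The product `A ⊠ B` -/

section Box

variable {k : Type v} [CommRing k] {a : Type u₁} [Category.{v} a] [Preadditive a] [Linear k a]
  {b : Type u₂} [Category.{v} b] [Preadditive b] [Linear k b]

/-- The presheaf `F(-, B)` on `a`. -/
def sliceLeft (F : (TensorCat k a b)ᵒᵖ ⥤ ModuleCat.{v} k) (B : b) : aᵒᵖ ⥤ ModuleCat.{v} k :=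
  (Prod.sectL a B ⋙ TensorCat.pair k a b).op ⋙ F

/-- The presheaf `F(A, -)` on `b`. -/
def sliceRight (F : (TensorCat k a b)ᵒᵖ ⥤ ModuleCat.{v} k) (A : a) : bᵒᵖ ⥤ ModuleCat.{v} k :=
  (Prod.sectR A b ⋙ TensorCat.pair k a b).op ⋙ F

/-- The presheaves on `a ⊗ b` satisfying the sheaf condition in each variable. -/
def isBoxSheaf (k : Type v) [CommRing k] {a : Type u₁} [Category.{v} a] [Preadditive a]
    [Linear k a] {b : Type u₂} [Category.{v} b] [Preadditive b] [Linear k b]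
    (S₁ : Set (FormalSeq.{v} a)) (S₂ : Set (FormalSeq.{v} b)) :
    ObjectProperty (PSh k (TensorCat k a b)) :=
  fun F => (∀ s ∈ S₁, ∀ B : b, s.ExactOn (sliceLeft F.obj B)) ∧
    (∀ s ∈ S₂, ∀ A : a, s.ExactOn (sliceRight F.obj A))

/-- `A ⊠ B`, as a full subcategory of `PSh (a ⊗ b)`. -/
abbrev Box (k : Type v) [CommRing k] {a : Type u₁} [Category.{v} a] [Preadditive a]
    [Linear k a] {b : Type u₂} [Category.{v} b] [Preadditive b] [Linear k b]
    (S₁ : Set (FormalSeq.{v} a)) (S₂ : Set (FormalSeq.{v} b)) : Type (max u₁ u₂ (v + 1)) :=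
  (isBoxSheaf k S₁ S₂).FullSubcategory

end Box

/-! ### The Kelly tensor product of cocomplete linear categories -/

section Kelly

variable (k : Type v) [CommRing k]

/-- The `k`-linear functors that preserve all small (`v`-small) colimits. -/
def isLinCocont (C : Type u₁) [Category.{v₁} C] [Preadditive C] [Linear k C]
    (D : Type u₂) [Category.{v₂} D] [Preadditive D] [Linear k D] : ObjectProperty (C ⥤ D) :=
  fun F => F.Additive ∧ Functor.Linear k F ∧ PreservesColimitsOfSize.{v, v} F

/-- The functors `A × B ⥤ D` that are `k`-linear and preserve small colimits in each
variable. -/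
def isLinCocont₂ (A : Type u₁) [Category.{v₁} A] [Preadditive A] [Linear k A]
    (B : Type u₂) [Category.{v₂} B] [Preadditive B] [Linear k B]
    (D : Type u₃) [Category.{w} D] [Preadditive D] [Linear k D] : ObjectProperty (A × B ⥤ D) :=
  fun F => (∀ Y : B, isLinCocont k A D (Prod.sectL A Y ⋙ F)) ∧
    (∀ X : A, isLinCocont k B D (Prod.sectR X B ⋙ F))

variable {A : Type u₁} [Category.{v₁} A] [Preadditive A] [Linear k A]
  {B : Type u₂} [Category.{v₂} B] [Preadditive B] [Linear k B]
  {C : Type u₃} [Category.{w} C] [Preadditive C] [Linear k C]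

variable {k} in
theorem isLinCocont₂.comp {T : A × B ⥤ C} (hT : isLinCocont₂ k A B C T)
    {D : Type u₄} [Category.{w'} D] [Preadditive D] [Linear k D] {H : C ⥤ D}
    (hH : isLinCocont k C D H) : isLinCocont₂ k A B D (T ⋙ H) := by
  obtain ⟨_, _, _⟩ := hH
  refine ⟨fun Y => ?_, fun X => ?_⟩
  · obtain ⟨_, _, _⟩ := hT.1 Y
    exact ⟨inferInstanceAs ((Prod.sectL A Y ⋙ T) ⋙ H).Additive,
      inferInstanceAs (Functor.Linear k ((Prod.sectL A Y ⋙ T) ⋙ H)),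
      inferInstanceAs (PreservesColimitsOfSize.{v, v} ((Prod.sectL A Y ⋙ T) ⋙ H))⟩
  · obtain ⟨_, _, _⟩ := hT.2 X
    exact ⟨inferInstanceAs ((Prod.sectR X B ⋙ T) ⋙ H).Additive,
      inferInstanceAs (Functor.Linear k ((Prod.sectR X B ⋙ T) ⋙ H)),
      inferInstanceAs (PreservesColimitsOfSize.{v, v} ((Prod.sectR X B ⋙ T) ⋙ H))⟩

variable {k} in
/-- Precomposition with `T`, from the category `[C, D]_cc` of `k`-linear cocontinuous functors to
the category of functors `A × B ⥤ D` that are `k`-linear and cocontinuous in each variable. -/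
def precomp {T : A × B ⥤ C} (hT : isLinCocont₂ k A B C T)
    (D : Type u₄) [Category.{w'} D] [Preadditive D] [Linear k D] :
    (isLinCocont k C D).FullSubcategory ⥤ (isLinCocont₂ k A B D).FullSubcategory :=
  (isLinCocont₂ k A B D).lift
    ((isLinCocont k C D).ι ⋙ (Functor.whiskeringLeft (A × B) C D).obj T)
    fun H => hT.comp H.property

/-- `T : A × B ⥤ C` exhibits the cocomplete `k`-linear category `C` as the Kelly tensor product
of `A` and `B`: it is `k`-linear and cocontinuous in each variable, and precomposition with `T`
is an equivalence for every locally small cocomplete `k`-linear category `D`. -/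
def IsKellyProduct (T : A × B ⥤ C) : Prop :=
  HasColimitsOfSize.{v, v} C ∧
    ∃ hT : isLinCocont₂ k A B C T,
      ∀ (D : Type u₄) [Category.{w'} D] [Preadditive D] [Linear k D] [LocallySmall.{v} D]
        [HasColimitsOfSize.{v, v} D], (precomp hT D).IsEquivalence

end Kelly

/-- `T : A × B ⥤ A ⊠ B` extends the canonical functor `a × b ⥤ a ⊗ b ⥤ A ⊠ B`. -/
def ExtendsGen {k : Type v} [CommRing k]
    {a : Type u₁} [Category.{v} a] [Preadditive a] [Linear k a]
    {b : Type u₂} [Category.{v} b] [Preadditive b] [Linear k b]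
    {A : Type u₃} [Category.{v₁} A] [Preadditive A] [Linear k A]
    {B : Type u₄} [Category.{v₂} B] [Preadditive B] [Linear k B]
    {S₁ : Set (FormalSeq.{v} a)} {S₂ : Set (FormalSeq.{v} b)}
    (R₁ : Realisation k A S₁) (R₂ : Realisation k B S₂)
    (h : IsLocalisation (isBoxSheaf k S₁ S₂).ι) (T : A × B ⥤ Box k S₁ S₂) : Prop :=
  Nonempty (R₁.gen.prod R₂.gen ⋙ T ≅ TensorCat.pair k a b ⋙ genFunctor h)

end LinSh

end

noncomputable section

namespace LinSh

/-! ### Injective hulls in Grothendieck categories -/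

section Hull

variable {P : Type u₁} [Category.{v₁} P] [Abelian P]

/-- A subobject `N` of `I` meets the image of `j : M ⟶ I` trivially. -/
def DisjointFrom {M I : P} (j : M ⟶ I) (N : Subobject I) : Prop :=
  ∀ ⦃X : P⦄ (x : X ⟶ N) (y : X ⟶ M), x ≫ N.arrow = y ≫ j → y ≫ j = 0

theorem disjointFrom_iff_of_mk {M I N : P} (j : M ⟶ I) (f : N ⟶ I) [Mono f] :
    DisjointFrom j (Subobject.mk f) ↔
      ∀ ⦃X : P⦄ (x : X ⟶ N) (y : X ⟶ M), x ≫ f = y ≫ j → y ≫ j = 0 := by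
  constructor
  · intro h X x y hxy
    exact h (x ≫ (Subobject.underlyingIso f).inv) y (by simpa using hxy)
  · intro h X x y hxy
    exact h (x ≫ (Subobject.underlyingIso f).hom) y (by simpa using hxy)

attribute [local instance] IsFiltered.isConnected in
theorem exists_maximal_disjointFrom [IsGrothendieckAbelian.{w} P] {M I : P} (j : M ⟶ I) :
    ∃ N : Subobject I, Maximal (DisjointFrom j) N := by
  refine zorn_le₀ {N | DisjointFrom j N} fun c hc hch => ?_
  rcases c.eq_empty_or_nonempty with rfl | ⟨n₀, hn₀⟩
  · refine ⟨⊥, fun X x y hxy => ?_, by simp⟩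
    rw [← hxy]; simp
  let e : Shrink.{w} (Subobject I) ≃ Subobject I := (equivShrink _).symm
  let J : Type w := {x : Shrink.{w} (Subobject I) // e x ∈ c}
  let φ : J → Subobject I := fun x => e x.1
  let _ : Preorder J := Preorder.lift φ
  have : Nonempty J := ⟨⟨e.symm n₀, by simpa using hn₀⟩⟩
  have : IsDirectedOrder J := ⟨fun x y => by
    rcases hch.total x.2 y.2 with h | h
    · exact ⟨y, h, le_rfl⟩
    · exact ⟨x, le_rfl, h⟩⟩
  have hφ : Monotone φ := fun _ _ h => h
  let F : J ⥤ MonoOver I := hφ.functor ⋙ Subobject.representative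
  let D := F ⋙ MonoOver.forget _ ⋙ Over.forget _
  let t : Cocone D := ⟨I, { app := fun x => (F.obj x).obj.hom
                            naturality := fun x y f => by simp [D] }⟩
  let f : colimit D ⟶ I := colimit.desc D t
  have hf : ∀ x, colimit.ι D x ≫ f = (F.obj x).obj.hom := fun x => colimit.ι_desc _ _
  have : Mono f := IsGrothendieckAbelian.mono_of_isColimit_monoOver F (colimit.isColimit D) f hf
  have hrep : ∀ x : J, (F.obj x).obj.hom = (φ x).arrow := fun x => rfl
  refine ⟨Subobject.mk f, ?_, ?_⟩
  · refine (disjointFrom_iff_of_mk j f).2 fun X x y hxy => ?_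
    rw [← hxy]
    refine (colimit.isColimit D).pullback_zero_ext fun n => ?_
    have h1 : pullback.fst (colimit.ι D n) x ≫ (φ n).arrow =
        (pullback.snd (colimit.ι D n) x ≫ y) ≫ j := by
      rw [← hrep, ← hf, pullback.condition_assoc, hxy, Category.assoc]
    have h2 := hc n.2 _ _ h1
    change pullback.snd (colimit.ι D n) x ≫ x ≫ f = 0
    rw [hxy, ← Category.assoc, h2]
  · intro N hN
    let n : J := ⟨e.symm N, by simpa using hN⟩
    have hn : φ n = N := by simp [φ, n]
    rw [← hn]
    exact Subobject.le_mk_of_comm (colimit.ι D n) (hf n)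

theorem mono_comp_cokernel_π {M I : P} (j : M ⟶ I) [Mono j] {N : Subobject I}
    (hN : Maximal (DisjointFrom j) N) : Mono (j ≫ cokernel.π N.arrow) := by
  refine Preadditive.mono_of_cancel_zero _ fun {X} x hx => ?_
  have h : N.Factors (x ≫ j) := by
    have hk := Abelian.monoIsKernelOfCokernel _ (cokernelIsCokernel N.arrow)
    refine (Subobject.factors_iff _ _).2 ⟨hk.lift (KernelFork.ofι (x ≫ j) (by simpa using hx)), ?_⟩
    exact hk.fac _ WalkingParallelPair.zero
  have := hN.1 (N.factorThru _ h) x (by simp)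
  exact zero_of_comp_mono j this

/-- The quotient by a maximal subobject disjoint from `M` is an essential extension of `M`. -/
theorem eq_zero_of_disjoint_quotient {M I : P} (j : M ⟶ I) [Mono j] {N : Subobject I}
    (hN : Maximal (DisjointFrom j) N) {X : P} (v : X ⟶ cokernel N.arrow)
    (h : ∀ ⦃X' : P⦄ (p : X' ⟶ X) (m : X' ⟶ M), p ≫ v = m ≫ j ≫ cokernel.π N.arrow → p ≫ v = 0) :
    v = 0 := by
  have := mono_comp_cokernel_π j hN
  let g := cokernel.π N.arrow ≫ cokernel.π v
  have hdisj : DisjointFrom j (Subobject.mk (kernel.ι g)) := by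
    refine (disjointFrom_iff_of_mk _ _).2 fun Z x y hxy => ?_
    have h0 : (y ≫ j ≫ cokernel.π N.arrow) ≫ cokernel.π v = 0 := by
      have : (x ≫ kernel.ι g) ≫ g = 0 := by simp
      rw [hxy] at this
      simpa [g] using this
    obtain ⟨Z', π, hπ, q, hq⟩ := (ShortComplex.exact_iff_exact_up_to_refinements
      (ShortComplex.mk v (cokernel.π v) (by simp))).1 (ShortComplex.exact_cokernel v)
        (y ≫ j ≫ cokernel.π N.arrow) h0
    dsimp at q hq
    have h1 := h q (π ≫ y) (by rw [← hq, Category.assoc])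
    rw [h1] at hq
    have h2 : y = 0 := by
      rw [← cancel_mono (j ≫ cokernel.π N.arrow), ← cancel_epi π]
      simpa using hq
    rw [h2, zero_comp]
  have hle : N ≤ Subobject.mk (kernel.ι g) :=
    Subobject.le_mk_of_comm (kernel.lift g N.arrow (by simp [g])) (by simp)
  have hle' := hN.2 hdisj hle
  have hz : kernel.ι g ≫ cokernel.π N.arrow = 0 := by
    have := Subobject.ofMkLE_arrow hle'
    rw [← this, Category.assoc, cokernel.condition, comp_zero]
  obtain ⟨X', π, hπ, q, hq⟩ := surjective_up_to_refinements_of_epi (cokernel.π N.arrow) v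
  have h3 : q ≫ g = 0 := by
    simp only [g]
    rw [← Category.assoc, ← hq, Category.assoc, cokernel.condition, comp_zero]
  rw [← cancel_epi π, hq, ← kernel.lift_ι g q h3, Category.assoc, hz, comp_zero, comp_zero]

theorem injective_quotient_of_maximal {M I : P} (j : M ⟶ I) {N : Subobject I}
    (hN : Maximal (DisjointFrom j) N) [IsGrothendieckAbelian.{w} P] [Injective I] :
    Injective (cokernel N.arrow) := by
  obtain ⟨N', hN'⟩ := exists_maximal_disjointFrom.{w} N.arrow
  have hm := mono_comp_cokernel_π N.arrow hN'
  let r : cokernel N'.arrow ⟶ I := Injective.factorThru N.arrow (N.arrow ≫ cokernel.π N'.arrow)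
  have hr : N.arrow ≫ cokernel.π N'.arrow ≫ r = N.arrow := by
    rw [← Category.assoc]; exact Injective.comp_factorThru _ _
  have hr0 : ∀ ⦃X : P⦄ (v : X ⟶ cokernel N'.arrow) (y : X ⟶ M), v ≫ r = y ≫ j → v = 0 := by
    intro X v y hvy
    refine eq_zero_of_disjoint_quotient N.arrow hN' v fun X' p n hn => ?_
    have h1 : n ≫ N.arrow = (p ≫ y) ≫ j := by
      rw [← hr, ← Category.assoc, ← Category.assoc, Category.assoc n, ← hn, Category.assoc, hvy,
        Category.assoc]
    have h2 := hN.1 n (p ≫ y) h1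
    rw [hn, ← Category.assoc, h1, h2, zero_comp]
  have : Mono r := Preadditive.mono_of_cancel_zero _ fun {X} v hv => hr0 v 0 (by simpa using hv)
  have hle : N ≤ Subobject.mk r :=
    Subobject.le_mk_of_comm (N.arrow ≫ cokernel.π N'.arrow) (by simpa using hr)
  have hle' := hN.2 ((disjointFrom_iff_of_mk j r).2 fun X x y hxy => by
    rw [← hxy, hr0 x y hxy, zero_comp]) hle
  let s : I ⟶ (N : P) := cokernel.π N'.arrow ≫ Subobject.ofMkLE r N hle'
  have hs : N.arrow ≫ s = 𝟙 _ := by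
    rw [← cancel_mono N.arrow]
    simp [s, hr]
  let t : cokernel N.arrow ⟶ I := cokernel.desc N.arrow (𝟙 I - s ≫ N.arrow) (by
    rw [Preadditive.comp_sub, ← Category.assoc, hs]; simp)
  have ht : t ≫ cokernel.π N.arrow = 𝟙 _ := by
    rw [← cancel_epi (cokernel.π N.arrow)]
    simp [t]
  exact ⟨fun {X Y} g f _ => ⟨Injective.factorThru (g ≫ t) f ≫ cokernel.π N.arrow, by
    rw [← Category.assoc, Injective.comp_factorThru, Category.assoc, ht, Category.comp_id]⟩⟩

theorem exists_injectiveHull [IsGrothendieckAbelian.{w} P] (M : P) :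
    ∃ (E : P) (i : M ⟶ E), Injective E ∧ Mono i ∧ ∀ ⦃X : P⦄ (v : X ⟶ E),
      (∀ ⦃X' : P⦄ (p : X' ⟶ X) (m : X' ⟶ M), p ≫ v = m ≫ i → p ≫ v = 0) → v = 0 := by
  obtain ⟨N, hN⟩ := exists_maximal_disjointFrom.{w} (Injective.ι M)
  exact ⟨_, Injective.ι M ≫ cokernel.π N.arrow, injective_quotient_of_maximal.{w} _ hN,
    mono_comp_cokernel_π _ hN, fun X v h => eq_zero_of_disjoint_quotient _ hN v h⟩

end Hull

end LinSh

namespace LinSh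

section Reflection

variable {C : Type u₁} [Category.{v₁} C] {Q : ObjectProperty C} {L : C ⥤ Q.FullSubcategory}

theorem exists_transpose (adj : L ⊣ Q.ι) {F E : C} (hE : Q E) (g : F ⟶ E) :
    ∃ g' : (L.obj F).obj ⟶ E, adj.unit.app F ≫ g' = g := by
  have h := (adj.homEquiv F ⟨E, hE⟩).apply_symm_apply g
  rw [adj.homEquiv_unit] at h
  exact ⟨_, h⟩

theorem eq_of_unit_comp_eq (adj : L ⊣ Q.ι) {F E : C} (hE : Q E)
    {g g' : (L.obj F).obj ⟶ E} (h : adj.unit.app F ≫ g = adj.unit.app F ≫ g') : g = g' := by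
  have := (adj.homEquiv F ⟨E, hE⟩).injective (a₁ := Q.homMk g) (a₂ := Q.homMk g') (by
    rw [adj.homEquiv_unit, adj.homEquiv_unit]; exact h)
  exact congrArg (·.hom) this

theorem unit_comp_map (adj : L ⊣ Q.ι) {F G : C} (f : F ⟶ G) :
    adj.unit.app F ≫ (L.map f).hom = f ≫ adj.unit.app G := (adj.unit.naturality f).symm

end Reflection

section Gabriel

variable {P : Type u₁} [Category.{v₁} P] [Abelian P]

/-- `g` factors through `f` if it vanishes on the kernel of `f` and has injective target. -/
theorem exists_factor_of_injective {X Y E : P} (f : X ⟶ Y) (g : X ⟶ E) [Injective E]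
    (h : kernel.ι f ≫ g = 0) : ∃ g' : Y ⟶ E, f ≫ g' = g :=
  ⟨(ShortComplex.exact_kernel f).descToInjective g h,
    (ShortComplex.exact_kernel f).comp_descToInjective g h⟩

variable (W : MorphismProperty P)

/-- `M` is separated for the class of morphisms `W`. -/
def IsSep (M : P) : Prop :=
  ∀ ⦃U V : P⦄ (i : U ⟶ V), W i → ∀ g : V ⟶ M, i ≫ g = 0 → g = 0

/-- The injective separated objects. -/
def IsInjSep (E : P) : Prop := Injective E ∧ IsSep W E

variable {W}

theorem isSep_of_isLocal {M : P} (h : W.isLocal M) : IsSep W M := fun _ _ i hi g hg =>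
  (h i hi).1 (by simpa using hg)

theorem IsInjSep.isLocal (hW : W ≤ MorphismProperty.monomorphisms P) {E : P}
    (h : IsInjSep W E) : W.isLocal E := fun U V i hi => by
  have := h.1
  have : Mono i := hW i hi
  refine ⟨fun g g' hg => ?_, fun g => ⟨Injective.factorThru g i, Injective.comp_factorThru g i⟩⟩
  rw [← sub_eq_zero]
  refine h.2 i hi _ ?_
  rw [Preadditive.comp_sub, sub_eq_zero]
  exact hg

/-- The quotient of a separated object by a local subobject is separated. -/
theorem isSep_of_exact [W.IsStableUnderBaseChange] {M E D : P} (i : M ⟶ E) (f : E ⟶ D) [Mono i]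
    [Epi f] (hif : i ≫ f = 0) (hex : (ShortComplex.mk i f hif).Exact) (hM : W.isLocal M)
    (hE : IsSep W E) : IsSep W D := by
  intro U V w hw v hv
  let fV := pullback.fst v f
  let fE := pullback.snd v f
  have hU : W (pullback.snd w fV) := W.pullback_snd _ _ hw
  let l : pullback w fV ⟶ M := hex.lift (pullback.snd w fV ≫ fE) (by
    simp only [Category.assoc, fE]
    rw [← pullback.condition, ← pullback.condition_assoc, hv, comp_zero])
  have hl : l ≫ i = pullback.snd w fV ≫ fE := hex.lift_f _ _
  obtain ⟨m, hm⟩ := (hM _ hU).2 l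
  dsimp at hm
  have h1 : fE = m ≫ i := by
    rw [← sub_eq_zero]
    refine hE _ hU _ ?_
    rw [Preadditive.comp_sub, ← hl, ← Category.assoc, hm, sub_self]
  rw [← cancel_epi fV, comp_zero]
  change pullback.fst v f ≫ v = 0
  rw [pullback.condition]
  change fE ≫ f = 0
  rw [h1, Category.assoc, hif, comp_zero]

variable [IsGrothendieckAbelian.{w} P]

theorem IsSep.exists_mono [W.IsStableUnderBaseChange] {M : P} (h : IsSep W M) :
    ∃ (E : P) (i : M ⟶ E), IsInjSep W E ∧ Mono i := by
  obtain ⟨E, j, hE, hj, hess⟩ := exists_injectiveHull.{w} M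
  refine ⟨E, j, ⟨hE, fun U V i hi g hg => hess g fun X p m hpm => ?_⟩, hj⟩
  have h1 : W (pullback.snd i p) := W.pullback_snd _ _ hi
  have h2 : pullback.snd i p ≫ m = 0 := by
    rw [← cancel_mono j, Category.assoc, ← hpm, ← pullback.condition_assoc, hg]; simp
  rw [hpm, h _ h1 m h2, zero_comp]

theorem IsInjSep.pi {J : Type w} (E : J → P) (h : ∀ j, IsInjSep W (E j)) :
    IsInjSep W (∏ᶜ E) := by
  have := fun j => (h j).1
  refine ⟨inferInstance, fun U V i hi g hg => Pi.hom_ext _ _ fun j => ?_⟩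
  rw [zero_comp]
  exact (h j).2 i hi _ (by rw [← Category.assoc, hg, zero_comp])

/-- Every object has a preenvelope by injective separated objects. -/
theorem exists_preenvelope (W : MorphismProperty P) (F : P) :
    ∃ (E : P) (f : F ⟶ E), IsInjSep W E ∧
      ∀ (E' : P) (g : F ⟶ E'), IsInjSep W E' → ∃ g' : E ⟶ E', f ≫ g' = g := by
  let e : Shrink.{w} (Subobject F) ≃ Subobject F := (equivShrink _).symm
  let J : Type w := {x : Shrink.{w} (Subobject F) //
    ∃ (E : P) (g : F ⟶ E), IsInjSep W E ∧ e x = kernelSubobject g}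
  choose E g hE hg using fun x : J => x.2
  refine ⟨∏ᶜ E, Pi.lift g, IsInjSep.pi E hE, fun E' g' hE' => ?_⟩
  have := hE'.1
  refine exists_factor_of_injective _ _ ?_
  let x : J := ⟨e.symm (kernelSubobject g'), E', g', hE', by simp⟩
  have hx : kernelSubobject g' = kernelSubobject (g x) := by rw [← hg x]; simp [x]
  have h1 : kernel.ι (Pi.lift g) ≫ g x = 0 := by
    have := kernel.condition (Pi.lift g)
    rw [show g x = Pi.lift g ≫ Pi.π E x by simp, ← Category.assoc, this, zero_comp]
  have h2 : (kernelSubobject (g x)).Factors (kernel.ι (Pi.lift g)) :=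
    kernelSubobject_factors _ _ h1
  rw [← hx] at h2
  rw [← Subobject.factorThru_arrow _ _ h2, Category.assoc, kernelSubobject_arrow_comp, comp_zero]

/-- A local object is the kernel of a morphism between injective separated objects. -/
theorem exists_copresentation [W.IsStableUnderBaseChange] {M : P} (hM : W.isLocal M) :
    ∃ (E E' : P) (i : M ⟶ E) (f : E ⟶ E') (_ : Mono i) (hif : i ≫ f = 0),
      IsInjSep W E ∧ IsInjSep W E' ∧ (ShortComplex.mk i f hif).Exact := by
  obtain ⟨E, i, hE, hi⟩ := (isSep_of_isLocal hM).exists_mono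
  obtain ⟨E', i', hE', hi'⟩ := (isSep_of_exact i (cokernel.π i) (cokernel.condition i)
    (ShortComplex.exact_cokernel i) hM hE.2).exists_mono
  refine ⟨E, E', i, cokernel.π i ≫ i', hi, by simp, hE, hE', ?_⟩
  have := (ShortComplex.exact_cokernel i)
  rw [ShortComplex.exact_iff_exact_up_to_refinements] at this ⊢
  intro A x hx
  exact this x (by rw [← cancel_mono i']; simpa using hx)

/-- Every object has a reflection in the local objects. -/
theorem exists_reflection (hW : W ≤ MorphismProperty.monomorphisms P)
    [W.IsStableUnderBaseChange] (F : P) :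
    ∃ (L : P) (η : F ⟶ L), W.isLocal L ∧
      ∀ M : P, W.isLocal M → Function.Bijective fun g : L ⟶ M => η ≫ g := by
  obtain ⟨E, f, hE, hf⟩ := exists_preenvelope W F
  obtain ⟨E₁, c, hE₁, hc⟩ := exists_preenvelope W (cokernel f)
  let d := cokernel.π f ≫ c
  let η : F ⟶ kernel d := kernel.lift d f (by simp [d])
  have hη : η ≫ kernel.ι d = f := kernel.lift_ι _ _ _
  have hsurj : ∀ (E' : P), IsInjSep W E' → ∀ g : F ⟶ E', ∃ g' : kernel d ⟶ E', η ≫ g' = g := by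
    intro E' hE' g
    obtain ⟨g', hg'⟩ := hf E' g hE'
    exact ⟨kernel.ι d ≫ g', by rw [← Category.assoc, hη, hg']⟩
  have hinj : ∀ (E' : P), IsSep W E' → ∀ g : kernel d ⟶ E', η ≫ g = 0 → g = 0 := by
    intro E' hE' g hg
    obtain ⟨E'', j, hE'', hj⟩ := hE'.exists_mono
    have := hE''.1
    rw [← cancel_mono j, zero_comp]
    let g₁ := Injective.factorThru (g ≫ j) (kernel.ι d)
    have hg₁ : kernel.ι d ≫ g₁ = g ≫ j := Injective.comp_factorThru _ _
    have h0 : f ≫ g₁ = 0 := by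
      rw [← hη, Category.assoc, hg₁, ← Category.assoc, hg, zero_comp]
    obtain ⟨g₂, hg₂⟩ := hc E'' (cokernel.desc f g₁ h0) hE''
    have : g₁ = d ≫ g₂ := by simp [d, hg₂]
    rw [← hg₁, this, ← Category.assoc, kernel.condition, zero_comp]
  refine ⟨kernel d, η, fun U V i hi => ?_, fun M hM => ⟨fun g g' hg => ?_, fun g => ?_⟩⟩
  · have hloc := hE.isLocal hW i hi
    refine ⟨fun x y hxy => ?_, fun x => ?_⟩
    · rw [← cancel_mono (kernel.ι d)]
      refine hloc.1 ?_
      dsimp at hxy ⊢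
      rw [← Category.assoc, hxy, Category.assoc]
    · obtain ⟨y, hy⟩ := hloc.2 (x ≫ kernel.ι d)
      dsimp at hy
      refine ⟨kernel.lift d y (hE₁.2 i hi _ ?_), ?_⟩
      · rw [← Category.assoc, hy, Category.assoc, kernel.condition, comp_zero]
      · rw [← cancel_mono (kernel.ι d)]
        simpa using hy
  · rw [← sub_eq_zero]
    refine hinj M (isSep_of_isLocal hM) _ ?_
    rw [Preadditive.comp_sub, sub_eq_zero]
    exact hg
  · obtain ⟨E₂, E₃, i, m, hi, him, hE₂, hE₃, hex⟩ := exists_copresentation.{w} hM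
    obtain ⟨y, hy⟩ := hsurj E₂ hE₂ (g ≫ i)
    have hym : y ≫ m = 0 := hinj E₃ hE₃.2 _ (by
      rw [← Category.assoc, hy, Category.assoc, him, comp_zero])
    refine ⟨hex.lift y hym, ?_⟩
    rw [← cancel_mono i]
    dsimp
    rw [Category.assoc]
    have : hex.lift y hym ≫ i = y := hex.lift_f _ _
    rw [this, hy]

theorem isRightAdjoint_ι_isLocal (hW : W ≤ MorphismProperty.monomorphisms P)
    [W.IsStableUnderBaseChange] : W.isLocal.ι.IsRightAdjoint := by
  choose L η hL hη using exists_reflection.{w} (W := W) hW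
  exact (Adjunction.adjunctionOfEquivLeft (F_obj := fun F => ⟨L F, hL F⟩)
    (fun F M => W.isLocal.fullyFaithfulι.homEquiv.trans (Equiv.ofBijective _ (hη F _ M.property)))
    (fun F M M' g f => by
      simp [Functor.FullyFaithful.homEquiv])).isRightAdjoint

variable {L : P ⥤ W.isLocal.FullSubcategory}

theorem mono_map_of_mono (hW : W ≤ MorphismProperty.monomorphisms P)
    [W.IsStableUnderBaseChange] (adj : L ⊣ W.isLocal.ι) {F G : P} (u : F ⟶ G) [Mono u] :
    Mono (L.map u).hom := by
  obtain ⟨E, j, hE, hj⟩ := (isSep_of_isLocal (L.obj F).property).exists_mono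
  have := hE.1
  obtain ⟨g', hg'⟩ := exists_transpose adj (hE.isLocal hW)
    (Injective.factorThru (adj.unit.app F ≫ j) u)
  have h : (L.map u).hom ≫ g' = j := eq_of_unit_comp_eq adj (hE.isLocal hW) (by
    rw [← Category.assoc, unit_comp_map, Category.assoc, hg', Injective.comp_factorThru])
  exact mono_of_mono_fac h

theorem exists_lift_map_kernel (hW : W ≤ MorphismProperty.monomorphisms P)
    [W.IsStableUnderBaseChange] (adj : L ⊣ W.isLocal.ι) {F G X : P} (f : F ⟶ G)
    (x : X ⟶ (L.obj F).obj) (hx : x ≫ (L.map f).hom = 0) :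
    ∃ y : X ⟶ (L.obj (kernel f)).obj, y ≫ (L.map (kernel.ι f)).hom = x := by
  let k := (L.map (kernel.ι f)).hom
  have : Mono k := mono_map_of_mono hW adj _
  obtain ⟨E, j, hE, hj⟩ := (isSep_of_exact k (cokernel.π k) (cokernel.condition k)
    (ShortComplex.exact_cokernel k) (L.obj _).property
    (isSep_of_isLocal (L.obj F).property)).exists_mono
  have := hE.1
  obtain ⟨g, hg⟩ := exists_factor_of_injective f (adj.unit.app F ≫ cokernel.π k ≫ j) (by
    rw [← Category.assoc, ← unit_comp_map]
    change (_ ≫ k) ≫ _ = 0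
    rw [Category.assoc, cokernel.condition_assoc, zero_comp, comp_zero])
  obtain ⟨g', hg'⟩ := exists_transpose adj (hE.isLocal hW) g
  have h : (L.map f).hom ≫ g' = cokernel.π k ≫ j := eq_of_unit_comp_eq adj (hE.isLocal hW) (by
    rw [← Category.assoc, unit_comp_map, Category.assoc, hg', hg])
  have hx' : x ≫ cokernel.π k = 0 := by
    rw [← cancel_mono j, Category.assoc, ← h, ← Category.assoc, hx, zero_comp, zero_comp]
  exact ⟨(ShortComplex.exact_cokernel k).lift x hx', (ShortComplex.exact_cokernel k).lift_f x hx'⟩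

/-- The local objects for a class of monomorphisms stable under base change in a Grothendieck
category form a localisation. -/
theorem isLocalisation_isLocal (hW : W ≤ MorphismProperty.monomorphisms P)
    [W.IsStableUnderBaseChange] : IsLocalisation W.isLocal.ι := by
  have := isRightAdjoint_ι_isLocal.{w} hW
  let L := W.isLocal.ι.leftAdjoint
  let adj : L ⊣ W.isLocal.ι := Adjunction.ofIsRightAdjoint _
  refine ⟨inferInstance, inferInstance, inferInstance, L, ⟨adj⟩, ?_⟩
  have : L.Additive := adj.left_adjoint_additive
  have : ∀ {F G : P} (f : F ⟶ G), PreservesLimit (parallelPair f 0) L := fun {F G} f => by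
    have h0 : L.map (kernel.ι f) ≫ L.map f = 0 := by
      rw [← L.map_comp, kernel.condition, L.map_zero]
    have : Mono (L.map (kernel.ι f)) := W.isLocal.ι.mono_of_mono_map
      (mono_map_of_mono hW adj (kernel.ι f))
    refine preservesLimit_of_preserves_limit_cone (kernelIsKernel f)
      ((isLimitMapConeForkEquiv' L (kernel.condition f)).symm
        (KernelFork.IsLimit.ofι' (L.map (kernel.ι f)) h0 fun {X} x hx => ?_))
    have := exists_lift_map_kernel hW adj f x.hom (congrArg (·.hom) hx)
    exact ⟨W.isLocal.homMk this.choose, W.isLocal.hom_ext this.choose_spec⟩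
  have : HasFiniteProducts W.isLocal.FullSubcategory := ⟨fun n => inferInstance⟩
  have : HasZeroObject W.isLocal.FullSubcategory := hasZeroObject_of_hasTerminal_object
  exact L.preservesFiniteLimits_of_preservesKernels

end Gabriel

end LinSh

namespace LinSh

section PShAbelian

variable {k : Type v} [CommRing k] {c : Type u} [Category.{v} c] [Preadditive c] [Linear k c]

instance (J : Type u₁) [Category.{v₁} J] [HasLimitsOfShape J (ModuleCat.{v} k)] :
    (isLinearPresheaf k c).IsClosedUnderLimitsOfShape J where
  limitsOfShape_le := by
    rintro F ⟨h⟩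
    have hl := fun X => isLimitOfPreserves ((evaluation cᵒᵖ (ModuleCat.{v} k)).obj X) h.isLimit
    refine ⟨⟨fun {X Y f g} => (hl Y).hom_ext fun j => ?_⟩, fun X Y f r => (hl _).hom_ext fun j => ?_⟩
    · have := (h.prop_diag_obj j).1
      have e := fun f => (h.π.app j).naturality (X := X) (Y := Y) f
      dsimp at e ⊢
      rw [Preadditive.add_comp, e, e, e, Functor.map_add, Preadditive.comp_add]
    · have e := fun f => (h.π.app j).naturality (X := op Y) (Y := op X) f
      dsimp at e ⊢
      rw [Linear.smul_comp, e, e, (h.prop_diag_obj j).2, Linear.comp_smul]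

instance (J : Type u₁) [Category.{v₁} J] [HasColimitsOfShape J (ModuleCat.{v} k)] :
    (isLinearPresheaf k c).IsClosedUnderColimitsOfShape J where
  colimitsOfShape_le := by
    rintro F ⟨h⟩
    have hl := fun X => isColimitOfPreserves ((evaluation cᵒᵖ (ModuleCat.{v} k)).obj X) h.isColimit
    refine ⟨⟨fun {X Y f g} => (hl X).hom_ext fun j => ?_⟩, fun X Y f r => (hl _).hom_ext fun j => ?_⟩
    · have := (h.prop_diag_obj j).1
      have e := fun f => (h.ι.app j).naturality (X := X) (Y := Y) f
      dsimp at e ⊢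
      rw [Preadditive.comp_add, ← e, ← e, ← e, Functor.map_add, Preadditive.add_comp]
    · have e := fun f => (h.ι.app j).naturality (X := op Y) (Y := op X) f
      dsimp at e ⊢
      rw [Linear.comp_smul, ← e, ← e, (h.prop_diag_obj j).2, Linear.smul_comp]

instance : HasColimitsOfSize.{v, v} (PSh k c) := ⟨fun _ _ => inferInstance⟩

instance : HasFiniteLimits (PSh k c) := ⟨fun _ _ _ => inferInstance⟩

instance preservesLimitsOfShape_ι (J : Type u₁) [Category.{v₁} J]
    [HasLimitsOfShape J (ModuleCat.{v} k)] :
    PreservesLimitsOfShape J (isLinearPresheaf k c).ι :=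
  inferInstance

instance preservesColimitsOfShape_ι (J : Type u₁) [Category.{v₁} J]
    [HasColimitsOfShape J (ModuleCat.{v} k)] :
    PreservesColimitsOfShape J (isLinearPresheaf k c).ι :=
  inferInstance

instance preservesFiniteLimits_ι : PreservesFiniteLimits (isLinearPresheaf k c).ι :=
  ⟨fun _ _ _ => inferInstance⟩

instance : (isLinearPresheaf k c).ContainsZero where
  exists_zero := ⟨_, isZero_zero _, ObjectProperty.prop_of_isLimit _
    (HasZeroObject.zeroIsTerminal (C := cᵒᵖ ⥤ ModuleCat.{v} k)) (by rintro ⟨⟨⟩⟩)⟩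

instance : (isLinearPresheaf k c).IsClosedUnderKernels where
  kernels_le := by
    rintro _ ⟨f, t, ht, h₁, h₂⟩
    exact ObjectProperty.prop_of_isLimit _ ht (by rintro (_ | _) <;> assumption)

instance : (isLinearPresheaf k c).IsClosedUnderCokernels where
  cokernels_le := by
    rintro _ ⟨f, t, ht, h₁, h₂⟩
    exact ObjectProperty.prop_of_isColimit _ ht (by rintro (_ | _) <;> assumption)

instance : (isLinearPresheaf k c).IsClosedUnderFiniteProducts where

instance : Abelian (PSh k c) where

instance [EssentiallySmall.{v} c] : LocallySmall.{v} (PSh k c) :=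
  locallySmall_of_faithful ((isLinearPresheaf k c).ι ⋙
    (Functor.whiskeringLeft _ _ _).obj (equivSmallModel.{v} cᵒᵖ).inverse)

instance : AB5OfSize.{v, v} (PSh k c) where
  ofShape J _ _ := HasExactColimitsOfShape.domain_of_functor J (isLinearPresheaf k c).ι

end PShAbelian

end LinSh

namespace LinSh

section Yoneda

variable {k : Type v} [CommRing k] {c : Type u} [Category.{v} c] [Preadditive c] [Linear k c]

instance (F : PSh k c) : F.obj.Additive := F.property.1

@[ext]
theorem PSh.hom_ext {F G : PSh k c} {f g : F ⟶ G}
    (h : ∀ (X : c) (x : F.obj.obj (op X)), (f.hom.app (op X)).hom x = (g.hom.app (op X)).hom x) :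
    f = g := by
  apply ObjectProperty.hom_ext
  ext X x
  exact h _ x

theorem PSh.naturality_apply {F G : PSh k c} (f : F ⟶ G) {X Y : c} (h : X ⟶ Y)
    (x : F.obj.obj (op Y)) :
    (f.hom.app (op X)).hom ((F.obj.map h.op).hom x) =
      (G.obj.map h.op).hom ((f.hom.app (op Y)).hom x) :=
  ConcreteCategory.congr_hom (f.hom.naturality h.op) x

theorem PSh.map_add_apply (F : PSh k c) {X Y : c} (f g : X ⟶ Y) (x : F.obj.obj (op Y)) :
    (F.obj.map (f + g).op).hom x = (F.obj.map f.op).hom x + (F.obj.map g.op).hom x := by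
  rw [op_add, F.obj.map_add]; rfl

theorem PSh.map_smul_apply (F : PSh k c) {X Y : c} (r : k) (f : X ⟶ Y) (x : F.obj.obj (op Y)) :
    (F.obj.map (r • f).op).hom x = r • (F.obj.map f.op).hom x := by
  rw [F.property.2]; rfl

/-- Constructor for morphisms of linear presheaves. -/
@[simps! hom]
def PSh.mkHom {F G : PSh k c} (φ : ∀ X : c, F.obj.obj (op X) →ₗ[k] G.obj.obj (op X))
    (h : ∀ {X Y : c} (f : X ⟶ Y) (x : F.obj.obj (op Y)),
      φ X ((F.obj.map f.op).hom x) = (G.obj.map f.op).hom (φ Y x)) : F ⟶ G :=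
  ObjectProperty.homMk
    { app := fun X => ModuleCat.ofHom (φ X.unop)
      naturality := fun X Y f => by
        ext x
        exact h f.unop x }

/-- Morphisms `Z ⟶ X` as elements of the presheaf represented by `X`. -/
def yonedaElt {Z X : c} : (Z ⟶ X) ≃ₗ[k] ((yonedaPSh k c).obj X).obj.obj (op Z) :=
  LinearEquiv.refl k (Z ⟶ X)

theorem yonedaElt_comp {Z' Z X : c} (f : Z' ⟶ Z) (h : Z ⟶ X) :
    yonedaElt (k := k) (f ≫ h) =
      (((yonedaPSh k c).obj X).obj.map f.op).hom (yonedaElt h) := rfl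

/-- The Yoneda lemma for linear presheaves. -/
def yonedaEquivPSh (X : c) (F : PSh k c) : ((yonedaPSh k c).obj X ⟶ F) ≃ₗ[k] F.obj.obj (op X) where
  toFun f := (f.hom.app (op X)).hom (yonedaElt (𝟙 X))
  invFun s := PSh.mkHom (F := (yonedaPSh k c).obj X)
    (fun Z => { toFun := fun h => (F.obj.map (yonedaElt.symm h : Z ⟶ X).op).hom s
                map_add' := fun f g => by rw [map_add]; exact F.map_add_apply _ _ s
                map_smul' := fun r f => by rw [map_smul]; exact F.map_smul_apply _ _ s })
    (fun {Z Z'} f h => by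
      obtain ⟨h, rfl⟩ := yonedaElt.surjective h
      change (F.obj.map (f ≫ h).op).hom s = (F.obj.map f.op).hom ((F.obj.map h.op).hom s)
      rw [op_comp, F.obj.map_comp]; rfl)
  left_inv f := by
    refine PSh.hom_ext fun Z h => ?_
    obtain ⟨h, rfl⟩ := yonedaElt.surjective h
    change (F.obj.map h.op).hom ((f.hom.app (op X)).hom (yonedaElt (𝟙 X))) = _
    rw [← PSh.naturality_apply, ← yonedaElt_comp, Category.comp_id]
  right_inv s := by
    change (F.obj.map (𝟙 X).op).hom s = s
    rw [op_id, F.obj.map_id]; rfl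
  map_add' f g := rfl
  map_smul' r f := rfl

theorem yonedaEquivPSh_comp {X : c} {F G : PSh k c} (f : (yonedaPSh k c).obj X ⟶ F) (g : F ⟶ G) :
    yonedaEquivPSh X G (f ≫ g) = (g.hom.app (op X)).hom (yonedaEquivPSh X F f) := rfl

theorem yonedaEquivPSh_symm_comp {X : c} {F G : PSh k c} (x : F.obj.obj (op X)) (g : F ⟶ G) :
    (yonedaEquivPSh X F).symm x ≫ g = (yonedaEquivPSh X G).symm ((g.hom.app (op X)).hom x) := by
  apply (yonedaEquivPSh X G).injective
  rw [yonedaEquivPSh_comp, LinearEquiv.apply_symm_apply, LinearEquiv.apply_symm_apply]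

theorem yonedaEquivPSh_map {X Y : c} {F : PSh k c} (h : X ⟶ Y) (f : (yonedaPSh k c).obj Y ⟶ F) :
    yonedaEquivPSh X F ((yonedaPSh k c).map h ≫ f) =
      (F.obj.map h.op).hom (yonedaEquivPSh Y F f) := by
  change (f.hom.app (op X)).hom (yonedaElt (𝟙 X ≫ h)) =
    (F.obj.map h.op).hom ((f.hom.app (op Y)).hom (yonedaElt (𝟙 Y)))
  rw [← PSh.naturality_apply, ← yonedaElt_comp, Category.id_comp, Category.comp_id]

theorem yonedaEquivPSh_symm_map {X Y : c} {F : PSh k c} (h : X ⟶ Y) (x : F.obj.obj (op Y)) :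
    (yonedaEquivPSh X F).symm ((F.obj.map h.op).hom x) =
      (yonedaPSh k c).map h ≫ (yonedaEquivPSh Y F).symm x := by
  apply (yonedaEquivPSh X F).injective
  rw [yonedaEquivPSh_map, LinearEquiv.apply_symm_apply, LinearEquiv.apply_symm_apply]

instance : (yonedaPSh k c).Additive where
  map_add {X _ f g} := PSh.hom_ext fun Z (h : Z ⟶ X) => Preadditive.comp_add _ _ _ h f g

instance : (yonedaPSh k c).Linear k where
  map_smul {X _} f r := PSh.hom_ext fun Z (h : Z ⟶ X) => Linear.comp_smul _ _ _ h r f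

variable (k c) in
/-- The representable presheaves, indexed by a small model. -/
def smallYoneda [EssentiallySmall.{v} c] (X : SmallModel.{v} c) : PSh k c :=
  (yonedaPSh k c).obj ((equivSmallModel.{v} c).inverse.obj X)

variable (k c) in
theorem isSeparating_smallYoneda [EssentiallySmall.{v} c] :
    (ObjectProperty.ofObj (smallYoneda k c)).IsSeparating := by
  intro F G f g h
  have h' : ∀ (X : c) (x : (yonedaPSh k c).obj X ⟶ F), x ≫ f = x ≫ g := by
    intro X x
    let e : (yonedaPSh k c).obj X ≅ smallYoneda k c ((equivSmallModel.{v} c).functor.obj X) :=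
      (yonedaPSh k c).mapIso ((equivSmallModel.{v} c).unitIso.app X)
    rw [← cancel_epi e.inv]
    have := h _ (ObjectProperty.ofObj_apply _ ((equivSmallModel.{v} c).functor.obj X)) (e.inv ≫ x)
    rw [Category.assoc, Category.assoc] at this
    exact this
  refine PSh.hom_ext fun X x => ?_
  obtain ⟨y, rfl⟩ := (yonedaEquivPSh X F).surjective x
  rw [← yonedaEquivPSh_comp, ← yonedaEquivPSh_comp, h']

instance [EssentiallySmall.{v} c] : IsGrothendieckAbelian.{v} (PSh k c) where
  hasSeparator := by
    have := (isSeparating_smallYoneda k c).isSeparator_coproduct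
    exact ⟨_, this⟩

/-- A class of presheaves that contains the representable ones and is closed under colimits
contains all presheaves. -/
theorem PSh.induction_colimits [EssentiallySmall.{v} c] (Q : ObjectProperty (PSh k c))
    (hY : ∀ X, Q ((yonedaPSh k c).obj X))
    (hQ : ∀ (ι : Type v) (f : ι → PSh k c), (∀ i, Q (f i)) → Q (∐ f))
    (hQ' : ∀ ⦃A B : PSh k c⦄ (f : A ⟶ B) (t : CokernelCofork f), IsColimit t → Q A → Q B → Q t.pt)
    (F : PSh k c) : Q F := by
  have hcov : ∀ F : PSh k c, ∃ (S : PSh k c) (p : S ⟶ F), Q S ∧ Epi p := by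
    intro F
    let ι : Type v := Σ X : SmallModel.{v} c, Shrink.{v} (smallYoneda k c X ⟶ F)
    let f : ∀ i : ι, smallYoneda k c i.1 ⟶ F := fun i => (equivShrink _).symm i.2
    refine ⟨∐ fun i : ι => smallYoneda k c i.1, Sigma.desc f,
      hQ _ _ fun i => hY _, ⟨fun g h hgh => ?_⟩⟩
    refine isSeparating_smallYoneda k c g h ?_
    rintro _ ⟨X⟩ x
    have := Sigma.ι (fun i : ι => smallYoneda k c i.1) ⟨X, equivShrink _ x⟩ ≫= hgh
    simpa [f] using this
  obtain ⟨S, p, hS, hp⟩ := hcov F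
  obtain ⟨S', p', hS', hp'⟩ := hcov (kernel p)
  have h1 := isCokernelEpiComp (Abelian.epiIsCokernelOfKernel _ (kernelIsKernel p)) p' rfl
  exact hQ' _ _ h1 hS' hS

end Yoneda

section Localisation

variable {P : Type u₁} [Category.{v₁} P] [Abelian P] [IsGrothendieckAbelian.{w} P]

theorem IsLocalisation.isGrothendieckCat {Q : ObjectProperty P} (h : IsLocalisation Q.ι) :
    IsGrothendieckCat.{w} Q.FullSubcategory := by
  obtain ⟨_, _, _, L, ⟨adj⟩, _⟩ := h
  let _ : Reflective Q.ι := ⟨L, adj⟩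
  have : HasFiniteLimits Q.FullSubcategory := ⟨fun _ _ _ => hasLimitsOfShape_of_reflective Q.ι⟩
  have : HasColimitsOfSize.{w, w} Q.FullSubcategory := hasColimits_of_reflective Q.ι
  have : L.Additive := adj.left_adjoint_additive
  let hab : Abelian Q.FullSubcategory := abelianOfAdjunction Q.ι L (asIso adj.counit) adj
  refine ⟨hab, rfl, ?_⟩
  have : LocallySmall.{w} Q.FullSubcategory := locallySmall_of_faithful Q.ι
  have : AB5OfSize.{w, w} Q.FullSubcategory := ⟨fun J _ _ => adj.hasExactColimitsOfShape J⟩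
  have : HasSeparator Q.FullSubcategory := ⟨L.obj (separator P), (isSeparator_def _).2
    fun X Y f g h => Q.ι.map_injective ((isSeparator_separator P).def _ _ fun x => by
      apply (adj.homEquiv _ _).symm.injective
      rw [adj.homEquiv_naturality_right_symm, adj.homEquiv_naturality_right_symm, h])⟩
  exact {}

theorem IsLocalisation.hasColimits {Q : ObjectProperty P} (h : IsLocalisation Q.ι) :
    HasColimitsOfSize.{w, w} Q.FullSubcategory := by
  obtain ⟨_, _, _, L, ⟨adj⟩, _⟩ := h
  let _ : Reflective Q.ι := ⟨L, adj⟩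
  exact hasColimits_of_reflective Q.ι

end Localisation

section Tensor

variable (k : Type v) [CommRing k] (a : Type u₁) [Category.{v} a] [Preadditive a] [Linear k a]
  (b : Type u₂) [Category.{v} b] [Preadditive b] [Linear k b]

instance [EssentiallySmall.{v} a] [EssentiallySmall.{v} b] :
    EssentiallySmall.{v} (TensorCat k a b) := by
  rw [essentiallySmall_iff]
  refine ⟨?_, inferInstance⟩
  let f : SmallModel.{v} a × SmallModel.{v} b → Skeleton (TensorCat k a b) := fun P =>
    toSkeleton ((TensorCat.pair k a b).obj
      ((equivSmallModel a).inverse.obj P.1, (equivSmallModel b).inverse.obj P.2))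
  refine small_of_surjective (f := f) fun S => ?_
  obtain ⟨⟨X, Y⟩, rfl⟩ : ∃ T, toSkeleton T = S := Quotient.exists_rep S
  refine ⟨((equivSmallModel a).functor.obj X, (equivSmallModel b).functor.obj Y), ?_⟩
  refine toSkeleton_eq_toSkeleton_iff.2 ⟨(TensorCat.pair k a b).mapIso (Iso.prod ?_ ?_)⟩
  · exact ((equivSmallModel a).unitIso.app X).symm
  · exact ((equivSmallModel b).unitIso.app Y).symm

end Tensor

end LinSh

namespace LinSh

section Nerve

variable {k : Type v} [CommRing k] {c : Type u} [Category.{v} c] [Preadditive c] [Linear k c]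
  {D : Type u₄} [Category.{w'} D] [Preadditive D] [Linear k D] [LocallySmall.{v} D]

variable (k) in
/-- Morphisms `X ⟶ Y` in a locally small linear category, as a small module. -/
abbrev smallHom (X Y : D) : ModuleCat.{v} k := ModuleCat.of k (Shrink.{v} (X ⟶ Y))

variable (k) in
/-- Morphisms as elements of `smallHom`. -/
def smallHomEquiv (X Y : D) : (X ⟶ Y) ≃ₗ[k] smallHom k X Y :=
  (Shrink.linearEquiv.{v} k (X ⟶ Y)).symm

variable (G : c ⥤ D) [G.Additive] [Functor.Linear k G]

variable (k) in
/-- The presheaf `D(G -, d)`. -/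
def nerveObj (d : D) : PSh k c where
  obj :=
    { obj := fun X => smallHom k (G.obj X.unop) d
      map := fun {X Y} f => ModuleCat.ofHom ((smallHomEquiv k (G.obj Y.unop) d).toLinearMap ∘ₗ
        Linear.leftComp k d (G.map f.unop) ∘ₗ (smallHomEquiv k (G.obj X.unop) d).symm.toLinearMap)
      map_id := fun X => by ext x; simp
      map_comp := fun f g => by ext x; simp }
  property := ⟨⟨fun {X Y f g} => by ext x; simp⟩, fun X Y f r => by ext x; simp⟩

variable (k) in
/-- Elements of the presheaf `nerveObj k G d`. -/
def nerveObjElt (X : c) (d : D) : (G.obj X ⟶ d) ≃ₗ[k] (nerveObj k G d).obj.obj (op X) :=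
  smallHomEquiv k _ _

theorem nerveObjElt_comp {X Y : c} (f : X ⟶ Y) {d : D} (g : G.obj Y ⟶ d) :
    nerveObjElt k G X d (G.map f ≫ g) =
      ((nerveObj k G d).obj.map f.op).hom (nerveObjElt k G Y d g) := by
  change _ = smallHomEquiv k _ _ (G.map f ≫ (smallHomEquiv k _ _).symm (smallHomEquiv k _ _ g))
  rw [LinearEquiv.symm_apply_apply]; rfl

variable (k) in
/-- The functor `d ↦ D(G -, d)`. -/
def nerve : D ⥤ PSh k c where
  obj := nerveObj k G
  map {d d'} h := PSh.mkHom (fun X => (nerveObjElt k G X d').toLinearMap ∘ₗ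
        Linear.rightComp k (G.obj X) h ∘ₗ (nerveObjElt k G X d).symm.toLinearMap)
    (fun {X Y} f x => by
      obtain ⟨x, rfl⟩ := (nerveObjElt k G Y d).surjective x
      simp [← nerveObjElt_comp])
  map_id d := by ext X x; simp
  map_comp f g := by ext X x; simp

variable (k) in
/-- Elements of the presheaf `D(G -, d)`. -/
def nerveElt (X : c) (d : D) : (G.obj X ⟶ d) ≃ₗ[k] ((nerve k G).obj d).obj.obj (op X) :=
  nerveObjElt k G X d

theorem nerveElt_comp {X Y : c} (f : X ⟶ Y) {d : D} (g : G.obj Y ⟶ d) :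
    nerveElt k G X d (G.map f ≫ g) =
      (((nerve k G).obj d).obj.map f.op).hom (nerveElt k G Y d g) :=
  nerveObjElt_comp G f g

theorem nerveElt_comp' {X : c} {d d' : D} (g : G.obj X ⟶ d) (h : d ⟶ d') :
    nerveElt k G X d' (g ≫ h) = (((nerve k G).map h).hom.app (op X)).hom (nerveElt k G X d g) := by
  change _ = nerveElt k G X d' ((nerveElt k G X d).symm (nerveElt k G X d g) ≫ h)
  rw [LinearEquiv.symm_apply_apply]

instance : (nerve k G).Additive where
  map_add {d d' f g} := PSh.hom_ext fun X x => by
    obtain ⟨x, rfl⟩ := (nerveElt k G X d).surjective x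
    change _ = (((nerve k G).map f).hom.app _).hom _ + (((nerve k G).map g).hom.app _).hom _
    rw [← nerveElt_comp', ← nerveElt_comp', ← nerveElt_comp', Preadditive.comp_add, map_add]

instance : (nerve k G).Linear k where
  map_smul {d d'} f r := PSh.hom_ext fun X x => by
    obtain ⟨x, rfl⟩ := (nerveElt k G X d).surjective x
    change _ = r • (((nerve k G).map f).hom.app _).hom _
    rw [← nerveElt_comp', ← nerveElt_comp', Linear.comp_smul, map_smul]

/-- A natural family of linear maps `F X → D(G X, d)` as a morphism of presheaves. -/
def homToNerve {F : PSh k c} {d : D} (t : ∀ X, F.obj.obj (op X) →ₗ[k] (G.obj X ⟶ d))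
    (ht : ∀ {X Y : c} (f : X ⟶ Y) (x : F.obj.obj (op Y)),
      t X ((F.obj.map f.op).hom x) = G.map f ≫ t Y x) : F ⟶ (nerve k G).obj d :=
  PSh.mkHom (fun X => (nerveElt k G X d).toLinearMap ∘ₗ t X) (fun {X Y} f x => by
    rw [LinearMap.comp_apply, ht]
    exact nerveElt_comp G f _)

variable (k) in
/-- Morphisms from a representable presheaf to `D(G -, d)`. -/
def nerveHomEquiv (X : c) (d : D) :
    (G.obj X ⟶ d) ≃ₗ[k] ((yonedaPSh k c).obj X ⟶ (nerve k G).obj d) :=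
  (nerveElt k G X d).trans (yonedaEquivPSh X _).symm

theorem nerveHomEquiv_comp {X : c} {d d' : D} (g : G.obj X ⟶ d) (h : d ⟶ d') :
    nerveHomEquiv k G X d' (g ≫ h) = nerveHomEquiv k G X d g ≫ (nerve k G).map h := by
  apply (yonedaEquivPSh X _).injective
  rw [yonedaEquivPSh_comp]
  refine (LinearEquiv.apply_symm_apply _ _).trans ((nerveElt_comp' (k := k) G g h).trans ?_)
  exact congrArg _ (LinearEquiv.apply_symm_apply _ _).symm

theorem nerveHomEquiv_map {X Y : c} (f : X ⟶ Y) {d : D} (g : G.obj Y ⟶ d) :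
    nerveHomEquiv k G X d (G.map f ≫ g) = (yonedaPSh k c).map f ≫ nerveHomEquiv k G Y d g := by
  apply (yonedaEquivPSh X _).injective
  rw [yonedaEquivPSh_map]
  refine (LinearEquiv.apply_symm_apply _ _).trans ((nerveElt_comp (k := k) G f g).trans ?_)
  exact congrArg _ (LinearEquiv.apply_symm_apply _ _).symm

instance isRightAdjoint_nerve [EssentiallySmall.{v} c] [HasColimitsOfSize.{v, v} D] :
    (nerve k G).IsRightAdjoint := by
  have : HasColimitsOfSize.{0, 0} D := hasColimitsOfSizeShrink.{0, 0, v, v} D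
  refine Functor.isRightAdjoint_of_leftAdjointObjIsDefined_eq_top ?_
  ext F
  simp only [Pi.top_apply, Prop.top_eq_true, iff_true]
  refine PSh.induction_colimits _ (fun X => ?_) (fun ι f h => ?_) (fun A B f t ht hA hB => ?_) F
  · exact (Functor.CorepresentableBy.mk (X := G.obj X) (fun {d} => (nerveHomEquiv k G X d).toEquiv)
      fun h g => nerveHomEquiv_comp G g h).isCorepresentable
  · exact Functor.leftAdjointObjIsDefined_colimit _ fun i => h _
  · exact Functor.leftAdjointObjIsDefined_of_isColimit ht (by rintro (_ | _) <;> assumption)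

/-- A left adjoint of the nerve of `G` extends `G`. -/
def yonedaCompIso {H : PSh k c ⥤ D} (adj : H ⊣ nerve k G) : yonedaPSh k c ⋙ H ≅ G :=
  NatIso.ofComponents (fun X =>
    { hom := (adj.homEquiv _ _).symm (nerveHomEquiv k G X _ (𝟙 _))
      inv := (nerveHomEquiv k G X _).symm (adj.unit.app ((yonedaPSh k c).obj X))
      hom_inv_id := by
        apply (adj.homEquiv _ _).injective
        rw [adj.homEquiv_naturality_right, Equiv.apply_symm_apply, ← nerveHomEquiv_comp,
          Category.id_comp, adj.homEquiv_unit]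
        refine (LinearEquiv.apply_symm_apply _ _).trans ?_
        simp
      inv_hom_id := by
        apply (nerveHomEquiv k G X _).injective
        rw [nerveHomEquiv_comp]
        refine (congrArg (· ≫ _) (LinearEquiv.apply_symm_apply _ _)).trans ?_
        exact (adj.homEquiv_unit ..).symm.trans (Equiv.apply_symm_apply _ _) })
    (fun {X Y} f => by
      dsimp
      rw [← adj.homEquiv_naturality_left_symm, ← adj.homEquiv_naturality_right_symm,
        ← nerveHomEquiv_map, ← nerveHomEquiv_comp, Category.comp_id, Category.id_comp])

end Nerve

section Extension

variable {k : Type v} [CommRing k] {c : Type u} [Category.{v} c] [Preadditive c] [Linear k c]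
  {D : Type u₄} [Category.{w'} D] [Preadditive D] [Linear k D] [LocallySmall.{v} D]
  (H : PSh k c ⥤ D) [H.Additive] [Functor.Linear k H]

/-- The comparison `D(H F, d) ⟶ Hom(F, D(H Y -, d))`. -/
def toNerve (F : PSh k c) (d : D) (g : H.obj F ⟶ d) :
    F ⟶ (nerve k (yonedaPSh k c ⋙ H)).obj d :=
  homToNerve (yonedaPSh k c ⋙ H)
    (fun X =>
      { toFun := fun x => H.map ((yonedaEquivPSh X F).symm x) ≫ g
        map_add' := fun x y => by rw [map_add, H.map_add, Preadditive.add_comp]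
        map_smul' := fun r x => by rw [map_smul, H.map_smul, Linear.smul_comp]; rfl })
    (fun {X Y} f x => by
      change H.map _ ≫ g = H.map _ ≫ H.map _ ≫ g
      rw [yonedaEquivPSh_symm_map, H.map_comp, Category.assoc])

theorem toNerve_app (F : PSh k c) (d : D) (g : H.obj F ⟶ d) (X : c) (x : F.obj.obj (op X)) :
    ((toNerve H F d g).hom.app (op X)).hom x =
      nerveElt k (yonedaPSh k c ⋙ H) X d (H.map ((yonedaEquivPSh X F).symm x) ≫ g) := rfl

theorem toNerve_naturality_left {F F' : PSh k c} (s : F' ⟶ F) {d : D} (g : H.obj F ⟶ d) :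
    toNerve H F' d (H.map s ≫ g) = s ≫ toNerve H F d g := PSh.hom_ext fun X x => by
  rw [toNerve_app, ← Category.assoc, ← H.map_comp, yonedaEquivPSh_symm_comp]
  exact (toNerve_app ..).symm

theorem toNerve_naturality_right {F : PSh k c} {d d' : D} (g : H.obj F ⟶ d) (h : d ⟶ d') :
    toNerve H F d' (g ≫ h) = toNerve H F d g ≫ (nerve k _).map h := PSh.hom_ext fun X x => by
  rw [toNerve_app, ← Category.assoc, nerveElt_comp', ← toNerve_app]; rfl

theorem bijective_toNerve_of_isColimit {J : Type u₁} [Category.{v₁} J] {T : J ⥤ PSh k c}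
    {t : Cocone T} (ht : IsColimit t) [PreservesColimit T H] (d : D)
    (h : ∀ j, Function.Bijective (toNerve H (T.obj j) d)) :
    Function.Bijective (toNerve H t.pt d) := by
  have hH := isColimitOfPreserves H ht
  refine ⟨fun g g' hg => hH.hom_ext fun j => (h j).1 ?_, fun s => ?_⟩
  · dsimp
    rw [toNerve_naturality_left, hg, toNerve_naturality_left]
  · choose g hg using fun j => (h j).2 (t.ι.app j ≫ s)
    let t' : Cocone (T ⋙ H) := ⟨d, { app := g, naturality := fun i j f => (h i).1 (by
      dsimp
      rw [toNerve_naturality_left, hg, Category.comp_id, hg, ← Category.assoc, t.w]) }⟩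
    refine ⟨hH.desc t', ht.hom_ext fun j => ?_⟩
    rw [← toNerve_naturality_left, ← hg]
    exact congrArg _ (hH.fac t' j)

theorem bijective_toNerve [EssentiallySmall.{v} c] [PreservesColimitsOfSize.{v, v} H]
    (F : PSh k c) (d : D) : Function.Bijective (toNerve H F d) := by
  have : PreservesColimitsOfSize.{0, 0} H := preservesColimitsOfSize_shrink.{0, v, 0, v} H
  refine PSh.induction_colimits (fun F => Function.Bijective (toNerve H F d)) (fun X => ?_)
    (fun ι f h => bijective_toNerve_of_isColimit H (colimit.isColimit _) d fun i => h _)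
    (fun A B f t ht hA hB => bijective_toNerve_of_isColimit H ht d
      (by rintro (_ | _) <;> assumption)) F
  suffices h : toNerve H ((yonedaPSh k c).obj X) d = nerveHomEquiv k (yonedaPSh k c ⋙ H) X d by
    rw [h]; exact (nerveHomEquiv k (yonedaPSh k c ⋙ H) X d).bijective
  funext g
  apply (yonedaEquivPSh X _).injective
  refine Eq.trans ?_ (LinearEquiv.apply_symm_apply _ _).symm
  change ((toNerve H _ d g).hom.app (op X)).hom _ = _
  rw [toNerve_app]
  change nerveElt k (yonedaPSh k c ⋙ H) X d (H.map ((yonedaEquivPSh X _).symm (yonedaEquivPSh X _ (𝟙 _))) ≫ g) = _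
  rw [LinearEquiv.symm_apply_apply, H.map_id]
  exact congrArg (nerveElt k (yonedaPSh k c ⋙ H) X d) (Category.id_comp g)

/-- A cocontinuous linear functor on linear presheaves is left adjoint to its nerve. -/
def nerveAdjunction [EssentiallySmall.{v} c] [PreservesColimitsOfSize.{v, v} H] :
    H ⊣ nerve k (yonedaPSh k c ⋙ H) :=
  Adjunction.mkOfHomEquiv
    { homEquiv := fun F d => Equiv.ofBijective _ (bijective_toNerve H F d)
      homEquiv_naturality_left_symm := fun s g => by
        rw [Equiv.symm_apply_eq]
        refine ((toNerve_naturality_left ..).trans ?_).symm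
        exact congrArg _ ((Equiv.ofBijective _ (bijective_toNerve H _ _)).apply_symm_apply g)
      homEquiv_naturality_right := fun g h => toNerve_naturality_right H g h }

/-- A natural linear family of morphisms, indexed by the elements of `F`, comes from a unique
morphism out of `H F`. -/
theorem existsUnique_desc [EssentiallySmall.{v} c] [PreservesColimitsOfSize.{v, v} H]
    (F : PSh k c) (d : D) (t : ∀ X : c, ((yonedaPSh k c).obj X ⟶ F) →ₗ[k]
      (H.obj ((yonedaPSh k c).obj X) ⟶ d))
    (ht : ∀ {X Y : c} (f : X ⟶ Y) (x : (yonedaPSh k c).obj Y ⟶ F),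
      t X ((yonedaPSh k c).map f ≫ x) = H.map ((yonedaPSh k c).map f) ≫ t Y x) :
    ∃! g : H.obj F ⟶ d, ∀ (X : c) (x : (yonedaPSh k c).obj X ⟶ F), H.map x ≫ g = t X x := by
  let s : F ⟶ (nerve k (yonedaPSh k c ⋙ H)).obj d := homToNerve (yonedaPSh k c ⋙ H)
    (fun X => t X ∘ₗ (yonedaEquivPSh X F).symm.toLinearMap)
    (fun {X Y} f x => by
      change t X _ = H.map _ ≫ t Y _
      rw [← ht]
      exact congrArg _ (yonedaEquivPSh_symm_map f x))
  have key : ∀ g, (∀ (X : c) (x : (yonedaPSh k c).obj X ⟶ F), H.map x ≫ g = t X x) ↔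
      toNerve H F d g = s := by
    intro g
    constructor
    · intro h
      refine PSh.hom_ext fun X x => ?_
      rw [toNerve_app, h]; rfl
    · intro h X x
      apply (nerveElt k (yonedaPSh k c ⋙ H) X d).injective
      obtain ⟨x, rfl⟩ := (yonedaEquivPSh X F).symm.surjective x
      rw [← toNerve_app, h]; rfl
  simp only [key]
  exact (bijective_toNerve H F d).existsUnique s

end Extension

end LinSh

namespace LinSh

theorem linear_of_adjunction {k : Type v} [CommRing k] {B : Type u₁} [Category.{v₁} B]
    [Preadditive B] [Linear k B] {C : Type u₂} [Category.{v₂} C] [Preadditive C] [Linear k C]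
    {L : B ⥤ C} {R : C ⥤ B} (adj : L ⊣ R) [L.Additive] [R.Additive] [R.Linear k] :
    L.Linear k where
  map_smul {X Y} f r := by
    apply (adj.homEquiv _ _).injective
    rw [adj.homEquiv_unit, adj.homEquiv_unit, R.map_smul, Linear.comp_smul]
    exact (adj.unit.naturality (r • f)).symm.trans ((Linear.smul_comp _ _ _ r f _).trans
      (congrArg (r • ·) (adj.unit.naturality f)))

/-- The morphisms sent to isomorphisms by `L`. -/
abbrev inverted {B : Type u₁} [Category.{v₁} B] {C : Type u₂} [Category.{v₂} C] (L : B ⥤ C) :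
    MorphismProperty B :=
  (MorphismProperty.isomorphisms C).inverseImage L

section Local

variable {B : Type u₁} [Category.{v₁} B] {C : Type u₂} [Category.{v₂} C] {L : B ⥤ C} {R : C ⥤ B}

theorem isLocal_inverted_obj (adj : L ⊣ R) (M : C) : (inverted L).isLocal (R.obj M) := by
  intro X Y f hf
  have : IsIso (L.map f) := hf
  have h : (fun g : Y ⟶ R.obj M => f ≫ g) =
      (adj.homEquiv _ _) ∘ (fun g => L.map f ≫ g) ∘ (adj.homEquiv _ _).symm := by
    funext g
    simp [adj.homEquiv_naturality_left]
  rw [h]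
  exact (adj.homEquiv _ _).bijective.comp
    (((asIso (L.map f)).homFromEquiv (Z := M)).symm.bijective.comp (adj.homEquiv _ _).symm.bijective)

theorem inverted_unit (adj : L ⊣ R) [R.Full] [R.Faithful] (X : B) :
    inverted L (adj.unit.app X) :=
  inferInstanceAs (IsIso (L.map (adj.unit.app X)))

theorem isIso_unit_of_isLocal (adj : L ⊣ R) [R.Full] [R.Faithful] {X : B}
    (hX : (inverted L).isLocal X) : IsIso (adj.unit.app X) := by
  obtain ⟨r, hr⟩ := (hX _ (inverted_unit adj X)).2 (𝟙 X)
  replace hr : adj.unit.app X ≫ r = 𝟙 X := hr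
  refine ⟨r, hr, ?_⟩
  apply (isLocal_inverted_obj adj _ _ (inverted_unit adj X)).1
  change adj.unit.app X ≫ r ≫ adj.unit.app X = adj.unit.app X ≫ 𝟙 _
  rw [← Category.assoc, hr]
  exact (Category.id_comp _).trans (Category.comp_id _).symm

end Local

/-! ### Two-variable restriction -/

section TwoVariable

variable {a : Type u₁} [Category.{v} a] {b : Type u₂} [Category.{w} b] {A : Type u₃}
  [Category.{v₁} A] {B : Type u₄} [Category.{v₂} B] {D : Type u₅} [Category.{w'} D]

/-- Restriction along `p : a ⥤ A` is bijective on natural transformations `H ⟶ H'`. -/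
def RestrictBijective (p : a ⥤ A) (H H' : A ⥤ D) : Prop :=
  Function.Bijective (fun α : H ⟶ H' => Functor.whiskerLeft p α)

theorem RestrictBijective.prod {p : a ⥤ A} {q : b ⥤ B} {F F' : A × B ⥤ D}
    (hp : ∀ Y Y', RestrictBijective p (Prod.sectL A Y ⋙ F) (Prod.sectL A Y' ⋙ F'))
    (hq : ∀ X X', RestrictBijective q (Prod.sectR X B ⋙ F) (Prod.sectR X' B ⋙ F')) :
    RestrictBijective (p.prod q) F F' := by
  let sl (α : F ⟶ F') (Y : B) : Prod.sectL A Y ⋙ F ⟶ Prod.sectL A Y ⋙ F' :=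
    Functor.whiskerLeft _ α
  let sr (α : F ⟶ F') (X : A) : Prod.sectR X B ⋙ F ⟶ Prod.sectR X B ⋙ F' :=
    Functor.whiskerLeft _ α
  have mapFac : ∀ (G : A × B ⥤ D) {X X' : A} {Y Y' : B} (f : X ⟶ X') (g : Y ⟶ Y'),
      G.map (Prod.mkHom f g) = G.map (Prod.mkHom f (𝟙 Y)) ≫ G.map (Prod.mkHom (𝟙 X') g) := by
    intro G X X' Y Y' f g
    rw [← G.map_comp]
    congr 1
    ext <;> simp
  have mapFac' : ∀ (G : A × B ⥤ D) {X X' : A} {Y Y' : B} (f : X ⟶ X') (g : Y ⟶ Y'),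
      G.map (Prod.mkHom f g) = G.map (Prod.mkHom (𝟙 X) g) ≫ G.map (Prod.mkHom f (𝟙 Y')) := by
    intro G X X' Y Y' f g
    rw [← G.map_comp]
    congr 1
    ext <;> simp
  constructor
  · intro α α' h
    have h₀ : ∀ x y, α.app (p.obj x, q.obj y) = α'.app (p.obj x, q.obj y) :=
      fun x y => NatTrans.congr_app h (x, y)
    have h₁ : ∀ X y, α.app (X, q.obj y) = α'.app (X, q.obj y) := fun X y => by
      have : sl α (q.obj y) = sl α' (q.obj y) := (hp _ _).1 (by ext x; exact h₀ x y)
      exact NatTrans.congr_app this X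
    ext ⟨X, Y⟩
    have : sr α X = sr α' X := (hq _ _).1 (by ext y; exact h₁ X y)
    exact NatTrans.congr_app this Y
  · intro α
    choose β hβ using fun y => (hp (q.obj y) (q.obj y)).2
      { app := fun x => α.app (x, y)
        naturality := fun x x' f => by
          have := α.naturality (Prod.mkHom f (𝟙 y) : (x, y) ⟶ (x', y))
          dsimp at this
          rw [q.map_id] at this
          exact this }
    have hβ' : ∀ y x, (β y).app (p.obj x) = α.app (x, y) := fun y x => NatTrans.congr_app (hβ y) x
    let lF (G : A × B ⥤ D) {Y Y' : B} (g : Y ⟶ Y') : Prod.sectL A Y ⋙ G ⟶ Prod.sectL A Y' ⋙ G :=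
      { app := fun X => G.map (Prod.mkHom (𝟙 X) g)
        naturality := fun X X' f => (mapFac G f g).symm.trans (mapFac' G f g) }
    let rF (G : A × B ⥤ D) {X X' : A} (f : X ⟶ X') : Prod.sectR X B ⋙ G ⟶ Prod.sectR X' B ⋙ G :=
      { app := fun Y => G.map (Prod.mkHom f (𝟙 Y))
        naturality := fun Y Y' g => (mapFac' G f g).symm.trans (mapFac G f g) }
    have hnat : ∀ {y y' : b} (g : y ⟶ y'), lF F (q.map g) ≫ β y' = β y ≫ lF F' (q.map g) := by
      intro y y' g
      apply (hp _ _).1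
      ext x
      have := α.naturality (Prod.mkHom (𝟙 x) g : (x, y) ⟶ (x, y'))
      dsimp at this
      rw [p.map_id] at this
      dsimp [lF]
      rw [hβ', hβ']
      exact this
    choose γ hγ using fun X => (hq X X).2
      { app := fun y => (β y).app X
        naturality := fun y y' g => NatTrans.congr_app (hnat g) X }
    have hγ' : ∀ X y, (γ X).app (q.obj y) = (β y).app X := fun X y => NatTrans.congr_app (hγ X) y
    have hnat' : ∀ {X X' : A} (f : X ⟶ X'), rF F f ≫ γ X' = γ X ≫ rF F' f := by
      intro X X' f
      apply (hq _ _).1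
      ext y
      dsimp [rF]
      rw [hγ', hγ']
      exact (β y).naturality f
    refine ⟨{ app := fun P => (γ P.1).app P.2, naturality := ?_ }, ?_⟩
    · rintro ⟨X, Y⟩ ⟨X', Y'⟩ ⟨f, g⟩
      let δ : ∀ X Y, F.obj (X, Y) ⟶ F'.obj (X, Y) := fun X Y => (γ X).app Y
      have h₁ : F.map (Prod.mkHom (𝟙 X') g) ≫ δ X' Y' = δ X' Y ≫ F'.map (Prod.mkHom (𝟙 X') g) :=
        (γ X').naturality g
      have h₂ : F.map (Prod.mkHom f (𝟙 Y)) ≫ δ X' Y = δ X Y ≫ F'.map (Prod.mkHom f (𝟙 Y)) :=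
        NatTrans.congr_app (hnat' f) Y
      change F.map (Prod.mkHom f g) ≫ δ X' Y' = δ X Y ≫ F'.map (Prod.mkHom f g)
      rw [mapFac F, mapFac F', Category.assoc, h₁, ← Category.assoc, h₂, Category.assoc]
    · ext ⟨x, y⟩
      dsimp
      rw [hγ', hβ']

end TwoVariable

/-! ### Cocontinuous functors on a reflective subcategory of linear presheaves -/

section Reflective

variable {k : Type v} [CommRing k] {c : Type u} [Category.{v} c] [Preadditive c] [Linear k c]
  {C : Type u₁} [Category.{v₁} C] [Preadditive C] [Linear k C]
  {L : PSh k c ⥤ C} {R : C ⥤ PSh k c}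
  {D : Type u₄} [Category.{w'} D] [Preadditive D] [Linear k D] [LocallySmall.{v} D]

theorem restrictBijective_yonedaPSh [EssentiallySmall.{v} c] {H H' : PSh k c ⥤ D} (hH : isLinCocont k (PSh k c) D H)
    [H'.Additive] [H'.Linear k] : RestrictBijective (yonedaPSh k c) H H' := by
  obtain ⟨_, _, _⟩ := hH
  have desc (α : yonedaPSh k c ⋙ H ⟶ yonedaPSh k c ⋙ H') (F : PSh k c) :
      ∃! g : H.obj F ⟶ H'.obj F, ∀ (X : c) (x : (yonedaPSh k c).obj X ⟶ F),
        H.map x ≫ g = α.app X ≫ H'.map x :=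
    existsUnique_desc H F (H'.obj F)
      (fun X =>
        { toFun := fun x => α.app X ≫ H'.map x
          map_add' := fun x y => by rw [H'.map_add, Preadditive.comp_add]
          map_smul' := fun r x => by rw [H'.map_smul, Linear.comp_smul]; rfl })
      (fun {X Y} f x => by
        change α.app X ≫ H'.map _ = H.map _ ≫ α.app Y ≫ H'.map _
        rw [H'.map_comp, ← Category.assoc, ← Category.assoc]
        congr 1
        exact (α.naturality f).symm)
  constructor
  · intro α α' h
    ext F
    refine (desc (Functor.whiskerLeft _ α) F).unique (fun X x => α.naturality x) (fun X x => ?_)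
    exact (α'.naturality x).trans (congrArg (· ≫ H'.map x) (NatTrans.congr_app h X).symm)
  · intro α
    choose g hg hg' using desc α
    refine ⟨{ app := g, naturality := fun F F' s => ?_ }, ?_⟩
    · refine (existsUnique_desc H F (H'.obj F')
        (fun X =>
          { toFun := fun x => α.app X ≫ H'.map (x ≫ s)
            map_add' := fun x y => by rw [Preadditive.add_comp, H'.map_add, Preadditive.comp_add]
            map_smul' := fun r x => by
              rw [Linear.smul_comp, H'.map_smul, Linear.comp_smul]; rfl })
        (fun {X Y} f x => by
          change α.app X ≫ H'.map _ = H.map _ ≫ α.app Y ≫ H'.map _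
          rw [Category.assoc, H'.map_comp, ← Category.assoc, ← Category.assoc]
          congr 1
          exact (α.naturality f).symm)).unique (fun X x => ?_) (fun X x => ?_)
      · rw [← Category.assoc, ← H.map_comp, hg]; rfl
      · rw [← Category.assoc, hg, Category.assoc, ← H'.map_comp]; rfl
    · ext X
      have := hg ((yonedaPSh k c).obj X) X (𝟙 _)
      simpa using this

variable [L.Additive] [L.Linear k]

theorem isLinCocont_comp_left (adj : L ⊣ R) {D : Type u₄} [Category.{w'} D] [Preadditive D]
    [Linear k D] {H : C ⥤ D} (hH : isLinCocont k C D H) :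
    isLinCocont k (PSh k c) D (L ⋙ H) := by
  obtain ⟨_, _, _⟩ := hH
  have := adj.leftAdjoint_preservesColimits
  exact ⟨inferInstance, inferInstance, inferInstance⟩

theorem restrictBijective_reflective [EssentiallySmall.{v} c] (adj : L ⊣ R) [R.Full] [R.Faithful] {H H' : C ⥤ D}
    (hH : isLinCocont k C D H)
    [H'.Additive] [H'.Linear k] : RestrictBijective (yonedaPSh k c ⋙ L) H H' := by
  have := adj.isLocalization
  have : Function.Bijective (fun α : H ⟶ H' => Functor.whiskerLeft L α) :=
    have := Localization.full_whiskeringLeft L (inverted L) D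
    have := Localization.faithful_whiskeringLeft L (inverted L) D
    ⟨((Functor.whiskeringLeft _ _ D).obj L).map_injective,
      ((Functor.whiskeringLeft _ _ D).obj L).map_surjective⟩
  exact (restrictBijective_yonedaPSh (H' := L ⋙ H') (isLinCocont_comp_left adj hH)).comp this

theorem isLocal_nerve [EssentiallySmall.{v} c] (adj : L ⊣ R) {H : C ⥤ D} (hH : isLinCocont k C D H)
    [(yonedaPSh k c ⋙ L ⋙ H).Additive] [(yonedaPSh k c ⋙ L ⋙ H).Linear k] (d : D) :
    (inverted L).isLocal ((nerve k (yonedaPSh k c ⋙ L ⋙ H)).obj d) := by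
  obtain ⟨_, _, _⟩ := isLinCocont_comp_left adj hH
  have h := isLocal_inverted_obj (nerveAdjunction (L ⋙ H)) d
  intro X Y f hf
  have : IsIso (L.map f) := hf
  exact h f (inferInstanceAs (IsIso (H.map (L.map f))))

end Reflective

/-! ### Extending functors to a reflective subcategory -/

section Extend

variable {k : Type v} [CommRing k] {c : Type u} [Category.{v} c] [Preadditive c] [Linear k c]
  [EssentiallySmall.{v} c] {Q : ObjectProperty (PSh k c)} {L : PSh k c ⥤ Q.FullSubcategory}
  {D : Type u₄} [Category.{w'} D] [Preadditive D] [Linear k D] [LocallySmall.{v} D]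
  [HasColimitsOfSize.{v, v} D]

instance (Q : ObjectProperty (PSh k c)) : Q.ι.Linear k where

theorem exists_extension (adj : L ⊣ Q.ι) (G : c ⥤ D) [G.Additive] [G.Linear k]
    (hG : ∀ d, Q ((nerve k G).obj d)) :
    ∃ H : Q.FullSubcategory ⥤ D, isLinCocont k _ D H ∧ Nonempty ((yonedaPSh k c ⋙ L) ⋙ H ≅ G) := by
  let N : D ⥤ Q.FullSubcategory := Q.lift (nerve k G) hG
  let adj₀ := Adjunction.ofIsRightAdjoint (nerve k G)
  let H : Q.FullSubcategory ⥤ D := Q.ι ⋙ (nerve k G).leftAdjoint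
  have adj₁ : H ⊣ N := adj₀.restrictFullyFaithful Q.fullyFaithfulι (Functor.FullyFaithful.id D)
    (Iso.refl _) (Iso.refl _)
  have : N.Additive := ⟨fun {X Y f g} => Q.ι.map_injective (nerve k G).map_add⟩
  have : N.Linear k := ⟨fun f r => Q.ι.map_injective ((nerve k G).map_smul r f)⟩
  have : H.Additive := adj₁.left_adjoint_additive
  have : H.Linear k := linear_of_adjunction adj₁
  have := adj₁.leftAdjoint_preservesColimits
  refine ⟨H, ⟨inferInstance, inferInstance, inferInstance⟩, ⟨?_⟩⟩
  have adj₂ : L ⋙ H ⊣ nerve k G := adj.comp adj₁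
  exact Functor.associator _ _ _ ≪≫ yonedaCompIso G adj₂

end Extend

end LinSh

namespace LinSh

/-! ### Restriction of linear presheaves -/

section Restrict

variable {k : Type v} [CommRing k] {c : Type u₁} [Category.{v} c] [Preadditive c] [Linear k c]
  {c' : Type u₂} [Category.{v} c'] [Preadditive c'] [Linear k c'] (G : c ⥤ c') [G.Additive]
  [G.Linear k]

variable (k) in
/-- Restriction of linear presheaves along a linear functor. -/
def PSh.restrict : PSh k c' ⥤ PSh k c :=
  (isLinearPresheaf k c).lift
    ((isLinearPresheaf k c').ι ⋙ (Functor.whiskeringLeft _ _ (ModuleCat.{v} k)).obj G.op)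
    fun F => ⟨⟨fun {X Y f g} => by
        change F.obj.map (G.map (f + g).unop).op = _
        rw [unop_add, G.map_add, op_add, F.obj.map_add]; rfl⟩,
      fun X Y f r => by
        change F.obj.map (G.map (r • f)).op = r • F.obj.map (G.map f).op
        rw [G.map_smul, F.property.2]⟩

instance : (PSh.restrict k G).Additive := ⟨rfl⟩

instance preservesLimitsOfShape_restrict (J : Type u₃) [Category.{v₁} J]
    [HasLimitsOfShape J (ModuleCat.{v} k)] : PreservesLimitsOfShape J (PSh.restrict k G) :=
  have : PreservesLimitsOfShape J (PSh.restrict k G ⋙ (isLinearPresheaf k c).ι) :=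
    inferInstanceAs (PreservesLimitsOfShape J
      ((isLinearPresheaf k c').ι ⋙ (Functor.whiskeringLeft _ _ (ModuleCat.{v} k)).obj G.op))
  preservesLimitsOfShape_of_reflects_of_preserves _ (isLinearPresheaf k c).ι

instance preservesColimitsOfShape_restrict (J : Type u₃) [Category.{v₁} J]
    [HasColimitsOfShape J (ModuleCat.{v} k)] : PreservesColimitsOfShape J (PSh.restrict k G) :=
  have : PreservesColimitsOfShape J (PSh.restrict k G ⋙ (isLinearPresheaf k c).ι) :=
    inferInstanceAs (PreservesColimitsOfShape J
      ((isLinearPresheaf k c').ι ⋙ (Functor.whiskeringLeft _ _ (ModuleCat.{v} k)).obj G.op))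
  preservesColimitsOfShape_of_reflects_of_preserves _ (isLinearPresheaf k c).ι

instance : PreservesFiniteLimits (PSh.restrict k G) := ⟨fun _ _ _ => inferInstance⟩

end Restrict

/-! ### Slices and the external tensor product -/

section External

variable {k : Type v} [CommRing k] {a : Type u₁} [Category.{v} a] [Preadditive a] [Linear k a]
  {b : Type u₂} [Category.{v} b] [Preadditive b] [Linear k b]

theorem TensorCat.homTmul_comp {X X' X'' : a} {Y Y' Y'' : b} (f : X ⟶ X') (g : Y ⟶ Y')
    (f' : X' ⟶ X'') (g' : Y' ⟶ Y'') :
    (homTmul (f ≫ f') (g ≫ g') : (⟨X, Y⟩ : TensorCat k a b) ⟶ _) =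
      homTmul f g ≫ homTmul f' g' := rfl

theorem TensorCat.hom_induction {P Q : TensorCat k a b} {motive : (P ⟶ Q) → Prop} (φ : P ⟶ Q)
    (tmul : ∀ (f : P.left ⟶ Q.left) (g : P.right ⟶ Q.right), motive (homTmul f g))
    (add : ∀ φ ψ, motive φ → motive ψ → motive (φ + ψ)) : motive φ :=
  TensorProduct.induction_on (R := k) (M := P.left ⟶ Q.left) (N := P.right ⟶ Q.right) φ
    (by have := tmul 0 0
        rwa [show (homTmul (0 : P.left ⟶ Q.left) (0 : P.right ⟶ Q.right) : P ⟶ Q) = 0 from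
          TensorProduct.zero_tmul _ _] at this)
    tmul add

variable (k a) in
/-- The functor `X ↦ (X, y)`. -/
abbrev inclL (y : b) : a ⥤ TensorCat k a b := Prod.sectL a y ⋙ TensorCat.pair k a b

variable (k b) in
/-- The functor `Y ↦ (x, Y)`. -/
abbrev inclR (x : a) : b ⥤ TensorCat k a b := Prod.sectR x b ⋙ TensorCat.pair k a b

instance (y : b) : (inclL k a y).Additive := ⟨TensorProduct.add_tmul _ _ _⟩

instance (x : a) : (inclR k b x).Additive := ⟨TensorProduct.tmul_add _ _ _⟩

instance (y : b) : (inclL k a y).Linear k := ⟨fun {x x'} f r =>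
  (TensorProduct.smul_tmul' (R := k) (M := x ⟶ x') (N := y ⟶ y) r f (𝟙 y)).symm⟩

instance (x : a) : (inclR k b x).Linear k := ⟨fun {y y'} g r =>
  TensorProduct.tmul_smul (R := k) (M := x ⟶ x) (N := y ⟶ y') r (𝟙 x) g⟩

variable (k a) in
/-- The functor `Z ↦ Z(-, y)`. -/
abbrev sliceL (y : b) : PSh k (TensorCat k a b) ⥤ PSh k a := PSh.restrict k (inclL k a y)

variable (k b) in
/-- The functor `Z ↦ Z(x, -)`. -/
abbrev sliceR (x : a) : PSh k (TensorCat k a b) ⥤ PSh k b := PSh.restrict k (inclR k b x)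

theorem PSh.map_comp_apply {c : Type u} [Category.{v} c] [Preadditive c] [Linear k c]
    (F : PSh k c) {X Y Z : c} (f : X ⟶ Y) (g : Y ⟶ Z) (x : F.obj.obj (op Z)) :
    (F.obj.map (f ≫ g).op).hom x = (F.obj.map f.op).hom ((F.obj.map g.op).hom x) := by
  rw [op_comp, F.obj.map_comp]; rfl

theorem PSh.map_right_left_apply (Z : PSh k (TensorCat k a b)) {x x' : a} {y y' : b} (f : x ⟶ x')
    (g : y ⟶ y') (z : Z.obj.obj (op ⟨x', y'⟩)) :
    (Z.obj.map (TensorCat.homTmul (𝟙 x) g).op).hom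
      ((Z.obj.map (TensorCat.homTmul f (𝟙 y')).op).hom z) =
        (Z.obj.map (TensorCat.homTmul f g).op).hom z := by
  rw [← PSh.map_comp_apply, ← TensorCat.homTmul_comp, Category.id_comp, Category.comp_id]

theorem PSh.map_left_right_apply (Z : PSh k (TensorCat k a b)) {x x' : a} {y y' : b} (f : x ⟶ x')
    (g : y ⟶ y') (z : Z.obj.obj (op ⟨x', y'⟩)) :
    (Z.obj.map (TensorCat.homTmul f (𝟙 y)).op).hom
      ((Z.obj.map (TensorCat.homTmul (𝟙 x') g).op).hom z) =
        (Z.obj.map (TensorCat.homTmul f g).op).hom z := by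
  rw [← PSh.map_comp_apply, ← TensorCat.homTmul_comp, Category.id_comp, Category.comp_id]

/-- The morphism `Z(-, y') ⟶ Z(-, y)` induced by `g : y ⟶ y'`. -/
def sliceLMap (Z : PSh k (TensorCat k a b)) {y y' : b} (g : y ⟶ y') :
    (sliceL k a y').obj Z ⟶ (sliceL k a y).obj Z :=
  PSh.mkHom (F := (sliceL k a y').obj Z) (G := (sliceL k a y).obj Z)
    (fun x => (Z.obj.map (TensorCat.homTmul (𝟙 x) g).op).hom) (fun f z =>
      (Z.map_right_left_apply f g z).trans (Z.map_left_right_apply f g z).symm)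

/-- The morphism `Z(x', -) ⟶ Z(x, -)` induced by `f : x ⟶ x'`. -/
def sliceRMap (Z : PSh k (TensorCat k a b)) {x x' : a} (f : x ⟶ x') :
    (sliceR k b x').obj Z ⟶ (sliceR k b x).obj Z :=
  PSh.mkHom (F := (sliceR k b x').obj Z) (G := (sliceR k b x).obj Z)
    (fun y => (Z.obj.map (TensorCat.homTmul f (𝟙 y)).op).hom) (fun g z =>
      (Z.map_left_right_apply f g z).trans (Z.map_right_left_apply f g z).symm)

/-- The action of morphisms on a linear presheaf. -/
def PSh.act {c : Type u} [Category.{v} c] [Preadditive c] [Linear k c] (M : PSh k c) (X Y : c) :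
    (X ⟶ Y) →ₗ[k] M.obj.obj (op Y) →ₗ[k] M.obj.obj (op X) where
  toFun f := (M.obj.map f.op).hom
  map_add' f g := LinearMap.ext (M.map_add_apply f g)
  map_smul' r f := LinearMap.ext (M.map_smul_apply r f)

/-- The action of a morphism of `a ⊗ b` on the external tensor product. -/
def extAct (M : PSh k a) (N : PSh k b) (P Q : TensorCat k a b) :
    ((P.left ⟶ Q.left) ⊗[k] (P.right ⟶ Q.right)) →ₗ[k]
      (M.obj.obj (op Q.left) ⊗[k] N.obj.obj (op Q.right)) →ₗ[k]
        (M.obj.obj (op P.left) ⊗[k] N.obj.obj (op P.right)) :=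
  TensorProduct.map₂ (M.act P.left Q.left) (N.act P.right Q.right)

/-- The external tensor product `(x, y) ↦ M x ⊗ N y`. -/
def ext (M : PSh k a) (N : PSh k b) : PSh k (TensorCat k a b) where
  obj :=
    { obj := fun P => ModuleCat.of k (M.obj.obj (op P.unop.left) ⊗[k] N.obj.obj (op P.unop.right))
      map := fun {P Q} φ => ModuleCat.ofHom (extAct M N Q.unop P.unop φ.unop)
      map_id := fun P => by
        ext : 1
        refine TensorProduct.ext' fun m n => ?_
        change (M.obj.map (𝟙 _)).hom m ⊗ₜ[k] (N.obj.map (𝟙 _)).hom n = m ⊗ₜ n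
        rw [M.obj.map_id, N.obj.map_id]; rfl
      map_comp := fun {P Q R} φ ψ => by
        ext : 1
        obtain ⟨φ⟩ := φ
        obtain ⟨ψ⟩ := ψ
        change extAct M N R.unop P.unop (TensorCat.compHom _ _ _ ψ φ) =
          extAct M N R.unop Q.unop ψ ∘ₗ extAct M N Q.unop P.unop φ
        induction φ using TensorCat.hom_induction with
        | add φ φ' h h' =>
          erw [map_add, map_add, map_add, h, h', LinearMap.comp_add]
        | tmul f g =>
          induction ψ using TensorCat.hom_induction with
          | add φ φ' h h' =>
            erw [map_add, LinearMap.add_apply, map_add, map_add, h, h', LinearMap.add_comp]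
          | tmul f' g' =>
            refine TensorProduct.ext' fun m n => ?_
            change (M.obj.map (f.op ≫ f'.op)).hom m ⊗ₜ[k] (N.obj.map (g.op ≫ g'.op)).hom n =
              (M.obj.map f'.op).hom ((M.obj.map f.op).hom m) ⊗ₜ
                (N.obj.map g'.op).hom ((N.obj.map g.op).hom n)
            rw [M.obj.map_comp, N.obj.map_comp]; rfl }
  property := ⟨⟨fun {P Q φ ψ} => by
      ext : 1
      exact (extAct M N Q.unop P.unop).map_add φ.unop ψ.unop⟩,
    fun P Q φ r => by
      ext : 1
      exact (extAct M N P Q).map_smul r φ⟩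

/-- Elementary tensors in the external tensor product. -/
def extTmul (M : PSh k a) (N : PSh k b) (x : a) (y : b) :
    M.obj.obj (op x) →ₗ[k] N.obj.obj (op y) →ₗ[k] (ext M N).obj.obj (op ⟨x, y⟩) :=
  TensorProduct.mk k _ _

theorem ext_map_extTmul {M : PSh k a} {N : PSh k b} {x x' : a} {y y' : b} (f : x ⟶ x')
    (g : y ⟶ y') (m : M.obj.obj (op x')) (n : N.obj.obj (op y')) :
    ((ext M N).obj.map (TensorCat.homTmul f g).op).hom (extTmul M N x' y' m n) =
      extTmul M N x y ((M.obj.map f.op).hom m) ((N.obj.map g.op).hom n) := rfl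

theorem ext_induction {M : PSh k a} {N : PSh k b} {x : a} {y : b}
    {motive : (ext M N).obj.obj (op ⟨x, y⟩) → Prop} (t : (ext M N).obj.obj (op ⟨x, y⟩))
    (tmul : ∀ m n, motive (extTmul M N x y m n))
    (add : ∀ s t, motive s → motive t → motive (s + t)) : motive t :=
  TensorProduct.induction_on (R := k) (M := M.obj.obj (op x)) (N := N.obj.obj (op y)) t
    (by have := tmul 0 0; rwa [map_zero] at this) tmul add

/-- A linear map on a value of an external tensor product from a bilinear map. -/
def extLift {M : PSh k a} {N : PSh k b} {x : a} {y : b} {V : ModuleCat.{v} k}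
    (φ : M.obj.obj (op x) →ₗ[k] N.obj.obj (op y) →ₗ[k] V) :
    (ext M N).obj.obj (op ⟨x, y⟩) →ₗ[k] V :=
  TensorProduct.lift φ

/-- A morphism out of an external tensor product from a natural family of bilinear maps. -/
def extDesc {M : PSh k a} {N : PSh k b} {Z : PSh k (TensorCat k a b)}
    (φ : ∀ x y, M.obj.obj (op x) →ₗ[k] N.obj.obj (op y) →ₗ[k] Z.obj.obj (op ⟨x, y⟩))
    (hφ : ∀ {x x' y y'} (f : x ⟶ x') (g : y ⟶ y') (m : M.obj.obj (op x'))
      (n : N.obj.obj (op y')), φ x y ((M.obj.map f.op).hom m) ((N.obj.map g.op).hom n) =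
        (Z.obj.map (TensorCat.homTmul f g).op).hom (φ x' y' m n)) : ext M N ⟶ Z :=
  PSh.mkHom (F := ext M N) (fun P => extLift (φ P.left P.right)) (fun {P Q} f t => by
    obtain ⟨x, y⟩ := P
    obtain ⟨x', y'⟩ := Q
    induction f using TensorCat.hom_induction with
    | add f g hf hg => rw [PSh.map_add_apply, PSh.map_add_apply, map_add, hf, hg]
    | tmul f g =>
      induction t using ext_induction with
      | add s t hs ht => rw [map_add, map_add, hs, ht, map_add, map_add]
      | tmul m n => exact hφ f g m n)

theorem ext_hom_ext {M : PSh k a} {N : PSh k b} {Z : PSh k (TensorCat k a b)}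
    {f g : ext M N ⟶ Z} (h : ∀ x y (m : M.obj.obj (op x)) (n : N.obj.obj (op y)),
      (f.hom.app (op ⟨x, y⟩)).hom (extTmul M N x y m n) =
        (g.hom.app (op ⟨x, y⟩)).hom (extTmul M N x y m n)) : f = g := by
  refine PSh.hom_ext fun P t => ?_
  induction t using ext_induction with
  | tmul m n => exact h _ _ m n
  | add s t hs ht => rw [map_add, map_add, hs, ht]

/-- Functoriality of the external tensor product. -/
def extMap {M M' : PSh k a} {N N' : PSh k b} (s : M ⟶ M') (t : N ⟶ N') : ext M N ⟶ ext M' N' :=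
  extDesc (fun x y => (extTmul M' N' x y).compl₁₂ (s.hom.app (op x)).hom (t.hom.app (op y)).hom)
    (fun f g m n => by
      rw [LinearMap.compl₁₂_apply, LinearMap.compl₁₂_apply, PSh.naturality_apply,
        PSh.naturality_apply, ext_map_extTmul])

variable (k a b) in
/-- The external tensor product as a functor. -/
def extFunctor : PSh k a × PSh k b ⥤ PSh k (TensorCat k a b) where
  obj P := ext P.1 P.2
  map f := extMap f.1 f.2
  map_id _ := ext_hom_ext fun _ _ _ _ => rfl
  map_comp _ _ := ext_hom_ext fun _ _ _ _ => rfl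

/-- The external tensor product of representable presheaves is representable. -/
def extYoneda : (yonedaPSh k a).prod (yonedaPSh k b) ⋙ extFunctor k a b ≅
    TensorCat.pair k a b ⋙ yonedaPSh k (TensorCat k a b) :=
  NatIso.ofComponents
    (fun P =>
      { hom := extDesc (fun x y => TensorProduct.mk k (x ⟶ P.1) (y ⟶ P.2)) (fun _ _ _ _ => rfl)
        inv := (yonedaEquivPSh _ (ext _ _)).symm
          (extTmul _ _ _ _ (yonedaElt (𝟙 P.1)) (yonedaElt (𝟙 P.2)))
        hom_inv_id := by
          refine ext_hom_ext fun x y m n => ?_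
          obtain ⟨m, rfl⟩ := yonedaElt.surjective m
          obtain ⟨n, rfl⟩ := yonedaElt.surjective n
          change extTmul _ _ _ _ (yonedaElt (m ≫ 𝟙 P.1)) (yonedaElt (n ≫ 𝟙 P.2)) = _
          rw [Category.comp_id, Category.comp_id]; rfl
        inv_hom_id := by
          apply (yonedaEquivPSh _ _).injective
          refine (yonedaEquivPSh_comp _ _).trans ?_
          exact congrArg (ModuleCat.Hom.hom ((extDesc _ _).hom.app _))
            (LinearEquiv.apply_symm_apply (yonedaEquivPSh _ (ext _ _)) _) })
    (fun _ => ext_hom_ext fun _ _ _ _ => rfl)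

end External

end LinSh

namespace LinSh

theorem inverted_of_bijective {B : Type u₁} [Category.{v₁} B] {C : Type u₂} [Category.{v₂} C]
    {L : B ⥤ C} {R : C ⥤ B} (adj : L ⊣ R) {X Y : B} (j : X ⟶ Y)
    (h : ∀ M, Function.Bijective (fun g : Y ⟶ R.obj M => j ≫ g)) : inverted L j := by
  refine (isIso_iff_coyoneda_map_bijective (L.map j)).2 fun M => ?_
  have e : (fun g : L.obj Y ⟶ M => L.map j ≫ g) =
      (adj.homEquiv _ _).symm ∘ (fun g => j ≫ g) ∘ (adj.homEquiv _ _) := by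
    funext g
    simp [adj.homEquiv_naturality_left_symm]
  rw [e]
  exact (adj.homEquiv _ _).symm.bijective.comp ((h M).comp (adj.homEquiv _ _).bijective)

section Slices

variable {k : Type v} [CommRing k] {a : Type u₁} [Category.{v} a] [Preadditive a] [Linear k a]
  {b : Type u₂} [Category.{v} b] [Preadditive b] [Linear k b]

theorem bijective_of_sliceL {U V Z : PSh k (TensorCat k a b)} (w : U ⟶ V)
    (h : ∀ y y', Function.Bijective
      (fun g : (sliceL k a y').obj V ⟶ (sliceL k a y).obj Z => (sliceL k a y').map w ≫ g)) :
    Function.Bijective (fun g : V ⟶ Z => w ≫ g) := by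
  constructor
  · intro g g' hg
    refine PSh.hom_ext fun P t => ?_
    have : (sliceL k a P.right).map g = (sliceL k a P.right).map g' := (h _ _).1 (by
      dsimp only
      rw [← Functor.map_comp, ← Functor.map_comp]
      exact congrArg _ hg)
    exact congrArg (fun s => (s.hom.app (op P.left)).hom t) this
  · intro ψ
    choose E hE using fun y => (h y y).2 ((sliceL k a y).map ψ)
    have hE' : ∀ {x : a} {y : b} (t : U.obj.obj (op ⟨x, y⟩)),
        ((E y).hom.app (op x)).hom ((w.hom.app (op ⟨x, y⟩)).hom t) =
          (ψ.hom.app (op ⟨x, y⟩)).hom t :=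
      fun {x y} t => congrArg (fun s => (s.hom.app (op x)).hom t) (hE y)
    have nat : ∀ {y y' : b} (g : y ⟶ y'), sliceLMap V g ≫ E y = E y' ≫ sliceLMap Z g := by
      intro y y' g
      refine (h y y').1 (PSh.hom_ext fun x t => ?_)
      change ((E y).hom.app (op x)).hom ((V.obj.map (TensorCat.homTmul (𝟙 x) g).op).hom
        ((w.hom.app (op ⟨x, y'⟩)).hom t)) = (Z.obj.map (TensorCat.homTmul (𝟙 x) g).op).hom
          (((E y').hom.app (op x)).hom ((w.hom.app (op ⟨x, y'⟩)).hom t))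
      refine Eq.trans ?_ (congrArg (Z.obj.map (TensorCat.homTmul (𝟙 x) g).op).hom (hE' t).symm)
      refine (congrArg ((E y).hom.app (op x)).hom (PSh.naturality_apply w _ t).symm).trans ?_
      exact (hE' _).trans (PSh.naturality_apply ψ _ t)
    refine ⟨PSh.mkHom (fun P => ((E P.right).hom.app (op P.left)).hom) (fun {P Q} f t => ?_), ?_⟩
    · obtain ⟨x, y⟩ := P
      obtain ⟨x', y'⟩ := Q
      induction f using TensorCat.hom_induction with
      | add f g hf hg =>
        rw [PSh.map_add_apply, PSh.map_add_apply]
        exact (map_add ((E y).hom.app (op x)).hom _ _).trans (congrArg₂ (· + ·) hf hg)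
      | tmul f g =>
        change ((E y).hom.app (op x)).hom ((V.obj.map (TensorCat.homTmul f g).op).hom t) =
          (Z.obj.map (TensorCat.homTmul f g).op).hom (((E y').hom.app (op x')).hom t)
        refine (congrArg ((E y).hom.app (op x)).hom
          (V.map_right_left_apply f g t).symm).trans ?_
        refine Eq.trans ?_ (Z.map_right_left_apply f g _)
        refine (congrArg (fun s : (sliceL k a y').obj V ⟶ (sliceL k a y).obj Z =>
          (s.hom.app (op x)).hom ((V.obj.map (TensorCat.homTmul f (𝟙 y')).op).hom t))
            (nat g)).trans ?_
        exact congrArg (Z.obj.map (TensorCat.homTmul (𝟙 x) g).op).hom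
          (PSh.naturality_apply (E y') f t)
    · refine PSh.hom_ext fun P t => hE' t

/-- The morphism `m ↦ m ⊗ n`. -/
def extInL (M : PSh k a) (N : PSh k b) {y : b} (n : N.obj.obj (op y)) :
    M ⟶ (sliceL k a y).obj (ext M N) :=
  PSh.mkHom (G := (sliceL k a y).obj (ext M N)) (fun x => (extTmul M N x y).flip n)
    (fun {x x'} f m => by
      refine Eq.trans ?_ (ext_map_extTmul f (𝟙 y) m n).symm
      rw [op_id, N.obj.map_id]; rfl)

theorem inverted_sliceL_extMap {C : Type u₃} [Category.{v₁} C] {L : PSh k a ⥤ C} {R : C ⥤ PSh k a}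
    (adj : L ⊣ R) {U V : PSh k a} {i : U ⟶ V} (hi : inverted L i) (N : PSh k b) (y : b) :
    inverted L ((sliceL k a y).map (extMap i (𝟙 N))) := by
  refine inverted_of_bijective adj _ fun F => ?_
  have hF := isLocal_inverted_obj adj F i hi
  constructor
  · intro g g' hg
    refine PSh.hom_ext fun x t => ?_
    induction t using ext_induction (x := x) (y := y) with
    | add s t hs ht =>
      exact (map_add (g.hom.app (op x)).hom s t).trans
        ((congrArg₂ (· + ·) hs ht).trans (map_add (g'.hom.app (op x)).hom s t).symm)
    | tmul m n =>
      have : extInL V N n ≫ g = extInL V N n ≫ g' := hF.1 (PSh.hom_ext fun x u =>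
        congrArg (fun s => (s.hom.app (op x)).hom (extTmul U N x y u n)) hg)
      exact congrArg (fun s => (s.hom.app (op x)).hom m) this
  · intro ψ
    choose E hE using fun n : N.obj.obj (op y) => hF.2 (extInL U N n ≫ ψ)
    replace hE : ∀ n, i ≫ E n = extInL U N n ≫ ψ := hE
    let E' : N.obj.obj (op y) →ₗ[k] (V ⟶ R.obj F) :=
      { toFun := E
        map_add' := fun n n' => hF.1 (by
          change i ≫ E (n + n') = i ≫ (E n + E n')
          rw [Preadditive.comp_add, hE, hE, hE]
          refine PSh.hom_ext fun x u => ?_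
          refine (congrArg (ψ.hom.app (op x)).hom ((extTmul U N x y u).map_add n n')).trans ?_
          exact map_add (ψ.hom.app (op x)).hom _ _)
        map_smul' := fun r n => hF.1 (by
          change i ≫ E (r • n) = i ≫ (r • E n)
          rw [Linear.comp_smul, hE, hE]
          refine PSh.hom_ext fun x u => ?_
          refine (congrArg (ψ.hom.app (op x)).hom ((extTmul U N x y u).map_smul r n)).trans ?_
          exact map_smul (ψ.hom.app (op x)).hom _ _) }
    let φ (x : a) : V.obj.obj (op x) →ₗ[k] N.obj.obj (op y) →ₗ[k] (R.obj F).obj.obj (op x) :=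
      LinearMap.flip
        { toFun := fun n => ((E' n).hom.app (op x)).hom
          map_add' := fun n n' => by rw [map_add]; rfl
          map_smul' := fun r n => by rw [map_smul]; rfl }
    let ℓ (x : a) : ((sliceL k a y).obj (ext V N)).obj.obj (op x) →ₗ[k] (R.obj F).obj.obj (op x) :=
      extLift (φ x)
    refine ⟨PSh.mkHom (F := (sliceL k a y).obj (ext V N)) ℓ (fun {x x'} f t => ?_), ?_⟩
    · induction t using ext_induction (x := x') (y := y) with
      | add s t hs ht =>
        refine (congrArg (ℓ x) (map_add
          (((sliceL k a y).obj (ext V N)).obj.map f.op).hom s t)).trans ?_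
        refine ((map_add (ℓ x) _ _).trans (congrArg₂ (· + ·) hs ht)).trans ?_
        refine (map_add ((R.obj F).obj.map f.op).hom _ _).symm.trans ?_
        exact congrArg ((R.obj F).obj.map f.op).hom (map_add (ℓ x') s t).symm
      | tmul m n =>
        change ((E ((N.obj.map (𝟙 y).op).hom n)).hom.app (op x)).hom ((V.obj.map f.op).hom m) =
          ((R.obj F).obj.map f.op).hom (((E n).hom.app (op x')).hom m)
        rw [op_id, N.obj.map_id]
        exact PSh.naturality_apply (E n) f m
    · refine PSh.hom_ext fun x t => ?_
      induction t using ext_induction (x := x) (y := y) with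
      | add s t hs ht =>
        refine Eq.trans ?_ ((congrArg₂ (· + ·) hs ht).trans
          (map_add (ψ.hom.app (op x)).hom s t).symm)
        refine (congrArg (ℓ x)
          (map_add ((extMap i (𝟙 N)).hom.app (op ⟨x, y⟩)).hom s t)).trans ?_
        exact map_add (ℓ x) _ _
      | tmul m n => exact congrArg (fun s => (s.hom.app (op x)).hom m) (hE n)

theorem bijective_extInL (V : PSh k a) (y : b) (Z : PSh k (TensorCat k a b)) :
    Function.Bijective (fun g : ext V ((yonedaPSh k b).obj y) ⟶ Z =>
      extInL V ((yonedaPSh k b).obj y) (yonedaElt (𝟙 y)) ≫ (sliceL k a y).map g) := by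
  constructor
  · intro g g' hg
    refine ext_hom_ext fun x y' m n => ?_
    obtain ⟨n, rfl⟩ := yonedaElt.surjective n
    have h : extTmul V ((yonedaPSh k b).obj y) x y' m (yonedaElt n) =
        ((ext V ((yonedaPSh k b).obj y)).obj.map (TensorCat.homTmul (𝟙 x) n).op).hom
          (extTmul V ((yonedaPSh k b).obj y) x y m (yonedaElt (𝟙 y))) := by
      rw [ext_map_extTmul, ← yonedaElt_comp, Category.comp_id, op_id, V.obj.map_id]; rfl
    rw [h, PSh.naturality_apply, PSh.naturality_apply]
    exact congrArg (fun s => (Z.obj.map _).hom ((s.hom.app (op x)).hom m)) hg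
  · intro s
    refine ⟨extDesc (fun x y' => LinearMap.mk₂ k (fun m n => (Z.obj.map
      (TensorCat.homTmul (𝟙 x) (yonedaElt.symm n : y' ⟶ y)).op).hom ((s.hom.app (op x)).hom m))
      (fun m m' n => ?_) (fun r m n => ?_) (fun m n n' => ?_) (fun r m n => ?_))
      (fun {x x' y₁ y₂} f g m n => ?_), ?_⟩
    · rw [map_add]; exact map_add (Z.obj.map _).hom _ _
    · rw [map_smul]; exact map_smul (Z.obj.map _).hom _ _
    · rw [map_add]
      refine Eq.trans ?_ (PSh.map_add_apply Z _ _ _)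
      exact congrArg (fun φ => (Z.obj.map (Quiver.Hom.op φ)).hom _) (TensorProduct.tmul_add _ _ _)
    · rw [map_smul]
      refine Eq.trans ?_ (PSh.map_smul_apply Z _ _ _)
      exact congrArg (fun φ => (Z.obj.map (Quiver.Hom.op φ)).hom _) (TensorProduct.tmul_smul _ _ _)
    · obtain ⟨n, rfl⟩ := yonedaElt.surjective n
      rw [← yonedaElt_comp, LinearMap.mk₂_apply, LinearMap.mk₂_apply, LinearEquiv.symm_apply_apply,
        LinearEquiv.symm_apply_apply, PSh.naturality_apply]
      refine (Z.map_right_left_apply f (g ≫ n) ((s.hom.app (op x')).hom m)).trans ?_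
      have h (z : Z.obj.obj (op ⟨x', y⟩)) : (Z.obj.map (TensorCat.homTmul f (g ≫ n)).op).hom z =
          (Z.obj.map (TensorCat.homTmul f g).op).hom
            ((Z.obj.map (TensorCat.homTmul (𝟙 x') n).op).hom z) := by
        rw [← PSh.map_comp_apply, ← TensorCat.homTmul_comp, Category.comp_id]
      exact h _
    · refine PSh.hom_ext fun x m => ?_
      change (Z.obj.map (𝟙 (⟨x, y⟩ : TensorCat k a b)).op).hom ((s.hom.app (op x)).hom m) = _
      rw [op_id, Z.obj.map_id]; rfl

theorem bijective_comp_sliceL {U V : PSh k a} (i : U ⟶ V) (y : b) (Z : PSh k (TensorCat k a b))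
    (h : Function.Bijective (fun g : ext V ((yonedaPSh k b).obj y) ⟶ Z =>
      extMap i (𝟙 ((yonedaPSh k b).obj y)) ≫ g)) :
    Function.Bijective (fun g : V ⟶ (sliceL k a y).obj Z => i ≫ g) := by
  refine (Function.Bijective.of_comp_iff _ (bijective_extInL V y Z)).1 ?_
  exact (bijective_extInL U y Z).comp h

end Slices

end LinSh

namespace LinSh

section Slices

variable {k : Type v} [CommRing k] {a : Type u₁} [Category.{v} a] [Preadditive a] [Linear k a]
  {b : Type u₂} [Category.{v} b] [Preadditive b] [Linear k b]

theorem bijective_of_sliceR {U V Z : PSh k (TensorCat k a b)} (w : U ⟶ V)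
    (h : ∀ x x', Function.Bijective
      (fun g : (sliceR k b x').obj V ⟶ (sliceR k b x).obj Z => (sliceR k b x').map w ≫ g)) :
    Function.Bijective (fun g : V ⟶ Z => w ≫ g) := by
  constructor
  · intro g g' hg
    refine PSh.hom_ext fun P t => ?_
    have : (sliceR k b P.left).map g = (sliceR k b P.left).map g' := (h _ _).1 (by
      dsimp only
      rw [← Functor.map_comp, ← Functor.map_comp]
      exact congrArg _ hg)
    exact congrArg (fun s => (s.hom.app (op P.right)).hom t) this
  · intro ψ
    choose E hE using fun x => (h x x).2 ((sliceR k b x).map ψ)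
    have hE' : ∀ {x : a} {y : b} (t : U.obj.obj (op ⟨x, y⟩)),
        ((E x).hom.app (op y)).hom ((w.hom.app (op ⟨x, y⟩)).hom t) =
          (ψ.hom.app (op ⟨x, y⟩)).hom t :=
      fun {x y} t => congrArg (fun s => (s.hom.app (op y)).hom t) (hE x)
    have nat : ∀ {x x' : a} (f : x ⟶ x'), sliceRMap V f ≫ E x = E x' ≫ sliceRMap Z f := by
      intro x x' f
      refine (h x x').1 (PSh.hom_ext fun y t => ?_)
      change ((E x).hom.app (op y)).hom ((V.obj.map (TensorCat.homTmul f (𝟙 y)).op).hom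
        ((w.hom.app (op ⟨x', y⟩)).hom t)) = (Z.obj.map (TensorCat.homTmul f (𝟙 y)).op).hom
          (((E x').hom.app (op y)).hom ((w.hom.app (op ⟨x', y⟩)).hom t))
      refine Eq.trans ?_ (congrArg (Z.obj.map (TensorCat.homTmul f (𝟙 y)).op).hom (hE' t).symm)
      refine (congrArg ((E x).hom.app (op y)).hom (PSh.naturality_apply w _ t).symm).trans ?_
      exact (hE' _).trans (PSh.naturality_apply ψ _ t)
    refine ⟨PSh.mkHom (fun P => ((E P.left).hom.app (op P.right)).hom) (fun {P Q} f t => ?_), ?_⟩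
    · obtain ⟨x, y⟩ := P
      obtain ⟨x', y'⟩ := Q
      induction f using TensorCat.hom_induction with
      | add f g hf hg =>
        rw [PSh.map_add_apply, PSh.map_add_apply]
        exact (map_add ((E x).hom.app (op y)).hom _ _).trans (congrArg₂ (· + ·) hf hg)
      | tmul f g =>
        change ((E x).hom.app (op y)).hom ((V.obj.map (TensorCat.homTmul f g).op).hom t) =
          (Z.obj.map (TensorCat.homTmul f g).op).hom (((E x').hom.app (op y')).hom t)
        refine (congrArg ((E x).hom.app (op y)).hom
          (V.map_left_right_apply f g t).symm).trans ?_
        refine Eq.trans ?_ (Z.map_left_right_apply f g _)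
        refine (congrArg (fun s : (sliceR k b x').obj V ⟶ (sliceR k b x).obj Z =>
          (s.hom.app (op y)).hom ((V.obj.map (TensorCat.homTmul (𝟙 x') g).op).hom t))
            (nat f)).trans ?_
        exact congrArg (Z.obj.map (TensorCat.homTmul f (𝟙 y)).op).hom
          (PSh.naturality_apply (E x') g t)
    · refine PSh.hom_ext fun P t => hE' t

/-- The morphism `n ↦ m ⊗ n`. -/
def extInR (M : PSh k a) (N : PSh k b) {x : a} (m : M.obj.obj (op x)) :
    N ⟶ (sliceR k b x).obj (ext M N) :=
  PSh.mkHom (G := (sliceR k b x).obj (ext M N)) (fun y => extTmul M N x y m)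
    (fun {y y'} g n => by
      refine Eq.trans ?_ (ext_map_extTmul (𝟙 x) g m n).symm
      rw [op_id, M.obj.map_id]; rfl)

theorem inverted_sliceR_extMap {C : Type u₃} [Category.{v₁} C] {L : PSh k b ⥤ C} {R : C ⥤ PSh k b}
    (adj : L ⊣ R) {U V : PSh k b} {i : U ⟶ V} (hi : inverted L i) (M : PSh k a) (x : a) :
    inverted L ((sliceR k b x).map (extMap (𝟙 M) i)) := by
  refine inverted_of_bijective adj _ fun F => ?_
  have hF := isLocal_inverted_obj adj F i hi
  constructor
  · intro g g' hg
    refine PSh.hom_ext fun y t => ?_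
    induction t using ext_induction (x := x) (y := y) with
    | add s t hs ht =>
      exact (map_add (g.hom.app (op y)).hom s t).trans
        ((congrArg₂ (· + ·) hs ht).trans (map_add (g'.hom.app (op y)).hom s t).symm)
    | tmul m n =>
      have : extInR M V m ≫ g = extInR M V m ≫ g' := hF.1 (PSh.hom_ext fun y u =>
        congrArg (fun s => (s.hom.app (op y)).hom (extTmul M U x y m u)) hg)
      exact congrArg (fun s => (s.hom.app (op y)).hom n) this
  · intro ψ
    choose E hE using fun m : M.obj.obj (op x) => hF.2 (extInR M U m ≫ ψ)
    replace hE : ∀ m, i ≫ E m = extInR M U m ≫ ψ := hE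
    let E' : M.obj.obj (op x) →ₗ[k] (V ⟶ R.obj F) :=
      { toFun := E
        map_add' := fun m m' => hF.1 (by
          change i ≫ E (m + m') = i ≫ (E m + E m')
          rw [Preadditive.comp_add, hE, hE, hE]
          refine PSh.hom_ext fun y u => ?_
          refine (congrArg (ψ.hom.app (op y)).hom
            ((extTmul M U x y).map_add₂ m m' u)).trans ?_
          exact map_add (ψ.hom.app (op y)).hom _ _)
        map_smul' := fun r m => hF.1 (by
          change i ≫ E (r • m) = i ≫ (r • E m)
          rw [Linear.comp_smul, hE, hE]
          refine PSh.hom_ext fun y u => ?_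
          refine (congrArg (ψ.hom.app (op y)).hom
            ((extTmul M U x y).map_smul₂ r m u)).trans ?_
          exact map_smul (ψ.hom.app (op y)).hom _ _) }
    let φ (y : b) : M.obj.obj (op x) →ₗ[k] V.obj.obj (op y) →ₗ[k] (R.obj F).obj.obj (op y) :=
      { toFun := fun m => ((E' m).hom.app (op y)).hom
        map_add' := fun m m' => by rw [map_add]; rfl
        map_smul' := fun r m => by rw [map_smul]; rfl }
    let ℓ (y : b) : ((sliceR k b x).obj (ext M V)).obj.obj (op y) →ₗ[k] (R.obj F).obj.obj (op y) :=
      extLift (φ y)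
    refine ⟨PSh.mkHom (F := (sliceR k b x).obj (ext M V)) ℓ (fun {y y'} f t => ?_), ?_⟩
    · induction t using ext_induction (x := x) (y := y') with
      | add s t hs ht =>
        refine (congrArg (ℓ y) (map_add
          (((sliceR k b x).obj (ext M V)).obj.map f.op).hom s t)).trans ?_
        refine ((map_add (ℓ y) _ _).trans (congrArg₂ (· + ·) hs ht)).trans ?_
        refine (map_add ((R.obj F).obj.map f.op).hom _ _).symm.trans ?_
        exact congrArg ((R.obj F).obj.map f.op).hom (map_add (ℓ y') s t).symm
      | tmul m n =>
        change ((E ((M.obj.map (𝟙 x).op).hom m)).hom.app (op y)).hom ((V.obj.map f.op).hom n) =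
          ((R.obj F).obj.map f.op).hom (((E m).hom.app (op y')).hom n)
        rw [op_id, M.obj.map_id]
        exact PSh.naturality_apply (E m) f n
    · refine PSh.hom_ext fun y t => ?_
      induction t using ext_induction (x := x) (y := y) with
      | add s t hs ht =>
        refine Eq.trans ?_ ((congrArg₂ (· + ·) hs ht).trans
          (map_add (ψ.hom.app (op y)).hom s t).symm)
        refine (congrArg (ℓ y)
          (map_add ((extMap (𝟙 M) i).hom.app (op ⟨x, y⟩)).hom s t)).trans ?_
        exact map_add (ℓ y) _ _
      | tmul m n => exact congrArg (fun s => (s.hom.app (op y)).hom n) (hE m)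

theorem bijective_extInR (V : PSh k b) (x : a) (Z : PSh k (TensorCat k a b)) :
    Function.Bijective (fun g : ext ((yonedaPSh k a).obj x) V ⟶ Z =>
      extInR ((yonedaPSh k a).obj x) V (yonedaElt (𝟙 x)) ≫ (sliceR k b x).map g) := by
  constructor
  · intro g g' hg
    refine ext_hom_ext fun x' y m n => ?_
    obtain ⟨m, rfl⟩ := yonedaElt.surjective m
    have h : extTmul ((yonedaPSh k a).obj x) V x' y (yonedaElt m) n =
        ((ext ((yonedaPSh k a).obj x) V).obj.map (TensorCat.homTmul m (𝟙 y)).op).hom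
          (extTmul ((yonedaPSh k a).obj x) V x y (yonedaElt (𝟙 x)) n) := by
      rw [ext_map_extTmul, ← yonedaElt_comp, Category.comp_id, op_id, V.obj.map_id]; rfl
    rw [h, PSh.naturality_apply, PSh.naturality_apply]
    exact congrArg (fun s => (Z.obj.map _).hom ((s.hom.app (op y)).hom n)) hg
  · intro s
    refine ⟨extDesc (fun x' y => LinearMap.mk₂ k (fun m n => (Z.obj.map
      (TensorCat.homTmul (yonedaElt.symm m : x' ⟶ x) (𝟙 y)).op).hom ((s.hom.app (op y)).hom n))
      (fun m m' n => ?_) (fun r m n => ?_) (fun m n n' => ?_) (fun r m n => ?_))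
      (fun {x₁ x₂ y y'} f g m n => ?_), ?_⟩
    · rw [map_add]
      refine Eq.trans ?_ (PSh.map_add_apply Z _ _ _)
      exact congrArg (fun φ => (Z.obj.map (Quiver.Hom.op φ)).hom _) (TensorProduct.add_tmul _ _ _)
    · rw [map_smul]
      refine Eq.trans ?_ (PSh.map_smul_apply Z _ _ _)
      exact congrArg (fun φ => (Z.obj.map (Quiver.Hom.op φ)).hom _)
        (TensorProduct.smul_tmul' (R := k) r _ _).symm
    · rw [map_add]; exact map_add (Z.obj.map _).hom _ _
    · rw [map_smul]; exact map_smul (Z.obj.map _).hom _ _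
    · obtain ⟨m, rfl⟩ := yonedaElt.surjective m
      rw [← yonedaElt_comp, LinearMap.mk₂_apply, LinearMap.mk₂_apply, LinearEquiv.symm_apply_apply,
        LinearEquiv.symm_apply_apply, PSh.naturality_apply]
      refine (Z.map_left_right_apply (f ≫ m) g ((s.hom.app (op y')).hom n)).trans ?_
      have h (z : Z.obj.obj (op ⟨x, y'⟩)) : (Z.obj.map (TensorCat.homTmul (f ≫ m) g).op).hom z =
          (Z.obj.map (TensorCat.homTmul f g).op).hom
            ((Z.obj.map (TensorCat.homTmul m (𝟙 y')).op).hom z) := by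
        rw [← PSh.map_comp_apply, ← TensorCat.homTmul_comp, Category.comp_id]
      exact h _
    · refine PSh.hom_ext fun y n => ?_
      change (Z.obj.map (𝟙 (⟨x, y⟩ : TensorCat k a b)).op).hom ((s.hom.app (op y)).hom n) = _
      rw [op_id, Z.obj.map_id]; rfl

theorem bijective_comp_sliceR {U V : PSh k b} (i : U ⟶ V) (x : a) (Z : PSh k (TensorCat k a b))
    (h : Function.Bijective (fun g : ext ((yonedaPSh k a).obj x) V ⟶ Z =>
      extMap (𝟙 ((yonedaPSh k a).obj x)) i ≫ g)) :
    Function.Bijective (fun g : V ⟶ (sliceR k b x).obj Z => i ≫ g) := by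
  refine (Function.Bijective.of_comp_iff _ (bijective_extInR V x Z)).1 ?_
  exact (bijective_extInR U x Z).comp h

end Slices

end LinSh

namespace LinSh

section CommonInverted

open scoped ZeroObject

variable {P : Type u₁} [Category.{v₁} P] {C : Type u₂} [Category.{v₂} C] {ι : Type u₃}
  (Φ : ι → P ⥤ C)

/-- The monomorphisms sent to isomorphisms by all functors of a family. -/
def invertedMono : MorphismProperty P := fun _ _ f => Mono f ∧ ∀ y, IsIso ((Φ y).map f)

theorem invertedMono_le : invertedMono Φ ≤ MorphismProperty.monomorphisms P := fun _ _ _ h => h.1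

variable [Abelian P] [Abelian C] [∀ y, PreservesFiniteLimits (Φ y)]

instance : (invertedMono Φ).IsStableUnderBaseChange where
  of_isPullback {_ _ _ _ _ _ _ _} sq h :=
    ⟨(MorphismProperty.monomorphisms P).of_isPullback sq h.1,
      fun y => (MorphismProperty.isomorphisms C).of_isPullback (sq.map (Φ y)) (h.2 y)⟩

theorem bijective_comp_of_isLocal [∀ y, (Φ y).Additive] {Z : P} (hZ : (invertedMono Φ).isLocal Z)
    {X Y : P} (j : X ⟶ Y) (hj : ∀ y, IsIso ((Φ y).map j)) :
    Function.Bijective (fun g : Y ⟶ Z => j ≫ g) := by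
  let e := Abelian.factorThruImage j
  let m := Abelian.image.ι j
  have hem : e ≫ m = j := Abelian.image.fac j
  have hm : ∀ y, IsIso ((Φ y).map m) := fun y => by
    have := hj y
    have : (Φ y).map e ≫ (Φ y).map m = (Φ y).map j := by rw [← Functor.map_comp, hem]
    have := epi_of_epi_fac this
    exact isIso_of_mono_of_epi _
  have he : ∀ y, IsIso ((Φ y).map e) := fun y => by
    have := hj y
    have := hm y
    have : IsIso ((Φ y).map e ≫ (Φ y).map m) := by rw [← Functor.map_comp, hem]; infer_instance
    exact IsIso.of_isIso_comp_right _ ((Φ y).map m)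
  have hK : ∀ y, IsZero ((Φ y).obj (kernel e)) := fun y => by
    have := he y
    refine IsZero.of_mono_eq_zero ((Φ y).map (kernel.ι e)) ?_
    rw [← cancel_mono ((Φ y).map e), ← Functor.map_comp, kernel.condition, Functor.map_zero,
      zero_comp]
  have h0 : invertedMono Φ (0 : (0 : P) ⟶ kernel e) :=
    ⟨inferInstance, fun y => ⟨0, ((Φ y).map_isZero (isZero_zero P)).eq_of_src _ _,
      (hK y).eq_of_src _ _⟩⟩
  have he' : Function.Bijective (fun g : Abelian.image j ⟶ Z => e ≫ g) :=
    ⟨fun g g' h => (cancel_epi e).1 h, fun ψ => ⟨Abelian.epiDesc e ψ ((hZ _ h0).1 (by simp)),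
      Abelian.comp_epiDesc _ _ _⟩⟩
  have : (fun g : Y ⟶ Z => j ≫ g) = (fun g => e ≫ g) ∘ (fun g => m ≫ g) := by
    funext g
    simp [← hem]
  rw [this]
  exact he'.comp (hZ m ⟨inferInstance, hm⟩)

end CommonInverted

section SheafIso

variable {k : Type v} [CommRing k] {a : Type u} [Category.{v} a] [Preadditive a]

theorem FormalSeq.ExactOn.of_iso {s : FormalSeq.{v} a} {F G : aᵒᵖ ⥤ ModuleCat.{v} k} (e : F ≅ G)
    (h : s.ExactOn F) : s.ExactOn G := by
  let α (X : a) : F.obj (op X) ≃ₗ[k] G.obj (op X) := (e.app (op X)).toLinearEquiv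
  have nat {X Y : a} (f : X ⟶ Y) (x : F.obj (op Y)) :
      α X ((F.map f.op).hom x) = (G.map f.op).hom (α Y x) :=
    ConcreteCategory.congr_hom (e.hom.naturality f.op) x
  have hQ (x) : s.evalQ G (α _ x) = fun j => α _ (s.evalQ F x j) := funext fun j => (nat _ x).symm
  have hP (y) : s.evalP G (fun j => α _ (y j)) = fun i => α _ (s.evalP F y i) := funext fun i => by
    refine Eq.trans ?_ ((α (s.Z i)).toAddEquiv.map_finsum _).symm
    exact finsum_congr fun j => (nat _ _).symm
  constructor
  · intro x x' hx
    obtain ⟨x, rfl⟩ := (α _).surjective x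
    obtain ⟨x', rfl⟩ := (α _).surjective x'
    rw [hQ, hQ] at hx
    exact congrArg _ (h.1 (funext fun j => (α _).injective (congrFun hx j)))
  · intro y
    obtain ⟨y, rfl⟩ : ∃ y', y = fun j => α (s.Y j) (y' j) :=
      ⟨fun j => (α _).symm (y j), funext fun j => ((α _).apply_symm_apply _).symm⟩
    rw [hP]
    have h0 : (fun i => α (s.Z i) (s.evalP F y i)) = 0 ↔ s.evalP F y = 0 :=
      ⟨fun h => funext fun i => (α _).injective ((congrFun h i).trans (map_zero _).symm),
        fun h => funext fun i => by rw [h]; exact map_zero _⟩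
    rw [h0, h.2 y]
    constructor
    · rintro ⟨x, rfl⟩
      exact ⟨α _ x, hQ x⟩
    · rintro ⟨x, hx⟩
      obtain ⟨x, rfl⟩ := (α _).surjective x
      rw [hQ] at hx
      exact ⟨x, funext fun j => (α _).injective (congrFun hx j)⟩

instance [Linear k a] (S : Set (FormalSeq.{v} a)) : (isSheafFor k S).IsClosedUnderIsomorphisms where
  of_iso e h s hs := (h s hs).of_iso ((isLinearPresheaf k a).ι.mapIso e)

end SheafIso

/-! ### The adjunction of a realisation -/

section Realisation

variable {k : Type v} [CommRing k] {a : Type u} [Category.{v} a] [Preadditive a] [Linear k a]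

namespace IsLocalisation

variable {C : Type u₁} [Category.{v₁} C] [Preadditive C] {B : Type u₂}
    [Category.{v₂} B] [Preadditive B] {I : C ⥤ B} (h : IsLocalisation I)

/-- The adjunction of a localisation. -/
def adjunction : h.sheafification ⊣ I := h.exists_leftAdjoint.choose_spec.1.some

theorem preservesFiniteLimits : PreservesFiniteLimits h.sheafification :=
  h.exists_leftAdjoint.choose_spec.2

end IsLocalisation

variable {A : Type u₁} [Category.{v₁} A] [Preadditive A] [Linear k A]
  {S : Set (FormalSeq.{v} a)} (ρ : Realisation k A S)

namespace Realisation

/-- The exact left adjoint `PSh a ⥤ A`. -/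
def reflection : PSh k a ⥤ A := ρ.localisation.sheafification ⋙ ρ.equiv.inverse

/-- The embedding `A ⥤ PSh a`. -/
def embedding : A ⥤ PSh k a := ρ.equiv.functor ⋙ (isSheafFor k S).ι

/-- The reflection is left adjoint to the embedding. -/
def adjunction : ρ.reflection ⊣ ρ.embedding :=
  ρ.localisation.adjunction.comp ρ.equiv.symm.toAdjunction

instance : ρ.embedding.Full := inferInstanceAs (ρ.equiv.functor ⋙ (isSheafFor k S).ι).Full

instance : ρ.embedding.Faithful := inferInstanceAs (ρ.equiv.functor ⋙ (isSheafFor k S).ι).Faithful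

instance : ρ.embedding.Additive :=
  have := ρ.additive
  inferInstanceAs (ρ.equiv.functor ⋙ (isSheafFor k S).ι).Additive

instance : ρ.embedding.Linear k :=
  have := ρ.linear
  have : (isSheafFor k S).ι.Linear k := {}
  inferInstanceAs (Functor.Linear k (ρ.equiv.functor ⋙ (isSheafFor k S).ι))

instance : ρ.reflection.Additive := ρ.adjunction.left_adjoint_additive

instance : ρ.reflection.Linear k := linear_of_adjunction ρ.adjunction

instance : PreservesFiniteLimits ρ.reflection :=
  have := ρ.localisation.preservesFiniteLimits
  inferInstanceAs (PreservesFiniteLimits (ρ.localisation.sheafification ⋙ ρ.equiv.inverse))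

theorem isSheafFor_eq : isSheafFor k S = (inverted ρ.reflection).isLocal := by
  ext F
  constructor
  · intro hF X Y f hf
    refine isLocal_inverted_obj ρ.localisation.adjunction ⟨F, hF⟩ f ?_
    have : IsIso (ρ.equiv.inverse.map (ρ.localisation.sheafification.map f)) := hf
    exact isIso_of_reflects_iso _ ρ.equiv.inverse
  · intro hF
    have := isIso_unit_of_isLocal ρ.adjunction hF
    exact (isSheafFor k S).prop_of_iso (asIso (ρ.adjunction.unit.app F)).symm
      (ρ.equiv.functor.obj (ρ.reflection.obj F)).property

end Realisation

end Realisation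

/-! ### The product is a localisation -/

section BoxLocalisation

variable {k : Type v} [CommRing k] {a : Type u₁} [Category.{v} a] [Preadditive a] [Linear k a]
  {b : Type u₂} [Category.{v} b] [Preadditive b] [Linear k b]

theorem isLocal_sliceL_iff {A : Type u₃} [Category.{v₁} A] [Abelian A] {L : PSh k a ⥤ A}
    {R : A ⥤ PSh k a} (adj : L ⊣ R) [L.Additive] [PreservesFiniteLimits L]
    (Z : PSh k (TensorCat k a b)) :
    (invertedMono fun y => sliceL k a y ⋙ L).isLocal Z ↔
      ∀ y, (inverted L).isLocal ((sliceL k a y).obj Z) :=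
  ⟨fun h y _ _ i hi => bijective_comp_sliceL i y Z (bijective_comp_of_isLocal _ h _ fun y' =>
      inverted_sliceL_extMap adj hi _ y'),
    fun h _ _ w hw => bijective_of_sliceL w fun y y' => h y _ (hw.2 y')⟩

theorem isLocal_sliceR_iff {B : Type u₃} [Category.{v₁} B] [Abelian B] {L : PSh k b ⥤ B}
    {R : B ⥤ PSh k b} (adj : L ⊣ R) [L.Additive] [PreservesFiniteLimits L]
    (Z : PSh k (TensorCat k a b)) :
    (invertedMono fun x => sliceR k b x ⋙ L).isLocal Z ↔
      ∀ x, (inverted L).isLocal ((sliceR k b x).obj Z) :=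
  ⟨fun h x _ _ i hi => bijective_comp_sliceR i x Z (bijective_comp_of_isLocal _ h _ fun x' =>
      inverted_sliceR_extMap adj hi _ x'),
    fun h _ _ w hw => bijective_of_sliceR w fun x x' => h x _ (hw.2 x')⟩

theorem isBoxSheaf_iff (S₁ : Set (FormalSeq.{v} a)) (S₂ : Set (FormalSeq.{v} b))
    (Z : PSh k (TensorCat k a b)) : isBoxSheaf k S₁ S₂ Z ↔
      (∀ y, isSheafFor k S₁ ((sliceL k a y).obj Z)) ∧
        ∀ x, isSheafFor k S₂ ((sliceR k b x).obj Z) :=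
  ⟨fun h => ⟨fun y s hs => h.1 s hs y, fun x s hs => h.2 s hs x⟩,
    fun h => ⟨fun s hs y => h.1 y s hs, fun s hs x => h.2 x s hs⟩⟩

variable {A : Type u₃} [Category.{v₁} A] [Abelian A] [Linear k A]
  {B : Type u₄} [Category.{v₂} B] [Abelian B] [Linear k B]
  {S₁ : Set (FormalSeq.{v} a)} {S₂ : Set (FormalSeq.{v} b)}

theorem isBoxSheaf_eq (ρ₁ : Realisation k A S₁) (ρ₂ : Realisation k B S₂) : isBoxSheaf k S₁ S₂ =
    ((invertedMono fun y : b => sliceL k a y ⋙ ρ₁.reflection) ⊔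
      (invertedMono fun x : a => sliceR k b x ⋙ ρ₂.reflection)).isLocal := by
  ext Z
  rw [isBoxSheaf_iff, ρ₁.isSheafFor_eq, ρ₂.isSheafFor_eq, ← isLocal_sliceL_iff ρ₁.adjunction,
    ← isLocal_sliceR_iff ρ₂.adjunction]
  exact ⟨fun h _ _ w hw => hw.elim (h.1 w) (h.2 w),
    fun h => ⟨fun _ _ w hw => h w (.inl hw), fun _ _ w hw => h w (.inr hw)⟩⟩

theorem isLocalisation_box [EssentiallySmall.{v} a] [EssentiallySmall.{v} b]
    (ρ₁ : Realisation k A S₁) (ρ₂ : Realisation k B S₂) :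
    IsLocalisation (isBoxSheaf k S₁ S₂).ι := by
  rw [isBoxSheaf_eq ρ₁ ρ₂]
  let W := (invertedMono fun y : b => sliceL k a y ⋙ ρ₁.reflection) ⊔
    (invertedMono fun x : a => sliceR k b x ⋙ ρ₂.reflection)
  have : W.IsStableUnderBaseChange := ⟨fun {_ _ _ _ _ _ _ _} sq h =>
    h.imp (MorphismProperty.of_isPullback sq) (MorphismProperty.of_isPullback sq)⟩
  exact isLocalisation_isLocal.{v} (W := W) (sup_le (invertedMono_le _) (invertedMono_le _))

end BoxLocalisation

end LinSh

namespace LinSh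

section ExternalCocontinuous

variable {k : Type v} [CommRing k] {a : Type u₁} [Category.{v} a] [Preadditive a] [Linear k a]
  {b : Type u₂} [Category.{v} b] [Preadditive b] [Linear k b]

theorem isLinCocont_extFunctor_sectL (N : PSh k b) :
    isLinCocont k (PSh k a) (PSh k (TensorCat k a b))
      (Prod.sectL (PSh k a) N ⋙ extFunctor k a b) := by
  refine ⟨⟨fun {M M' f g} => ext_hom_ext fun x y m n => ?_⟩,
    ⟨fun {M M'} f r => ext_hom_ext fun x y m n => ?_⟩, ⟨fun {J} _ => ?_⟩⟩
  · exact (extTmul M' N x y).map_add₂ _ _ n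
  · exact (extTmul M' N x y).map_smul₂ r _ n
  · have : PreservesColimitsOfShape J ((Prod.sectL (PSh k a) N ⋙ extFunctor k a b) ⋙
        (isLinearPresheaf k (TensorCat k a b)).ι) := by
      refine preservesColimitsOfShape_of_evaluation _ _ fun P => ?_
      have := (BraidedCategory.tensorLeftIsoTensorRight (N.obj.obj (op P.unop.right)))
      have : PreservesColimitsOfShape J
          (MonoidalCategory.tensorRight (N.obj.obj (op P.unop.right))) :=
        preservesColimitsOfShape_of_natIso this
      exact inferInstanceAs (PreservesColimitsOfShape J ((isLinearPresheaf k a).ι ⋙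
        (evaluation _ _).obj (op P.unop.left) ⋙
          MonoidalCategory.tensorRight (N.obj.obj (op P.unop.right))))
    exact preservesColimitsOfShape_of_reflects_of_preserves _
      (isLinearPresheaf k (TensorCat k a b)).ι

theorem isLinCocont_extFunctor_sectR (M : PSh k a) :
    isLinCocont k (PSh k b) (PSh k (TensorCat k a b))
      (Prod.sectR M (PSh k b) ⋙ extFunctor k a b) := by
  refine ⟨⟨fun {N N' f g} => ext_hom_ext fun x y m n => ?_⟩,
    ⟨fun {N N'} f r => ext_hom_ext fun x y m n => ?_⟩, ⟨fun {J} _ => ?_⟩⟩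
  · exact (extTmul M N' x y m).map_add _ _
  · exact (extTmul M N' x y m).map_smul r _
  · have : PreservesColimitsOfShape J ((Prod.sectR M (PSh k b) ⋙ extFunctor k a b) ⋙
        (isLinearPresheaf k (TensorCat k a b)).ι) := by
      refine preservesColimitsOfShape_of_evaluation _ _ fun P => ?_
      exact inferInstanceAs (PreservesColimitsOfShape J ((isLinearPresheaf k b).ι ⋙
        (evaluation _ _).obj (op P.unop.right) ⋙
          MonoidalCategory.tensorLeft (M.obj.obj (op P.unop.left))))
    exact preservesColimitsOfShape_of_reflects_of_preserves _
      (isLinearPresheaf k (TensorCat k a b)).ι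

end ExternalCocontinuous

theorem isLinCocont_reflective_comp {k : Type v} [CommRing k] {c : Type u} [Category.{v} c]
    [Preadditive c] [Linear k c] [EssentiallySmall.{v} c]
    {C : Type u₁} [Category.{v₁} C] [Preadditive C] [Linear k C]
    {L : PSh k c ⥤ C} {R : C ⥤ PSh k c} (adj : L ⊣ R) [R.Full] [R.Faithful] [R.Additive]
    [R.Linear k] {D : Type u₄} [Category.{w'} D] [Preadditive D] [Linear k D] [LocallySmall.{v} D]
    {K : PSh k c ⥤ D} (hK : isLinCocont k (PSh k c) D K) (hL : inverted L ≤ inverted K) :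
    isLinCocont k C D (R ⋙ K) := by
  obtain ⟨_, _, _⟩ := hK
  let N := nerve k (yonedaPSh k c ⋙ K)
  let adjK : K ⊣ N := nerveAdjunction K
  have hN : ∀ d, IsIso (adj.unit.app (N.obj d)) := fun d =>
    isIso_unit_of_isLocal adj fun _ _ i hi => isLocal_inverted_obj adjK d i (hL i hi)
  let e : N ≅ N ⋙ L ⋙ R := NatIso.ofComponents (fun d => @asIso _ _ _ _ _ (hN d))
    (fun f => adj.unit.naturality (N.map f))
  have adj' : R ⋙ K ⊣ N ⋙ L := adjK.restrictFullyFaithful (Functor.FullyFaithful.ofFullyFaithful R)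
    (Functor.FullyFaithful.id D) (Iso.refl _) e
  have := adj'.leftAdjoint_preservesColimits
  exact ⟨inferInstance, inferInstance, inferInstance⟩

/-! ### Restriction of natural transformations -/

section RestrictBijective

variable {A : Type u₁} [Category.{v} A] {B : Type u₂} [Category.{w} B] {C : Type u₃}
  [Category.{v₁} C] {D : Type u₄} [Category.{w'} D] {p : A ⥤ B} {q : B ⥤ C}

theorem RestrictBijective.of_iso {p' : A ⥤ B} {H H' : B ⥤ D} (h : RestrictBijective p H H')
    (e : p ≅ p') : RestrictBijective p' H H' := by
  have : (fun α : H ⟶ H' => Functor.whiskerLeft p' α) =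
      (Iso.homCongr (Functor.isoWhiskerRight e H) (Functor.isoWhiskerRight e H')) ∘
        (fun α => Functor.whiskerLeft p α) := by
    funext α
    ext X
    change _ = H.map (e.inv.app X) ≫ α.app (p.obj X) ≫ H'.map (e.hom.app X)
    rw [← α.naturality, ← Category.assoc, ← H.map_comp, e.inv_hom_id_app, H.map_id,
      Category.id_comp]
    rfl
  unfold RestrictBijective
  rw [this]
  exact (Equiv.bijective _).comp h

theorem RestrictBijective.comp {H H' : C ⥤ D} (hp : RestrictBijective p (q ⋙ H) (q ⋙ H'))
    (hq : RestrictBijective q H H') : RestrictBijective (p ⋙ q) H H' :=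
  Function.Bijective.comp hp hq

theorem RestrictBijective.of_comp {H H' : C ⥤ D} (hp : RestrictBijective p (q ⋙ H) (q ⋙ H'))
    (hpq : RestrictBijective (p ⋙ q) H H') : RestrictBijective q H H' :=
  (Function.Bijective.of_comp_iff' hp _).1 hpq

theorem RestrictBijective.nonempty_iso {H H' : B ⥤ D} (h : ∀ X ∈ ({H, H'} : Set (B ⥤ D)),
    ∀ Y ∈ ({H, H'} : Set (B ⥤ D)), RestrictBijective p X Y) (e : p ⋙ H ≅ p ⋙ H') :
    Nonempty (H ≅ H') := by
  obtain ⟨f, hf⟩ := (h H (by simp) H' (by simp)).2 e.hom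
  obtain ⟨g, hg⟩ := (h H' (by simp) H (by simp)).2 e.inv
  replace hf : Functor.whiskerLeft p f = e.hom := hf
  replace hg : Functor.whiskerLeft p g = e.inv := hg
  refine ⟨⟨f, g, (h H (by simp) H (by simp)).1 ?_, (h H' (by simp) H' (by simp)).1 ?_⟩⟩
  · dsimp only
    rw [Functor.whiskerLeft_comp, hf, hg, e.hom_inv_id, Functor.whiskerLeft_id']
  · dsimp only
    rw [Functor.whiskerLeft_comp, hf, hg, e.inv_hom_id, Functor.whiskerLeft_id']

end RestrictBijective

/-! ### Linear functors on the tensor product of categories -/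

section TensorFunctors

variable {k : Type v} [CommRing k] {a : Type u₁} [Category.{v} a] [Preadditive a] [Linear k a]
  {b : Type u₂} [Category.{v} b] [Preadditive b] [Linear k b]
  {D : Type u₄} [Category.{w'} D] [Preadditive D]

theorem restrictBijective_pair {G G' : TensorCat k a b ⥤ D} [G.Additive] [G'.Additive] :
    RestrictBijective (TensorCat.pair k a b) G G' := by
  constructor
  · intro α α' h
    ext P
    exact NatTrans.congr_app h (P.left, P.right)
  · intro α
    let β (P : TensorCat k a b) : G.obj P ⟶ G'.obj P := α.app (P.left, P.right)
    refine ⟨{ app := β, naturality := fun P Q f => ?_ }, rfl⟩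
    induction f using TensorCat.hom_induction with
    | add f g hf hg =>
      rw [G.map_add, G'.map_add, Preadditive.add_comp, Preadditive.comp_add, hf, hg]
    | tmul f g => exact α.naturality (Prod.mkHom f g)

variable [Linear k D] (F : a × b ⥤ D) [∀ y, (Prod.sectL a y ⋙ F).Additive]
  [∀ y, (Prod.sectL a y ⋙ F).Linear k] [∀ x, (Prod.sectR x b ⋙ F).Additive]
  [∀ x, (Prod.sectR x b ⋙ F).Linear k]

/-- The action of a bilinear functor on morphisms, as a bilinear map. -/
def bilinearMap (x x' : a) (y y' : b) :
    (x ⟶ x') →ₗ[k] (y ⟶ y') →ₗ[k] (F.obj (x, y) ⟶ F.obj (x', y')) :=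
  (Linear.comp (F.obj (x, y)) (F.obj (x', y)) (F.obj (x', y'))).compl₁₂
    ((Prod.sectL a y ⋙ F).mapLinearMap k) ((Prod.sectR x' b ⋙ F).mapLinearMap k)

theorem bilinearMap_apply {x x' : a} {y y' : b} (f : x ⟶ x') (g : y ⟶ y') :
    bilinearMap (k := k) F x x' y y' f g = F.map (Prod.mkHom f g) := by
  refine (F.map_comp (Prod.mkHom f (𝟙 y)) (Prod.mkHom (𝟙 x') g)).symm.trans ?_
  congr 1
  ext <;> simp

/-- The morphism part of the linear extension of a bilinear functor. -/
def tensorExtMap (P Q : TensorCat k a b) :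
    (P ⟶ Q) →ₗ[k] (F.obj (P.left, P.right) ⟶ F.obj (Q.left, Q.right)) :=
  TensorProduct.lift (bilinearMap F P.left Q.left P.right Q.right)

theorem tensorExtMap_homTmul {x x' : a} {y y' : b} (f : x ⟶ x') (g : y ⟶ y') :
    tensorExtMap F ⟨x, y⟩ ⟨x', y'⟩ (TensorCat.homTmul (k := k) f g) = F.map (Prod.mkHom f g) :=
  bilinearMap_apply F f g

/-- The linear extension of a bilinear functor to the tensor product. -/
def tensorExt : TensorCat k a b ⥤ D where
  obj P := F.obj (P.left, P.right)
  map {P Q} φ := tensorExtMap F P Q φ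
  map_id P := (tensorExtMap_homTmul F (𝟙 P.left) (𝟙 P.right)).trans (F.map_id _)
  map_comp {P Q R} φ ψ := by
    obtain ⟨x, y⟩ := P
    obtain ⟨x', y'⟩ := Q
    obtain ⟨x'', y''⟩ := R
    induction φ using TensorCat.hom_induction with
    | add φ φ' h h' => rw [Preadditive.add_comp, map_add, h, h', map_add, Preadditive.add_comp]
    | tmul f g =>
      induction ψ using TensorCat.hom_induction with
      | add φ φ' h h' => rw [Preadditive.comp_add, map_add, h, h', map_add, Preadditive.comp_add]
      | tmul f' g' =>
        rw [← TensorCat.homTmul_comp, tensorExtMap_homTmul, tensorExtMap_homTmul,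
          tensorExtMap_homTmul, ← F.map_comp]
        rfl

instance : (tensorExt (k := k) F).Additive := ⟨fun {P Q f g} => map_add (tensorExtMap F P Q) f g⟩

instance : (tensorExt (k := k) F).Linear k :=
  ⟨fun {P Q} f r => map_smul (tensorExtMap F P Q) r f⟩

/-- The linear extension extends. -/
def pairTensorExt : TensorCat.pair k a b ⋙ tensorExt F ≅ F :=
  NatIso.ofComponents (fun _ => Iso.refl _) (fun f =>
    (Category.comp_id _).trans ((tensorExtMap_homTmul F f.1 f.2).trans (Category.id_comp _).symm))

end TensorFunctors

/-- The nerve only depends on the functor up to isomorphism. -/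
def nerveIso {k : Type v} [CommRing k] {c : Type u} [Category.{v} c] [Preadditive c] [Linear k c]
    {D : Type u₄} [Category.{w'} D] [Preadditive D] [Linear k D] [LocallySmall.{v} D]
    {G G' : c ⥤ D} [G.Additive] [G.Linear k] [G'.Additive] [G'.Linear k] (e : G ≅ G') (d : D) :
    (nerve k G).obj d ≅ (nerve k G').obj d :=
  let f {G G' : c ⥤ D} [G.Additive] [G.Linear k] [G'.Additive] [G'.Linear k] (e : G' ⟶ G) :
      (nerve k G).obj d ⟶ (nerve k G').obj d :=
    homToNerve G' (fun X => Linear.leftComp k d (e.app X) ∘ₗ (nerveElt k G X d).symm.toLinearMap)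
      (fun {X Y} h x => by
        obtain ⟨x, rfl⟩ := (nerveElt k G Y d).surjective x
        rw [← nerveElt_comp]
        simp)
  { hom := f e.inv
    inv := f e.hom
    hom_inv_id := PSh.hom_ext fun X x => by
      obtain ⟨x, rfl⟩ := (nerveElt k G X d).surjective x
      change nerveElt k G X d (e.hom.app X ≫ (nerveElt k G' X d).symm (nerveElt k G' X d
        (e.inv.app X ≫ (nerveElt k G X d).symm (nerveElt k G X d x)))) = _
      simp
    inv_hom_id := PSh.hom_ext fun X x => by
      obtain ⟨x, rfl⟩ := (nerveElt k G' X d).surjective x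
      change nerveElt k G' X d (e.inv.app X ≫ (nerveElt k G X d).symm (nerveElt k G X d
        (e.hom.app X ≫ (nerveElt k G' X d).symm (nerveElt k G' X d x)))) = _
      simp }

end LinSh

namespace LinSh

namespace IsLocalisation

variable {k : Type v} [CommRing k] {c : Type u} [Category.{v} c] [Preadditive c] [Linear k c]
  {Q : ObjectProperty (PSh k c)} (h : IsLocalisation Q.ι)

theorem additive_sheafification : h.sheafification.Additive := h.adjunction.left_adjoint_additive

theorem linear_sheafification : h.sheafification.Linear k :=
  have := h.additive_sheafification
  linear_of_adjunction h.adjunction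

end IsLocalisation

instance {k : Type v} [CommRing k] {c : Type u} [Category.{v} c] [Preadditive c] [Linear k c]
    [EssentiallySmall.{v} c] (Q : ObjectProperty (PSh k c)) : LocallySmall.{v} Q.FullSubcategory :=
  locallySmall_of_faithful Q.ι

section Sections

variable {A : Type u₁} [Category.{v} A] {B : Type u₂} [Category.{w} B] {A' : Type u₃}
  [Category.{v₁} A'] {B' : Type u₄} [Category.{v₂} B'] (p : A ⥤ A') (q : B ⥤ B')

/-- Fixing the second variable in a product of functors. -/
def sectLProd (Y : B) : Prod.sectL A Y ⋙ p.prod q ≅ p ⋙ Prod.sectL A' (q.obj Y) :=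
  NatIso.ofComponents (fun _ => Iso.refl _) (fun f =>
    (Category.comp_id _).trans (Eq.trans (congrArg (Prod.mkHom (p.map f)) (q.map_id Y))
      (Category.id_comp _).symm))

/-- Fixing the first variable in a product of functors. -/
def sectRProd (X : A) : Prod.sectR X B ⋙ p.prod q ≅ q ⋙ Prod.sectR (p.obj X) B' :=
  NatIso.ofComponents (fun _ => Iso.refl _) (fun f =>
    (Category.comp_id _).trans (Eq.trans (congrArg (Prod.mkHom · (q.map f)) (p.map_id X))
      (Category.id_comp _).symm))

end Sections

section LinCocont

variable {k : Type v} [CommRing k] {A : Type u₁} [Category.{v₁} A] [Preadditive A] [Linear k A]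
  {B : Type u₂} [Category.{v₂} B] [Preadditive B] [Linear k B]
  {C : Type u₃} [Category.{w} C] [Preadditive C] [Linear k C]

theorem isLinCocont.comp {F : A ⥤ B} {G : B ⥤ C} (hF : isLinCocont k A B F)
    (hG : isLinCocont k B C G) : isLinCocont k A C (F ⋙ G) := by
  obtain ⟨_, _, _⟩ := hF
  obtain ⟨_, _, _⟩ := hG
  exact ⟨inferInstance, inferInstance, inferInstance⟩

theorem isLinCocont.of_iso {F G : A ⥤ B} (e : F ≅ G) (hF : isLinCocont k A B F) :
    isLinCocont k A B G := by
  obtain ⟨_, _, _⟩ := hF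
  have := Functor.additive_of_iso e
  exact ⟨this, Functor.linear_of_iso k e, preservesColimits_of_natIso e⟩

end LinCocont

section BoxTensor

variable {k : Type v} [CommRing k]
  {a : Type u₁} [Category.{v} a] [Preadditive a] [Linear k a]
  {b : Type u₂} [Category.{v} b] [Preadditive b] [Linear k b]
  {A : Type u₃} [Category.{v₁} A] [Preadditive A] [Linear k A]
  {B : Type u₄} [Category.{v₂} B] [Preadditive B] [Linear k B]
  {S₁ : Set (FormalSeq.{v} a)} {S₂ : Set (FormalSeq.{v} b)}
  (ρ₁ : Realisation k A S₁) (ρ₂ : Realisation k B S₂) (h : IsLocalisation (isBoxSheaf k S₁ S₂).ι)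

/-- The bifunctor `A × B ⥤ A ⊠ B`: the sheafified external tensor product. -/
def boxTensor : A × B ⥤ Box k S₁ S₂ :=
  (ρ₁.embedding.prod ρ₂.embedding) ⋙ extFunctor k a b ⋙ h.sheafification

theorem inverted_extMap_left (ρ₁ : Realisation k A S₁) {U V : PSh k a} {i : U ⟶ V}
    (hi : inverted ρ₁.reflection i) (N : PSh k b) : inverted h.sheafification (extMap i (𝟙 N)) :=
  inverted_of_bijective h.adjunction _ fun Z => bijective_of_sliceL _ fun y y' => by
    have := ((isBoxSheaf_iff S₁ S₂ _).1 Z.property).1 y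
    rw [ρ₁.isSheafFor_eq] at this
    exact this _ (inverted_sliceL_extMap ρ₁.adjunction hi N y')

theorem inverted_extMap_right (ρ₂ : Realisation k B S₂) {U V : PSh k b} {i : U ⟶ V}
    (hi : inverted ρ₂.reflection i) (M : PSh k a) : inverted h.sheafification (extMap (𝟙 M) i) :=
  inverted_of_bijective h.adjunction _ fun Z => bijective_of_sliceR _ fun x x' => by
    have := ((isBoxSheaf_iff S₁ S₂ _).1 Z.property).2 x
    rw [ρ₂.isSheafFor_eq] at this
    exact this _ (inverted_sliceR_extMap ρ₂.adjunction hi M x')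

theorem isLinCocont_sheafification : isLinCocont k _ _ h.sheafification :=
  ⟨h.additive_sheafification, h.linear_sheafification, h.adjunction.leftAdjoint_preservesColimits⟩

/-- The bifunctor `boxTensor` commutes with the reflections. -/
def extReflection : extFunctor k a b ⋙ h.sheafification ≅
    (ρ₁.reflection.prod ρ₂.reflection) ⋙ boxTensor ρ₁ ρ₂ h :=
  have (P : PSh k a × PSh k b) : IsIso (h.sheafification.map (extMap
      (ρ₁.adjunction.unit.app P.1) (ρ₂.adjunction.unit.app P.2))) := by
    have h₁ : IsIso _ := inverted_extMap_left h ρ₁ (inverted_unit ρ₁.adjunction P.1) P.2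
    have h₂ : IsIso _ := inverted_extMap_right h ρ₂ (inverted_unit ρ₂.adjunction P.2)
      (ρ₁.embedding.obj (ρ₁.reflection.obj P.1))
    have h₃ := IsIso.comp_isIso' h₁ h₂
    rw [← Functor.map_comp] at h₃
    have e : extMap (ρ₁.adjunction.unit.app P.1) (𝟙 P.2) ≫ extMap (𝟙 _)
        (ρ₂.adjunction.unit.app P.2) = extMap (ρ₁.adjunction.unit.app P.1)
          (ρ₂.adjunction.unit.app P.2) := ext_hom_ext fun _ _ _ _ => rfl
    exact (congrArg (fun f => IsIso (h.sheafification.map f)) e).mp h₃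
  NatIso.ofComponents (fun P => @asIso _ _ _ _ (h.sheafification.map (extMap
      (ρ₁.adjunction.unit.app P.1) (ρ₂.adjunction.unit.app P.2))) (this P)) (fun {P Q} f => by
    refine (h.sheafification.map_comp _ _).symm.trans
      (Eq.trans ?_ (h.sheafification.map_comp _ _))
    congr 1
    refine ((extFunctor k a b).map_comp f (Prod.mkHom (ρ₁.adjunction.unit.app Q.1)
      (ρ₂.adjunction.unit.app Q.2))).symm.trans ?_
    refine Eq.trans ?_ ((extFunctor k a b).map_comp (Prod.mkHom (ρ₁.adjunction.unit.app P.1)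
      (ρ₂.adjunction.unit.app P.2)) _)
    exact congrArg (extFunctor k a b).map
      (Prod.ext (ρ₁.adjunction.unit.naturality f.1) (ρ₂.adjunction.unit.naturality f.2)))

/-- The bifunctor `boxTensor` extends the canonical functor. -/
def genBoxTensor : ρ₁.gen.prod ρ₂.gen ⋙ boxTensor ρ₁ ρ₂ h ≅
    TensorCat.pair k a b ⋙ genFunctor h :=
  (Functor.isoWhiskerLeft ((yonedaPSh k a).prod (yonedaPSh k b)) (extReflection ρ₁ ρ₂ h)).symm ≪≫
    Functor.isoWhiskerRight extYoneda h.sheafification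

theorem extendsGen_boxTensor : ExtendsGen ρ₁ ρ₂ h (boxTensor ρ₁ ρ₂ h) := ⟨genBoxTensor ρ₁ ρ₂ h⟩

variable [EssentiallySmall.{v} a] [EssentiallySmall.{v} b]

theorem isLinCocont₂_boxTensor : isLinCocont₂ k A B _ (boxTensor ρ₁ ρ₂ h) := by
  refine ⟨fun Y => ?_, fun X => ?_⟩
  · exact (isLinCocont_reflective_comp ρ₁.adjunction
      ((isLinCocont_extFunctor_sectL (ρ₂.embedding.obj Y)).comp (isLinCocont_sheafification h))
      fun _ _ _ hi => inverted_extMap_left h ρ₁ hi _).of_iso (Functor.isoWhiskerRight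
        (sectLProd ρ₁.embedding ρ₂.embedding Y) (extFunctor k a b ⋙ h.sheafification)).symm
  · exact (isLinCocont_reflective_comp ρ₂.adjunction
      ((isLinCocont_extFunctor_sectR (ρ₁.embedding.obj X)).comp (isLinCocont_sheafification h))
      fun _ _ _ hi => inverted_extMap_right h ρ₂ hi _).of_iso (Functor.isoWhiskerRight
        (sectRProd ρ₁.embedding ρ₂.embedding X) (extFunctor k a b ⋙ h.sheafification)).symm

variable {D : Type u₅} [Category.{w'} D] [Preadditive D] [Linear k D] [LocallySmall.{v} D]

theorem restrictBijective_gen {H H' : A ⥤ D} (hH : isLinCocont k A D H)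
    (hH' : isLinCocont k A D H') : RestrictBijective ρ₁.gen H H' :=
  have := hH'.1
  have := hH'.2.1
  restrictBijective_reflective ρ₁.adjunction hH

theorem restrictBijective_gen_prod {F F' : A × B ⥤ D} (hF : isLinCocont₂ k A B D F)
    (hF' : isLinCocont₂ k A B D F') : RestrictBijective (ρ₁.gen.prod ρ₂.gen) F F' :=
  RestrictBijective.prod (fun Y Y' => restrictBijective_gen ρ₁ (hF.1 Y) (hF'.1 Y'))
    fun X X' => restrictBijective_gen ρ₂ (hF.2 X) (hF'.2 X')

theorem restrictBijective_genFunctor {H H' : Box k S₁ S₂ ⥤ D} (hH : isLinCocont k _ D H)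
    (hH' : isLinCocont k _ D H') : RestrictBijective (genFunctor h) H H' :=
  have := h.additive_sheafification
  have := h.linear_sheafification
  have := hH'.1
  have := hH'.2.1
  restrictBijective_reflective h.adjunction hH

theorem restrictBijective_boxTensor {H H' : Box k S₁ S₂ ⥤ D} (hH : isLinCocont k _ D H)
    (hH' : isLinCocont k _ D H') : RestrictBijective (boxTensor ρ₁ ρ₂ h) H H' := by
  have hT := isLinCocont₂_boxTensor ρ₁ ρ₂ h
  refine (restrictBijective_gen_prod ρ₁ ρ₂ (hT.comp hH) (hT.comp hH')).of_comp ?_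
  refine RestrictBijective.of_iso ?_ (genBoxTensor ρ₁ ρ₂ h).symm
  have := h.additive_sheafification
  have := hH.1
  have := hH'.1
  have : (genFunctor h).Additive :=
    inferInstanceAs (yonedaPSh k _ ⋙ h.sheafification).Additive
  exact RestrictBijective.comp restrictBijective_pair (restrictBijective_genFunctor h hH hH')

theorem exists_boxTensor_comp_iso [HasColimitsOfSize.{v, v} D] {F : A × B ⥤ D}
    (hF : isLinCocont₂ k A B D F) :
    ∃ H : Box k S₁ S₂ ⥤ D, isLinCocont k _ D H ∧ Nonempty (boxTensor ρ₁ ρ₂ h ⋙ H ≅ F) := by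
  let F₀ := ρ₁.gen.prod ρ₂.gen ⋙ F
  have : ρ₁.gen.Additive := inferInstanceAs (yonedaPSh k a ⋙ ρ₁.reflection).Additive
  have : ρ₂.gen.Additive := inferInstanceAs (yonedaPSh k b ⋙ ρ₂.reflection).Additive
  have : ρ₁.gen.Linear k := inferInstanceAs ((yonedaPSh k a ⋙ ρ₁.reflection).Linear k)
  have : ρ₂.gen.Linear k := inferInstanceAs ((yonedaPSh k b ⋙ ρ₂.reflection).Linear k)
  let eL (y : b) : ρ₁.gen ⋙ Prod.sectL A (ρ₂.gen.obj y) ⋙ F ≅ Prod.sectL a y ⋙ F₀ :=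
    (Functor.isoWhiskerRight (sectLProd ρ₁.gen ρ₂.gen y) F).symm
  let eR (x : a) : ρ₂.gen ⋙ Prod.sectR (ρ₁.gen.obj x) B ⋙ F ≅ Prod.sectR x b ⋙ F₀ :=
    (Functor.isoWhiskerRight (sectRProd ρ₁.gen ρ₂.gen x) F).symm
  have aL (y : b) : (Prod.sectL a y ⋙ F₀).Additive :=
    have := (hF.1 (ρ₂.gen.obj y)).1
    Functor.additive_of_iso (eL y)
  have lL (y : b) : (Prod.sectL a y ⋙ F₀).Linear k :=
    have := (hF.1 (ρ₂.gen.obj y)).1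
    have := (hF.1 (ρ₂.gen.obj y)).2.1
    Functor.linear_of_iso k (eL y)
  have aR (x : a) : (Prod.sectR x b ⋙ F₀).Additive :=
    have := (hF.2 (ρ₁.gen.obj x)).1
    Functor.additive_of_iso (eR x)
  have lR (x : a) : (Prod.sectR x b ⋙ F₀).Linear k :=
    have := (hF.2 (ρ₁.gen.obj x)).1
    have := (hF.2 (ρ₁.gen.obj x)).2.1
    Functor.linear_of_iso k (eR x)
  have hG (d : D) : isBoxSheaf k S₁ S₂ ((nerve k (tensorExt (k := k) F₀)).obj d) := by
    rw [isBoxSheaf_iff]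
    constructor
    · intro y
      let e : ρ₁.gen ⋙ Prod.sectL A (ρ₂.gen.obj y) ⋙ F ≅ inclL k a y ⋙ tensorExt (k := k) F₀ :=
        eL y ≪≫ Functor.isoWhiskerLeft (Prod.sectL a y) (pairTensorExt F₀).symm
      have hy := hF.1 (ρ₂.gen.obj y)
      have := hy.1
      have := hy.2.1
      refine (isSheafFor k S₁).prop_of_iso (nerveIso (k := k) e d) ?_
      rw [ρ₁.isSheafFor_eq]
      exact isLocal_nerve ρ₁.adjunction hy d
    · intro x
      let e : ρ₂.gen ⋙ Prod.sectR (ρ₁.gen.obj x) B ⋙ F ≅ inclR k b x ⋙ tensorExt (k := k) F₀ :=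
        eR x ≪≫ Functor.isoWhiskerLeft (Prod.sectR x b) (pairTensorExt F₀).symm
      have hx := hF.2 (ρ₁.gen.obj x)
      have := hx.1
      have := hx.2.1
      refine (isSheafFor k S₂).prop_of_iso (nerveIso (k := k) e d) ?_
      rw [ρ₂.isSheafFor_eq]
      exact isLocal_nerve ρ₂.adjunction hx d
  obtain ⟨H, hH, ⟨e⟩⟩ := exists_extension h.adjunction (tensorExt (k := k) F₀) hG
  refine ⟨H, hH, ?_⟩
  have hT := (isLinCocont₂_boxTensor ρ₁ ρ₂ h).comp hH
  refine RestrictBijective.nonempty_iso (p := ρ₁.gen.prod ρ₂.gen) ?_ ?_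
  · rintro X (rfl | rfl) Y (rfl | rfl) <;> apply restrictBijective_gen_prod <;> assumption
  · exact Functor.isoWhiskerRight (genBoxTensor ρ₁ ρ₂ h) H ≪≫
      Functor.isoWhiskerLeft (TensorCat.pair k a b) e ≪≫ pairTensorExt F₀

theorem isEquivalence_precomp_boxTensor [HasColimitsOfSize.{v, v} D] :
    (precomp (isLinCocont₂_boxTensor ρ₁ ρ₂ h) D).IsEquivalence where
  faithful := ⟨fun {H H'} α α' hα => ObjectProperty.hom_ext _
    ((restrictBijective_boxTensor ρ₁ ρ₂ h H.property H'.property).1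
      (congrArg (fun f => f.hom) hα))⟩
  full := ⟨fun {H H'} β => by
    obtain ⟨α, hα⟩ := (restrictBijective_boxTensor ρ₁ ρ₂ h H.property H'.property).2 β.hom
    exact ⟨ObjectProperty.homMk α, ObjectProperty.hom_ext _ hα⟩⟩
  essSurj := ⟨fun F => by
    obtain ⟨H, hH, ⟨e⟩⟩ := exists_boxTensor_comp_iso ρ₁ ρ₂ h F.property
    exact ⟨⟨H, hH⟩, ⟨ObjectProperty.isoMk _ e⟩⟩⟩

end BoxTensor

end LinSh

namespace LinSh

section Creator

variable {k : Type v} [CommRing k] {c : Type u} [Category.{v} c] [Preadditive c] [Linear k c]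
  {C : Type u₁} [Category.{v₁} C] [Preadditive C] [Linear k C]
  {L : PSh k c ⥤ C} {R : C ⥤ PSh k c} [R.Additive] [R.Linear k]

/-- Morphisms out of the reflection of a representable presheaf. -/
def reflYonedaEquiv (adj : L ⊣ R) (X : c) (M : C) :
    ((yonedaPSh k c ⋙ L).obj X ⟶ M) ≃ₗ[k] (R.obj M).obj.obj (op X) :=
  LinearEquiv.trans
    { adj.homEquiv ((yonedaPSh k c).obj X) M with
      map_add' := fun f g => by
        change adj.homEquiv _ _ _ = adj.homEquiv _ _ _ + adj.homEquiv _ _ _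
        rw [adj.homEquiv_unit, adj.homEquiv_unit, adj.homEquiv_unit, R.map_add,
          Preadditive.comp_add]
      map_smul' := fun r f => by
        change adj.homEquiv _ _ _ = r • adj.homEquiv _ _ _
        rw [adj.homEquiv_unit, adj.homEquiv_unit, R.map_smul, Linear.comp_smul] }
    (yonedaEquivPSh X (R.obj M))

theorem reflYonedaEquiv_comp (adj : L ⊣ R) {X : c} {M N : C}
    (f : (yonedaPSh k c ⋙ L).obj X ⟶ M) (g : M ⟶ N) :
    reflYonedaEquiv adj X N (f ≫ g) =
      ((R.map g).hom.app (op X)).hom (reflYonedaEquiv adj X M f) :=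
  (congrArg (yonedaEquivPSh X (R.obj N)) (adj.homEquiv_naturality_right f g)).trans
    (yonedaEquivPSh_comp _ _)

theorem reflYonedaEquiv_map (adj : L ⊣ R) {X Y : c} (s : X ⟶ Y) {M : C}
    (f : (yonedaPSh k c ⋙ L).obj Y ⟶ M) :
    reflYonedaEquiv adj X M ((yonedaPSh k c ⋙ L).map s ≫ f) =
      ((R.obj M).obj.map s.op).hom (reflYonedaEquiv adj Y M f) :=
  (congrArg (yonedaEquivPSh X (R.obj M)) (adj.homEquiv_naturality_left _ f)).trans
    (yonedaEquivPSh_map _ _)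

/-- The values of `R M` corepresented by the reflections of representable presheaves. -/
def uliftCoyonedaReflIso (adj : L ⊣ R) (X : c) :
    uliftCoyoneda.{v}.obj (op ((yonedaPSh k c ⋙ L).obj X)) ≅
      (R ⋙ (isLinearPresheaf k c).ι ⋙ (evaluation _ _).obj (op X) ⋙
        forget (ModuleCat.{v} k)) ⋙ uliftFunctor.{v₁} :=
  NatIso.ofComponents (fun M => (Equiv.ulift.trans
    ((reflYonedaEquiv adj X M).toEquiv.trans Equiv.ulift.symm)).toIso) (fun {M N} g => by
      ext f
      exact congrArg ULift.up (reflYonedaEquiv_comp adj f.down g))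

theorem isCardinalPresentable_iff (adj : L ⊣ R) (κ : Cardinal.{v}) [Fact κ.IsRegular] (X : c) :
    IsCardinalPresentable ((yonedaPSh k c ⋙ L).obj X) κ ↔
      (R ⋙ (isLinearPresheaf k c).ι ⋙ (evaluation _ _).obj (op X)).IsCardinalAccessible κ := by
  rw [isCardinalPresentable_iff_isCardinalAccessible_uliftCoyoneda_obj.{v}]
  constructor
  · intro h
    refine ⟨fun J _ _ => ?_⟩
    have := isFiltered_of_isCardinalFiltered J κ
    have := (uliftCoyoneda.{v}.obj (op ((yonedaPSh k c ⋙
      L).obj X))).preservesColimitsOfShape_of_isCardinalAccessible κ J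
    have : PreservesColimitsOfShape J (((R ⋙ (isLinearPresheaf k c).ι ⋙
        (evaluation _ _).obj (op X)) ⋙ forget (ModuleCat.{v} k)) ⋙ uliftFunctor.{v₁}) :=
      preservesColimitsOfShape_of_natIso (uliftCoyonedaReflIso adj X)
    have : PreservesColimitsOfShape J ((R ⋙ (isLinearPresheaf k c).ι ⋙
        (evaluation _ _).obj (op X)) ⋙ forget (ModuleCat.{v} k)) :=
      preservesColimitsOfShape_of_reflects_of_preserves _ uliftFunctor.{v₁, v}
    have : ReflectsColimitsOfShape J (forget (ModuleCat.{v} k)) :=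
      reflectsColimitsOfShape_of_reflectsIsomorphisms
    exact preservesColimitsOfShape_of_reflects_of_preserves _ (forget (ModuleCat.{v} k))
  · intro h
    refine ⟨fun J _ _ => ?_⟩
    have := isFiltered_of_isCardinalFiltered J κ
    have := (R ⋙ (isLinearPresheaf k c).ι ⋙
      (evaluation _ _).obj (op X)).preservesColimitsOfShape_of_isCardinalAccessible κ J
    have : PreservesColimitsOfShape J ((R ⋙ (isLinearPresheaf k c).ι ⋙
        (evaluation _ _).obj (op X) ⋙ forget (ModuleCat.{v} k)) ⋙ uliftFunctor.{v₁}) :=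
      inferInstanceAs (PreservesColimitsOfShape J ((R ⋙ (isLinearPresheaf k c).ι ⋙
        (evaluation _ _).obj (op X)) ⋙ forget (ModuleCat.{v} k) ⋙ uliftFunctor.{v₁}))
    exact preservesColimitsOfShape_of_natIso (uliftCoyonedaReflIso adj X).symm

end Creator

theorem isCreator_genFunctor {k : Type v} [CommRing k] {c : Type u} [Category.{v} c]
    [Preadditive c] [Linear k c] {Q : ObjectProperty (PSh k c)} (h : IsLocalisation Q.ι) :
    IsCreator k (genFunctor h) := by
  have := h.additive_sheafification
  have := h.linear_sheafification
  exact ⟨inferInstanceAs (yonedaPSh k c ⋙ h.sheafification).Additive,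
    inferInstanceAs ((yonedaPSh k c ⋙ h.sheafification).Linear k), Q.ι,
    reflYonedaEquiv h.adjunction, fun _ _ _ g f => reflYonedaEquiv_comp h.adjunction f g,
    fun _ _ s _ f => reflYonedaEquiv_map h.adjunction s f, h⟩

section Compact

variable {k : Type v} [CommRing k] (κ : Cardinal.{v}) [Fact κ.IsRegular]

theorem Realisation.isClosedUnderColimitsOfShape {c : Type u} [Category.{v} c] [Preadditive c]
    [Linear k c] {C : Type u₁} [Category.{v₁} C] [Preadditive C] [Linear k C]
    [HasColimitsOfSize.{v, v} C] {S : Set (FormalSeq.{v} c)} (ρ : Realisation k C S)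
    (h : ∀ X, IsCardinalPresentable (ρ.gen.obj X) κ) (J : Type v) [SmallCategory J]
    [IsCardinalFiltered J κ] : (isSheafFor k S).IsClosedUnderColimitsOfShape J := by
  have : PreservesColimitsOfShape J (ρ.embedding ⋙ (isLinearPresheaf k c).ι) :=
    preservesColimitsOfShape_of_evaluation _ _ fun X =>
      have := (isCardinalPresentable_iff ρ.adjunction κ X.unop).1 (h X.unop)
      (ρ.embedding ⋙ (isLinearPresheaf k c).ι ⋙
        (evaluation _ _).obj X).preservesColimitsOfShape_of_isCardinalAccessible κ J
  have : PreservesColimitsOfShape J ρ.embedding :=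
    preservesColimitsOfShape_of_reflects_of_preserves _ (isLinearPresheaf k c).ι
  have e : isSheafFor k S = ρ.embedding.essImage := by
    ext F
    constructor
    · intro hF
      rw [ρ.isSheafFor_eq] at hF
      have := isIso_unit_of_isLocal ρ.adjunction hF
      exact ⟨_, ⟨(asIso (ρ.adjunction.unit.app F)).symm⟩⟩
    · rintro ⟨M, ⟨e⟩⟩
      exact (isSheafFor k S).prop_of_iso e (ρ.equiv.functor.obj M).property
  rw [e]
  infer_instance

theorem isCompactCreator_box {a : Type u₁} [Category.{v} a] [Preadditive a] [Linear k a]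
    {b : Type u₂} [Category.{v} b] [Preadditive b] [Linear k b]
    {S₁ : Set (FormalSeq.{v} a)} {S₂ : Set (FormalSeq.{v} b)}
    (h : IsLocalisation (isBoxSheaf k S₁ S₂).ι)
    (h₁ : ∀ (J : Type v) [SmallCategory J] [IsCardinalFiltered J κ],
      (isSheafFor k S₁).IsClosedUnderColimitsOfShape J)
    (h₂ : ∀ (J : Type v) [SmallCategory J] [IsCardinalFiltered J κ],
      (isSheafFor k S₂).IsClosedUnderColimitsOfShape J) :
    IsCompactCreator k κ (genFunctor h) := by
  refine ⟨isCreator_genFunctor h, fun X => (isCardinalPresentable_iff h.adjunction κ X).2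
    ⟨fun J _ _ => ?_⟩⟩
  have := h₁ J
  have := h₂ J
  have : (isBoxSheaf k S₁ S₂).IsClosedUnderColimitsOfShape J := ⟨by
    rintro Z ⟨t⟩
    rw [isBoxSheaf_iff]
    exact ⟨fun y => ObjectProperty.prop_of_isColimit _ (isColimitOfPreserves (sliceL k a y)
        t.isColimit) fun j => ((isBoxSheaf_iff S₁ S₂ _).1 (t.prop_diag_obj j)).1 y,
      fun x => ObjectProperty.prop_of_isColimit _ (isColimitOfPreserves (sliceR k b x)
        t.isColimit) fun j => ((isBoxSheaf_iff S₁ S₂ _).1 (t.prop_diag_obj j)).2 x⟩⟩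
  infer_instance

end Compact

/-- Two Kelly tensor products of the same categories, as categories of box sheaves, are
equivalent. -/
theorem exists_boxEquivalence {k : Type v} [CommRing k]
    {A : Type u₁} [Category.{v₁} A] [Preadditive A] [Linear k A]
    {B : Type u₂} [Category.{v₂} B] [Preadditive B] [Linear k B]
    {a : Type u₃} [Category.{v} a] [Preadditive a] [Linear k a] [EssentiallySmall.{v} a]
    {b : Type u₄} [Category.{v} b] [Preadditive b] [Linear k b] [EssentiallySmall.{v} b]
    {a' : Type u₅} [Category.{v} a'] [Preadditive a'] [Linear k a'] [EssentiallySmall.{v} a']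
    {b' : Type u₆} [Category.{v} b'] [Preadditive b'] [Linear k b'] [EssentiallySmall.{v} b']
    {S₁ : Set (FormalSeq.{v} a)} {S₂ : Set (FormalSeq.{v} b)}
    {S₁' : Set (FormalSeq.{v} a')} {S₂' : Set (FormalSeq.{v} b')}
    (ρ₁ : Realisation k A S₁) (ρ₂ : Realisation k B S₂)
    (ρ₁' : Realisation k A S₁') (ρ₂' : Realisation k B S₂')
    (h : IsLocalisation (isBoxSheaf k S₁ S₂).ι) (h' : IsLocalisation (isBoxSheaf k S₁' S₂').ι) :
    ∃ E : Box k S₁ S₂ ≌ Box k S₁' S₂', E.functor.Additive ∧ E.functor.Linear k ∧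
      Nonempty (boxTensor ρ₁ ρ₂ h ⋙ E.functor ≅ boxTensor ρ₁' ρ₂' h') := by
  have := h.hasColimits
  have := h'.hasColimits
  obtain ⟨H, hH, ⟨e⟩⟩ := exists_boxTensor_comp_iso ρ₁ ρ₂ h (isLinCocont₂_boxTensor ρ₁' ρ₂' h')
  obtain ⟨H', hH', ⟨e'⟩⟩ := exists_boxTensor_comp_iso ρ₁' ρ₂' h' (isLinCocont₂_boxTensor ρ₁ ρ₂ h)
  have hid {C : Type (max u₃ u₄ (v + 1))} [Category.{max u₃ u₄ v} C] [Preadditive C] [Linear k C] :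
      isLinCocont k C C (𝟭 C) := ⟨inferInstance, inferInstance, inferInstance⟩
  have hid' {C : Type (max u₅ u₆ (v + 1))} [Category.{max u₅ u₆ v} C] [Preadditive C]
      [Linear k C] : isLinCocont k C C (𝟭 C) := ⟨inferInstance, inferInstance, inferInstance⟩
  obtain ⟨η⟩ : Nonempty (H ⋙ H' ≅ 𝟭 _) := by
    refine RestrictBijective.nonempty_iso (p := boxTensor ρ₁ ρ₂ h) ?_
      (Functor.isoWhiskerRight e H' ≪≫ e')
    have := hH.comp hH'
    rintro X (rfl | rfl) Y (rfl | rfl) <;> apply restrictBijective_boxTensor <;>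
      first | exact hid | assumption
  obtain ⟨ε⟩ : Nonempty (H' ⋙ H ≅ 𝟭 _) := by
    refine RestrictBijective.nonempty_iso (p := boxTensor ρ₁' ρ₂' h') ?_
      (Functor.isoWhiskerRight e' H ≪≫ e)
    have := hH'.comp hH
    rintro X (rfl | rfl) Y (rfl | rfl) <;> apply restrictBijective_boxTensor <;>
      first | exact hid' | assumption
  exact ⟨CategoryTheory.Equivalence.mk H H' η.symm ε, hH.1, hH.2.1, ⟨e⟩⟩

end LinSh

end

theorem mainTheorem10
    {k : Type v} [CommRing k]
    -- two `k`-linear Grothendieck categories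
    {A : Type u₁} [Category.{v₁} A] [Abelian A] [Linear k A] [IsGrothendieckAbelian.{v} A]
    {B : Type u₂} [Category.{v₂} B] [Abelian B] [Linear k B] [IsGrothendieckAbelian.{v} B]
    -- realisations of them as sheaf categories
    {a : Type u₃} [Category.{v} a] [Preadditive a] [Linear k a] [EssentiallySmall.{v} a]
    {b : Type u₄} [Category.{v} b] [Preadditive b] [Linear k b] [EssentiallySmall.{v} b]
    {S₁ : Set (LinSh.FormalSeq.{v} a)} {S₂ : Set (LinSh.FormalSeq.{v} b)}
    (R₁ : LinSh.Realisation k A S₁) (R₂ : LinSh.Realisation k B S₂) :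
    -- (i) localisation, so in particular a Grothendieck category
    ∃ hloc : LinSh.IsLocalisation (LinSh.isBoxSheaf k S₁ S₂).ι,
      LinSh.IsGrothendieckCat.{v} (LinSh.Box k S₁ S₂) ∧
      -- (ii) Kelly product
      (∃ T : A × B ⥤ LinSh.Box k S₁ S₂,
        LinSh.IsKellyProduct.{v, _, w', _, _, _, u} k T ∧
        LinSh.ExtendsGen R₁ R₂ hloc T ∧
        -- independence of the choice of realisations
        ∀ (a' : Type u₅) [Category.{v} a'] [Preadditive a'] [Linear k a'] [EssentiallySmall.{v} a']
          (b' : Type u₆) [Category.{v} b'] [Preadditive b'] [Linear k b'] [EssentiallySmall.{v} b']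
          (S₁' : Set (LinSh.FormalSeq.{v} a')) (S₂' : Set (LinSh.FormalSeq.{v} b'))
          (R₁' : LinSh.Realisation k A S₁') (R₂' : LinSh.Realisation k B S₂'),
          ∃ (hloc' : LinSh.IsLocalisation (LinSh.isBoxSheaf k S₁' S₂').ι)
            (E : LinSh.Box k S₁ S₂ ≌ LinSh.Box k S₁' S₂'),
            E.functor.Additive ∧ Functor.Linear k E.functor ∧
              LinSh.ExtendsGen R₁' R₂' hloc' (T ⋙ E.functor)) ∧
      -- (iii) compact creators
      (∀ (κ : Cardinal.{v}) [Fact κ.IsRegular],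
        LinSh.IsCompactCreator k κ R₁.gen → LinSh.IsCompactCreator k κ R₂.gen →
          LinSh.IsCompactCreator k κ (LinSh.genFunctor hloc)) := by
  have hloc := LinSh.isLocalisation_box R₁ R₂
  refine ⟨hloc, hloc.isGrothendieckCat, ⟨LinSh.boxTensor R₁ R₂ hloc,
    ⟨hloc.hasColimits, LinSh.isLinCocont₂_boxTensor R₁ R₂ hloc, ?_⟩,
    LinSh.extendsGen_boxTensor R₁ R₂ hloc, ?_⟩, ?_⟩
  · intro D _ _ _ _ _
    exact LinSh.isEquivalence_precomp_boxTensor R₁ R₂ hloc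
  · intro a' _ _ _ _ b' _ _ _ _ S₁' S₂' R₁' R₂'
    have hloc' := LinSh.isLocalisation_box R₁' R₂'
    obtain ⟨E, hE, hE', ⟨e⟩⟩ := LinSh.exists_boxEquivalence R₁ R₂ R₁' R₂' hloc hloc'
    exact ⟨hloc', E, hE, hE', ⟨Functor.isoWhiskerLeft (R₁'.gen.prod R₂'.gen) e ≪≫
      LinSh.genBoxTensor R₁' R₂' hloc'⟩⟩
  · intro κ _ h₁ h₂
    exact LinSh.isCompactCreator_box κ hloc
      (fun J _ _ => R₁.isClosedUnderColimitsOfShape κ h₁.2 J)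
      (fun J _ _ => R₂.isClosedUnderColimitsOfShape κ h₂.2 J)
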